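/- Let $\mathbb{R}^4_2$ be $\mathbb{R}^4$ with the metric $\langle x,y\rangle=-x_1y_1-x_2y_2+x_3y_3+x_4y_4$, and let $\mathbb{H}^3_1=\{x\in\mathbb{R}^4_2:\langle x,x\rangle=-1\}$. Let $M$ be a connected smooth surface and $\psi:M\to\mathbb{H}^3_1\subset\mathbb{R}^4_2$ a smooth immersion with non-degenerate (Riemannian or Lorentzian) induced metric, oriented by a smooth unit normal field $N$ in $\mathbb{H}^3_1$, $\langle N,N\rangle=\varepsilon=\pm1$. Let $SX=-dN(X)$ be the shape operator, $H=\frac{\varepsilon}{2}\operatorname{tr}S$ the mean curvature, $K$ the Gaussian curvature of the induced metric, $P_1=-2\varepsilon H I+S$, and $L_1f=\operatorname{tr}(P_1\circ\nabla^2f)$ for $f\in C^\infty(M)$, where $\nabla^2 f(X)=\nabla_X\nabla f$. On vector-valued functions $L_1$ acts componentwise. Assume that $\psi$ is of $L_1$-2-type, that is, $\psi=a+\psi_1+\psi_2$ with $a\in\mathbb{R}^4_2$ constant, $\psi_1,\psi_2:M\to\mathbb{R}^4_2$ smooth and non-constant, $L_1\psi_i=\lambda_i\psi_i$ $(i=1,2)$,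 $\lambda_1,\lambda_2\in\mathbb{R}$ and $\lambda_1\ne\lambda_2$. Then one of the following holds. 1. Up to a linear isometry of $\mathbb{R}^4_2$, $\psi(M)$ is an open subset of one of the products $\mathbb{S}^1_1(r)\times\mathbb{H}^1(-\sqrt{r^2+1})=\{-x_1^2+x_3^2=r^2,\ -x_2^2+x_4^2=-(r^2+1)\}$ with $r>0$, $\mathbb{H}^1(-r)\times\mathbb{H}^1(-\sqrt{1-r^2})=\{-x_1^2+x_3^2=-r^2,\ -x_2^2+x_4^2=-(1-r^2)\}$ with $0<r<1$, or $\mathbb{H}^1_1(-r)\times\mathbb{S}^1(\sqrt{r^2-1})=\{-x_1^2-x_2^2=-r^2,\ x_3^2+x_4^2=r^2-1\}$ with $r>1$. 2. $M$ is a non-flat $B$-scroll over a null curve, in the following sense: $K$ vanishes nowhere, $M$ has a non-umbilical point, and there is a constant $a_0\neq0$ such that every point of $M$ has a neighbourhood with smooth coordinates $(s,u)$, $s$ in an open interval $I$, in which $\psi(s,u)=\gamma(s)+uB(s)$. Here $\gamma:I\to\mathbb{H}^3_1$ is a null curve with smooth vector fields $A=\gamma',B,C$ along $\gamma$, tangent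 to $\mathbb{H}^3_1$, such that $\langle A,A\rangle=\langle B,B\rangle=\langle A,C\rangle=\langle B,C\rangle=0$, $\langle A,B\rangle=-1$, $\langle C,C\rangle=1$ and $C'=-a_0A-\kappa B$ for a smooth function $\kappa$ on $I$; and $\kappa$ can be taken nowhere zero if the point is not umbilical. 3. $H$ is not constant on $M$, $K$ is not constant on $M$, and no real constant is a principal curvature (an eigenvalue of $S$) at every point of $M$. -/

import Mathlib

open scoped Manifold ContDiff

noncomputable section

namespace AdSSurface

/-- The underlying vector space of the pseudo-Euclidean space `R^4_2`. -/
abbrev R42 : Type := Fin 4 → ℝ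

/-- The flat metric of index two, `-dx₁² - dx₂² + dx₃² + dx₄²`. -/
def ip : LinearMap.BilinForm ℝ R42 :=
  LinearMap.mk₂ ℝ
    (fun x y : R42 => -(x 0 * y 0) - x 1 * y 1 + x 2 * y 2 + x 3 * y 3)
    (by intro x x' y; simp only [Pi.add_apply]; ring)
    (by intro c x y; simp only [Pi.smul_apply, smul_eq_mul]; ring)
    (by intro x y y'; simp only [Pi.add_apply]; ring)
    (by intro c x y; simp only [Pi.smul_apply, smul_eq_mul]; ring)

/-- Anti de Sitter space `H^3_1 ⊂ R^4_2`. -/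
def AdS : Set R42 := {x | ip x x = -1}

variable {M : Type*} [TopologicalSpace M] [ChartedSpace (EuclideanSpace ℝ (Fin 2)) M]

/-- The differential at `p` of an `R42`-valued map. -/
def diff (F : M → R42) (p : M) : TangentSpace (𝓡 2) p →ₗ[ℝ] R42 :=
  ContinuousLinearMap.toLinearMap (M₂ := R42) (mfderiv (𝓡 2) 𝓘(ℝ, R42) F p)

/-- The differential at `p` of a real function. -/
def diffFun (f : M → ℝ) (p : M) : Module.Dual ℝ (TangentSpace (𝓡 2) p) :=
  ContinuousLinearMap.toLinearMap (M₂ := ℝ) (mfderiv (𝓡 2) 𝓘(ℝ, ℝ) f p)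

/-- The bilinear form induced on the tangent plane at `p` by a map into `R^4_2`. -/
def firstForm (F : M → R42) (p : M) : LinearMap.BilinForm ℝ (TangentSpace (𝓡 2) p) :=
  ip.comp (diff F p) (diff F p)

instance instFiniteDimensionalTangent (p : M) :
    FiniteDimensional ℝ (TangentSpace (𝓡 2) p) :=
  inferInstanceAs (FiniteDimensional ℝ (EuclideanSpace ℝ (Fin 2)))

variable (M) in
/-- A smooth non-degenerate surface immersed in anti de Sitter space, oriented by a smooth unit
normal field `N`, where `⟨N, N⟩ = ε = ±1`. Non-degeneracy of the induced metric makes `ψ` an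
immersion; the surface is Riemannian if `ε = -1` and Lorentzian if `ε = 1`. -/
structure OrientedSurface where
  ψ : M → R42
  N : M → R42
  ε : ℝ
  smooth_ψ : ContMDiff (𝓡 2) 𝓘(ℝ, R42) ∞ ψ
  mem_AdS : ∀ p, ψ p ∈ AdS
  nondegenerate : ∀ p, (firstForm ψ p).Nondegenerate
  smooth_N : ContMDiff (𝓡 2) 𝓘(ℝ, R42) ∞ N
  eps_eq : ε = 1 ∨ ε = -1
  ip_N_N : ∀ p, ip (N p) (N p) = ε
  ip_N_ψ : ∀ p, ip (N p) (ψ p) = 0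
  ip_N_tangent : ∀ p (X : TangentSpace (𝓡 2) p), ip (N p) (diff ψ p X) = 0

namespace OrientedSurface

variable (W : OrientedSurface M)

/-- The induced metric identifies tangent vectors with covectors. -/
def flat (p : M) : TangentSpace (𝓡 2) p ≃ₗ[ℝ] Module.Dual ℝ (TangentSpace (𝓡 2) p) :=
  (firstForm W.ψ p).toDual (W.nondegenerate p)

/-- The tangential component of a vector of `R^4_2`, as an element of the tangent plane:
the unique `Y` with `⟨dψ Y, dψ Z⟩ = ⟨v, dψ Z⟩` for all `Z`. -/
def tang (p : M) : R42 →ₗ[ℝ] TangentSpace (𝓡 2) p :=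
  (W.flat p).symm.toLinearMap ∘ₗ (diff W.ψ p).dualMap ∘ₗ ip

/-- The shape operator, `S X = -dN(X)`. -/
def shape (p : M) : Module.End ℝ (TangentSpace (𝓡 2) p) :=
  -(W.tang p ∘ₗ diff W.N p)

/-- The mean curvature `H = (ε / 2) tr S`. -/
def meanCurv (p : M) : ℝ := W.ε / 2 * LinearMap.trace ℝ _ (W.shape p)

/-- The Newton transformation `P₁ = -2 ε H I + S`. -/
def newton (p : M) : Module.End ℝ (TangentSpace (𝓡 2) p) :=
  (-2 * W.ε * W.meanCurv p) • LinearMap.id + W.shape p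

/-- The gradient of a function with respect to the induced metric. -/
def grad (f : M → ℝ) (p : M) : TangentSpace (𝓡 2) p := (W.flat p).symm (diffFun f p)

/-- The gradient seen as an `R^4_2`-valued vector field along `ψ`. -/
def gradField (f : M → ℝ) (p : M) : R42 := diff W.ψ p (W.grad f p)

/-- The Hessian operator `X ↦ ∇_X ∇f`; the Levi-Civita connection of the surface is the
tangential part of the derivative in the flat space `R^4_2`. -/
def hess (f : M → ℝ) (p : M) : Module.End ℝ (TangentSpace (𝓡 2) p) :=
  W.tang p ∘ₗ diff (W.gradField f) p

/-- The Cheng-Yau operator `L₁ f = tr (P₁ ∘ ∇²f)`. -/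
def L1 (f : M → ℝ) (p : M) : ℝ := LinearMap.trace ℝ _ (W.newton p ∘ₗ W.hess f p)

/-- `L₁` acting on vector-valued functions, componentwise. -/
def L1vec (F : M → R42) (p : M) : R42 := fun i => W.L1 (fun q => F q i) p

/-- The surface is of `L₁`-2-type. -/
def IsL1TwoType : Prop :=
  ∃ (a : R42) (ψ₁ ψ₂ : M → R42) (l₁ l₂ : ℝ),
    ContMDiff (𝓡 2) 𝓘(ℝ, R42) ∞ ψ₁ ∧ ContMDiff (𝓡 2) 𝓘(ℝ, R42) ∞ ψ₂ ∧
    (¬ ∃ v, ∀ p, ψ₁ p = v) ∧ (¬ ∃ v, ∀ p, ψ₂ p = v) ∧ l₁ ≠ l₂ ∧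
    (∀ p, W.ψ p = a + ψ₁ p + ψ₂ p) ∧
    (∀ p, W.L1vec ψ₁ p = l₁ • ψ₁ p) ∧ (∀ p, W.L1vec ψ₂ p = l₂ • ψ₂ p)

/-- The point `p` is umbilical. -/
def IsUmbilical (p : M) : Prop := ∃ k : ℝ, W.shape p = k • LinearMap.id

/-- The coefficient `⟨∂ᵢ, ∂ⱼ⟩` of the induced metric, as a function of the coordinates of the
chart around `p`. -/
def metricCoeff (p : M) (i j : Fin 2) (x : EuclideanSpace ℝ (Fin 2)) : ℝ :=
  ip (fderiv ℝ (W.ψ ∘ (extChartAt (𝓡 2) p).symm) x (EuclideanSpace.single i 1))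
    (fderiv ℝ (W.ψ ∘ (extChartAt (𝓡 2) p).symm) x (EuclideanSpace.single j 1))

end OrientedSurface

/-- Partial derivative on the coordinate plane. -/
def partialD (i : Fin 2) (f : EuclideanSpace ℝ (Fin 2) → ℝ) (x : EuclideanSpace ℝ (Fin 2)) : ℝ :=
  fderiv ℝ f x (EuclideanSpace.single i 1)

/-- The Gaussian curvature of the metric `E du² + 2 F du dv + G dv²`, by the Brioschi formula
(valid for every non-degenerate metric). -/
def brioschi (E F G : EuclideanSpace ℝ (Fin 2) → ℝ) (x : EuclideanSpace ℝ (Fin 2)) : ℝ :=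
  (Matrix.det
      !![-(partialD 1 (partialD 1 E) x) / 2 + partialD 0 (partialD 1 F) x
            - partialD 0 (partialD 0 G) x / 2,
          partialD 0 E x / 2, partialD 0 F x - partialD 1 E x / 2;
        partialD 1 F x - partialD 0 G x / 2, E x, F x;
        partialD 1 G x / 2, F x, G x]
    - Matrix.det
      !![0, partialD 1 E x / 2, partialD 0 G x / 2;
        partialD 1 E x / 2, E x, F x;
        partialD 0 G x / 2, F x, G x])
    / (E x * G x - F x ^ 2) ^ 2

/-- The (intrinsic) Gaussian curvature of the induced metric. -/
def OrientedSurface.gaussCurv (W : OrientedSurface M) (p : M) : ℝ :=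
  brioschi (W.metricCoeff p 0 0) (W.metricCoeff p 0 1) (W.metricCoeff p 1 1)
    (extChartAt (𝓡 2) p p)

/-- `S^1_1(r) × H^1(-√(r² + 1))`. -/
def prodSH (r : ℝ) : Set R42 :=
  {x | -(x 0) ^ 2 + (x 2) ^ 2 = r ^ 2 ∧ -(x 1) ^ 2 + (x 3) ^ 2 = -(r ^ 2 + 1)}

/-- `H^1(-r) × H^1(-√(1 - r²))`. -/
def prodHH (r : ℝ) : Set R42 :=
  {x | -(x 0) ^ 2 + (x 2) ^ 2 = -r ^ 2 ∧ -(x 1) ^ 2 + (x 3) ^ 2 = -(1 - r ^ 2)}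

/-- `H^1_1(-r) × S^1(√(r² - 1))`. -/
def prodHS (r : ℝ) : Set R42 :=
  {x | -(x 0) ^ 2 - (x 1) ^ 2 = -r ^ 2 ∧ (x 2) ^ 2 + (x 3) ^ 2 = r ^ 2 - 1}

/-- `P` is one of the standard pseudo-Riemannian products in `H^3_1`. -/
def IsStandardProduct (P : Set R42) : Prop :=
  (∃ r : ℝ, 0 < r ∧ P = prodSH r) ∨
  (∃ r : ℝ, 0 < r ∧ r < 1 ∧ P = prodHH r) ∨
  (∃ r : ℝ, 1 < r ∧ P = prodHS r)

/-- Up to a linear isometry `T` of `R^4_2`, the surface is an open portion of a standard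
product. -/
def OrientedSurface.IsOpenPortionOfProduct (W : OrientedSurface M) : Prop :=
  ∃ (P : Set R42) (T : R42 ≃ₗ[ℝ] R42) (O : Set R42),
    IsStandardProduct P ∧ (∀ x y, ip (T x) (T y) = ip x y) ∧ IsOpen O ∧
    Set.range (fun p => T (W.ψ p)) = O ∩ P

/-- `γ` is a null curve in `H^3_1` over the open interval `I`, with Cartan frame `A = γ'`, `B`,
`C` tangent to `H^3_1`, such that `C' = -a₀ A - κ B` with a non-zero constant `a₀`. -/
structure IsCartanFramed (I : Set ℝ) (a₀ : ℝ) (κ : ℝ → ℝ) (γ A B C : ℝ → R42) : Prop where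
  isOpen : IsOpen I
  ordConnected : I.OrdConnected
  a₀_ne_zero : a₀ ≠ 0
  smooth_κ : ContDiffOn ℝ ∞ κ I
  smooth_γ : ContDiffOn ℝ ∞ γ I
  smooth_A : ContDiffOn ℝ ∞ A I
  smooth_B : ContDiffOn ℝ ∞ B I
  smooth_C : ContDiffOn ℝ ∞ C I
  γ_mem : ∀ s ∈ I, γ s ∈ AdS
  A_γ : ∀ s ∈ I, ip (A s) (γ s) = 0
  B_γ : ∀ s ∈ I, ip (B s) (γ s) = 0
  C_γ : ∀ s ∈ I, ip (C s) (γ s) = 0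
  A_A : ∀ s ∈ I, ip (A s) (A s) = 0
  B_B : ∀ s ∈ I, ip (B s) (B s) = 0
  A_B : ∀ s ∈ I, ip (A s) (B s) = -1
  A_C : ∀ s ∈ I, ip (A s) (C s) = 0
  B_C : ∀ s ∈ I, ip (B s) (C s) = 0
  C_C : ∀ s ∈ I, ip (C s) (C s) = 1
  deriv_γ : ∀ s ∈ I, HasDerivAt γ (A s) s
  deriv_C : ∀ s ∈ I, HasDerivAt C (-a₀ • A s - κ s • B s) s

/-- Near `p` the surface is an open piece of the ruled surface `(s, u) ↦ γ s + u • B s`,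
`s ∈ I`: the map `Φ` is a smooth chart around `p` whose coordinates are `s` and `u`. -/
def OrientedSurface.IsRuledNear (W : OrientedSurface M) (p : M) (I : Set ℝ)
    (γ B : ℝ → R42) : Prop :=
  ∃ Φ : OpenPartialHomeomorph M (ℝ × ℝ),
    p ∈ Φ.source ∧ Φ.target ⊆ I ×ˢ Set.univ ∧
    ContMDiffOn (𝓡 2) 𝓘(ℝ, ℝ × ℝ) ∞ Φ Φ.source ∧
    ContMDiffOn 𝓘(ℝ, ℝ × ℝ) (𝓡 2) ∞ Φ.symm Φ.target ∧
    ∀ q ∈ Φ.source, W.ψ q = γ (Φ q).1 + (Φ q).2 • B (Φ q).1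

/-- The surface is (an open piece, near each of its points) of a non-flat `B`-scroll over a null
curve. The constant `a₀` is the same at all points; `κ` is nowhere zero around every point that
is not umbilical, and such points exist. -/
def OrientedSurface.IsNonflatBScroll (W : OrientedSurface M) : Prop :=
  (∀ p, W.gaussCurv p ≠ 0) ∧ (∃ p, ¬ W.IsUmbilical p) ∧
  ∃ a₀ : ℝ, ∀ p, ∃ (I : Set ℝ) (κ : ℝ → ℝ) (γ A B C : ℝ → R42),
    IsCartanFramed I a₀ κ γ A B C ∧ W.IsRuledNear p I γ B ∧
    (¬ W.IsUmbilical p → ∀ s ∈ I, κ s ≠ 0)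

end AdSSurface

end

/-!
The proof works in the charts of the surface. In a chart, `L₁` has an explicit expression, and with
`t = tr S`, `d = det S` one finds `L₁ ψ = -2 ε d N - t ψ` (`LocalSurface.lop_φ`) and
`L₁ N = ∇d + ε t d N + 2 d ψ` (`LocalSurface.lop_n`). Being of `L₁`-2-type means that
`L₁ L₁ ψ = (l₁ + l₂) L₁ ψ - l₁ l₂ (ψ - a)`. The tangential part of this equation and its components
along `N` and `ψ` (`TwoType.tangent_eq`, `TwoType.normal_eq`, `TwoType.position_eq`) express
`⟨a, dψ⟩`, `⟨a, N⟩` and `⟨a, ψ⟩` through `t` and `d`.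

Suppose that the mean curvature, the Gaussian curvature `ε d - 1`, or one principal curvature is
constant. Differentiating the normal components and comparing with the tangential one gives an
equation `R(f) df = 0` with a non-zero polynomial `R`, where `f` is `t` or `d`; since `M` is
connected, `f` is constant. In this way `t` and `d` are both constant
(`OrientedSurface.tr_dt_const`). The case `d = 0` needs an extra argument along the integral curves
of the kernel of `S` (`EigenFrame.false_of_twoType`).

If `t` and `d` are constant, then `d ≠ 0`, the surface is not totally umbilical, and the fourth
order equation becomes `l₁ + l₂ = t (ε d - 1)`, `l₁ l₂ = ε d (4 d - t²)`. If `t² < 4 d`, the Codazzi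
and Gauss equations in a null frame force `ε d = 1`, which contradicts these relations. There remain
two cases (`OrientedSurface.disc_cases`).

* `t² > 4 d`. The two principal curvatures `k ≠ l` are real. The Codazzi equations make the
  principal directions parallel, so that `ε k l = 1`, and the orthogonal splitting of `R^4_2` into
  the span of `N + k ψ` and the principal direction for `l`, and the span of `N + l ψ` and the
  principal direction for `k`, does not depend on the point. The components of `ψ` in the two planes
  are multiples of `N + k ψ` and `N + l ψ`, of constant norm, and the surface lies in a standard
  product. It is open there because the positive combinations of the two components fill an open
  subset of `R^4_2` (`OrientedSurface.isOpenPortionOfProduct`).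

* `t² = 4 d`. The surface is Lorentzian with double principal curvature `k = t / 2 ≠ 0`, `k² ≠ 1`.
  In a null frame `S ξ = k ξ + α η`, `S η = k η + β ξ` with `α β = 0`. By the Codazzi equations
  `α` is multiplied along the curves of `η` and `β` along those of `ξ`, and so one of them vanishes
  identically near each point, umbilical or not (`LocalSurface.eq_zero_or_eq_zero_near`).
  If it is `β`, then the integral curves of a multiple of `η` are straight lines, and together with
  an integral curve of `ξ` they give the ruled parametrization with `a₀ = k` and `C = N`
  (`ScrollFrame.exists_ruled`, `OrientedSurface.isNonflatBScroll`).
-/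

open scoped Manifold ContDiff

noncomputable section

namespace AdSSurface

/-! ### The flat space `R^4_2` -/

theorem ip_apply (x y : R42) :
    ip x y = -(x 0 * y 0) - x 1 * y 1 + x 2 * y 2 + x 3 * y 3 := rfl

theorem ip_comm (x y : R42) : ip x y = ip y x := by
  simp only [ip_apply]; ring

theorem ip_add_left (x y z : R42) : ip (x + y) z = ip x z + ip y z := by simp
theorem ip_add_right (x y z : R42) : ip x (y + z) = ip x y + ip x z := by simp
theorem ip_sub_left (x y z : R42) : ip (x - y) z = ip x z - ip y z := by simp
theorem ip_sub_right (x y z : R42) : ip x (y - z) = ip x y - ip x z := by simp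
theorem ip_neg_left (x y : R42) : ip (-x) y = -ip x y := by simp
theorem ip_neg_right (x y : R42) : ip x (-y) = -ip x y := by simp
theorem ip_smul_left (c : ℝ) (x y : R42) : ip (c • x) y = c * ip x y := by simp
theorem ip_smul_right (c : ℝ) (x y : R42) : ip x (c • y) = c * ip x y := by simp
theorem ip_zero_left (x : R42) : ip 0 x = 0 := by simp
theorem ip_zero_right (x : R42) : ip x 0 = 0 := by simp

/-- The Gram matrix of a basis of `R^4_2` has positive determinant, since the metric has. -/
theorem gram_pos_and_ext {a b n q : R42} {ε : ℝ} (hε : ε = 1 ∨ ε = -1)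
    (hΔ : ip a a * ip b b - ip a b ^ 2 ≠ 0) (hnn : ip n n = ε) (hqq : ip q q = -1)
    (hnq : ip n q = 0) (hna : ip n a = 0) (hnb : ip n b = 0)
    (hqa : ip q a = 0) (hqb : ip q b = 0) :
    0 < -ε * (ip a a * ip b b - ip a b ^ 2) ∧
    ∀ v, ip a v = 0 → ip b v = 0 → ip n v = 0 → ip q v = 0 → v = 0 := by
  set A : Matrix (Fin 4) (Fin 4) ℝ := Matrix.of ![a, b, n, q] with hA
  set J : Matrix (Fin 4) (Fin 4) ℝ := Matrix.diagonal ![-1, -1, 1, 1] with hJ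
  have hAJ : ∀ v : R42, (A * J).mulVec v = ![ip a v, ip b v, ip n v, ip q v] := by
    intro v
    ext i
    fin_cases i <;>
    · simp [hA, hJ, Matrix.mulVec, dotProduct, Fin.sum_univ_four, ip_apply]
      ring
  have hG : A * J * A.transpose =
      !![ip a a, ip a b, 0, 0; ip a b, ip b b, 0, 0; 0, 0, ε, 0; 0, 0, 0, -1] := by
    have h : ∀ i j, (A * J * A.transpose) i j = (A * J).mulVec (![a, b, n, q] j) i := by
      intro i j
      simp only [Matrix.mul_apply (M := A * J), Matrix.mulVec, dotProduct]
      rfl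
    ext i j
    rw [h, hAJ]
    fin_cases i <;> fin_cases j <;>
      simp [hnn, hqq, hnq, hna, hnb, hqa, hqb, ip_comm a n, ip_comm b n, ip_comm a q,
        ip_comm b q, ip_comm b a, ip_comm q n]
  have hdet : (A * J * A.transpose).det = -ε * (ip a a * ip b b - ip a b ^ 2) := by
    rw [hG]
    simp [Matrix.det_succ_row_zero, Fin.sum_univ_succ, Fin.succAbove]
    ring
  have hdJ : J.det = 1 := by simp [hJ, Fin.prod_univ_four]
  have hsq : (A * J * A.transpose).det = A.det ^ 2 := by
    rw [Matrix.det_mul, Matrix.det_mul, Matrix.det_transpose, hdJ]; ring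
  have hε0 : -ε ≠ 0 := by rcases hε with h | h <;> rw [h] <;> norm_num
  have hne : A.det ≠ 0 := by
    intro h0
    rw [h0, hdet] at hsq
    exact mul_ne_zero hε0 hΔ (by simpa using hsq)
  refine ⟨by rw [← hdet, hsq]; positivity, fun v h1 h2 h3 h4 => ?_⟩
  have h0 : (A * J).mulVec v = 0 := by
    rw [hAJ, h1, h2, h3, h4]
    ext i; fin_cases i <;> rfl
  refine Matrix.eq_zero_of_mulVec_eq_zero ?_ h0
  rw [Matrix.det_mul, hdJ, mul_one]
  exact hne

/-! ### Derivatives along vector fields of the coordinate plane -/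

/-- The coordinate plane. -/
abbrev Plane : Type := EuclideanSpace ℝ (Fin 2)

/-- The derivative of `f` along the vector field `ξ`. -/
def der {V : Type*} [NormedAddCommGroup V] [NormedSpace ℝ V] (ξ : Plane → Plane) (f : Plane → V)
    (x : Plane) : V :=
  fderiv ℝ f x (ξ x)

section der

variable {V : Type*} [NormedAddCommGroup V] [NormedSpace ℝ V] {U : Set Plane} {x : Plane}
  {ξ η : Plane → Plane}

theorem diffAt_of_smooth {f : Plane → V} (hU : IsOpen U) (hf : ContDiffOn ℝ ∞ f U) (hx : x ∈ U) :
    DifferentiableAt ℝ f x :=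
  (hf.contDiffAt (hU.mem_nhds hx)).differentiableAt (by simp)

theorem smooth_der {f : Plane → V} (hU : IsOpen U) (hξ : ContDiffOn ℝ ∞ ξ U)
    (hf : ContDiffOn ℝ ∞ f U) : ContDiffOn ℝ ∞ (der ξ f) U :=
  (hf.fderiv_of_isOpen hU (m := ∞) (by simp)).clm_apply hξ

theorem der_congr {f g : Plane → V} (hU : IsOpen U) (hx : x ∈ U) (h : ∀ y ∈ U, f y = g y) :
    der ξ f x = der ξ g x := by
  have : f =ᶠ[nhds x] g := Filter.eventuallyEq_of_mem (hU.mem_nhds hx) h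
  rw [der, der, this.fderiv_eq]

theorem der_const {c : V} : der ξ (fun _ => c) x = 0 := by simp [der]

/-- A function that is constant on an open set has vanishing derivative there. -/
theorem der_eq_zero {f : Plane → V} {c : V} (hU : IsOpen U) (hx : x ∈ U) (h : ∀ y ∈ U, f y = c) :
    der ξ f x = 0 := by
  rw [der_congr hU hx h, der_const]

theorem der_add {f g : Plane → V} (hf : DifferentiableAt ℝ f x) (hg : DifferentiableAt ℝ g x) :
    der ξ (fun y => f y + g y) x = der ξ f x + der ξ g x := by
  simp only [der, fderiv_fun_add hf hg, _root_.add_apply]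

theorem der_sub {f g : Plane → V} (hf : DifferentiableAt ℝ f x) (hg : DifferentiableAt ℝ g x) :
    der ξ (fun y => f y - g y) x = der ξ f x - der ξ g x := by
  simp only [der, fderiv_fun_sub hf hg, _root_.sub_apply]

theorem der_neg {f : Plane → V} : der ξ (fun y => -f y) x = -der ξ f x := by
  simp only [der, fderiv_fun_neg, _root_.neg_apply]

theorem der_smul {c : Plane → ℝ} {f : Plane → V} (hc : DifferentiableAt ℝ c x)
    (hf : DifferentiableAt ℝ f x) :
    der ξ (fun y => c y • f y) x = c x • der ξ f x + der ξ c x • f x := by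
  simp only [der, fderiv_fun_smul hc hf, _root_.add_apply,
    _root_.smul_apply, ContinuousLinearMap.smulRight_apply]

theorem der_mul {c f : Plane → ℝ} (hc : DifferentiableAt ℝ c x)
    (hf : DifferentiableAt ℝ f x) :
    der ξ (fun y => c y * f y) x = c x * der ξ f x + der ξ c x * f x :=
  der_smul hc hf

theorem der_const_smul {c : ℝ} {f : Plane → V} (hf : DifferentiableAt ℝ f x) :
    der ξ (fun y => c • f y) x = c • der ξ f x := by
  simp only [der, fderiv_fun_const_smul hf, _root_.smul_apply]

theorem der_const_mul {c : ℝ} {f : Plane → ℝ} (hf : DifferentiableAt ℝ f x) :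
    der ξ (fun y => c * f y) x = c * der ξ f x :=
  der_const_smul hf

theorem der_clm {V' : Type*} [NormedAddCommGroup V'] [NormedSpace ℝ V'] (ℓ : V →L[ℝ] V')
    {f : Plane → V} (hf : DifferentiableAt ℝ f x) :
    der ξ (fun y => ℓ (f y)) x = ℓ (der ξ f x) := by
  have := (ℓ.hasFDerivAt (x := f x)).comp x hf.hasFDerivAt
  simp only [der]
  rw [show (fun y => ℓ (f y)) = ℓ ∘ f from rfl, this.fderiv]; rfl

theorem der_bracket {f : Plane → V} (hU : IsOpen U) (hx : x ∈ U) (hξ : ContDiffOn ℝ ∞ ξ U)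
    (hη : ContDiffOn ℝ ∞ η U) (hf : ContDiffOn ℝ ∞ f U) :
    der ξ (der η f) x - der η (der ξ f) x = fderiv ℝ f x (der ξ η x - der η ξ x) := by
  have h := VectorField.fderiv_apply_lieBracket (𝕜 := ℝ) (n := ∞) (f := f) (x := x) (V := ξ) (W := η)
    (hf.contDiffAt (hU.mem_nhds hx)) (by rw [minSmoothness_of_isRCLikeNormedField]; exact WithTop.coe_le_coe.2 le_top)
    (diffAt_of_smooth hU hη hx) (diffAt_of_smooth hU hξ hx)
  rw [VectorField.lieBracket_eq] at h
  exact h.symm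

end der

theorem smooth_ip {U : Set Plane} {f g : Plane → R42} (hf : ContDiffOn ℝ ∞ f U)
    (hg : ContDiffOn ℝ ∞ g U) : ContDiffOn ℝ ∞ (fun x => ip (f x) (g x)) U := by
  have hf' := contDiffOn_pi.1 hf
  have hg' := contDiffOn_pi.1 hg
  simp only [ip_apply]
  exact ((((hf' 0).mul (hg' 0)).neg.sub ((hf' 1).mul (hg' 1))).add ((hf' 2).mul (hg' 2))).add
    ((hf' 3).mul (hg' 3))

theorem der_ip {ξ : Plane → Plane} {f g : Plane → R42} {x : Plane}
    (hf : DifferentiableAt ℝ f x) (hg : DifferentiableAt ℝ g x) :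
    der ξ (fun y => ip (f y) (g y)) x = ip (der ξ f x) (g x) + ip (f x) (der ξ g x) := by
  have hf' := hasFDerivAt_pi'.1 hf.hasFDerivAt
  have hg' := hasFDerivAt_pi'.1 hg.hasFDerivAt
  have h := ((((hf' 0).mul (hg' 0)).neg.sub ((hf' 1).mul (hg' 1))).add ((hf' 2).mul (hg' 2))).add
    ((hf' 3).mul (hg' 3))
  have h' : HasFDerivAt (fun y => ip (f y) (g y)) _ x := h
  simp only [der, h'.fderiv]
  simp [ip_apply]
  ring

/-! ### Surfaces in coordinates -/

/-- The coordinate vectors of the plane. -/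
def basisVec (i : Fin 2) : Plane := EuclideanSpace.single i 1

theorem plane_eq (v : Plane) : v = v 0 • basisVec 0 + v 1 • basisVec 1 := by
  ext i; fin_cases i <;> simp [basisVec]

/-- Partial derivative of a function with values in any normed space. -/
def pd {V : Type*} [NormedAddCommGroup V] [NormedSpace ℝ V] (i : Fin 2) (f : Plane → V) :
    Plane → V := der (fun _ => basisVec i) f

/-- A parametrized non-degenerate surface in `H^3_1` with unit normal field `n`: the coordinate
expression of an `OrientedSurface` on an open subset of the plane. -/
structure LocalSurface where
  U : Set Plane
  φ : Plane → R42
  n : Plane → R42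
  ε : ℝ
  isOpen : IsOpen U
  smooth_φ : ContDiffOn ℝ ∞ φ U
  smooth_n : ContDiffOn ℝ ∞ n U
  eps_eq : ε = 1 ∨ ε = -1
  φ_φ : ∀ x ∈ U, ip (φ x) (φ x) = -1
  n_n : ∀ x ∈ U, ip (n x) (n x) = ε
  n_φ : ∀ x ∈ U, ip (n x) (φ x) = 0
  n_tangent : ∀ x ∈ U, ∀ v, ip (n x) (fderiv ℝ φ x v) = 0
  gram_ne : ∀ x ∈ U, ip (pd 0 φ x) (pd 0 φ x) * ip (pd 1 φ x) (pd 1 φ x)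
    - ip (pd 0 φ x) (pd 1 φ x) ^ 2 ≠ 0

theorem fderiv_eq_pd {V : Type*} [NormedAddCommGroup V] [NormedSpace ℝ V] (f : Plane → V)
    (x v : Plane) : fderiv ℝ f x v = v 0 • pd 0 f x + v 1 • pd 1 f x := by
  conv_lhs => rw [plane_eq v, map_add, map_smul, map_smul]
  rfl

section pd

variable {V : Type*} [NormedAddCommGroup V] [NormedSpace ℝ V] {U : Set Plane} {x : Plane}

theorem smooth_pd {f : Plane → V} (hU : IsOpen U) (hf : ContDiffOn ℝ ∞ f U) (i : Fin 2) :
    ContDiffOn ℝ ∞ (pd i f) U := smooth_der hU contDiffOn_const hf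

theorem pd_comm {f : Plane → V} (hU : IsOpen U) (hx : x ∈ U) (hf : ContDiffOn ℝ ∞ f U)
    (i j : Fin 2) : pd i (pd j f) x = pd j (pd i f) x := by
  have h := der_bracket (ξ := fun _ => basisVec i) (η := fun _ => basisVec j) hU hx
    contDiffOn_const contDiffOn_const hf
  rw [der_const, der_const, sub_zero, map_zero] at h
  exact sub_eq_zero.1 h

end pd

namespace LocalSurface

variable (L : LocalSurface) {x : Plane}

/-- The Gram determinant of the coordinate frame. -/
def Δ (x : Plane) : ℝ :=
  ip (pd 0 L.φ x) (pd 0 L.φ x) * ip (pd 1 L.φ x) (pd 1 L.φ x) - ip (pd 0 L.φ x) (pd 1 L.φ x) ^ 2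

/-- The dual coordinate frame: the tangent vectors `X⁰`, `X¹` with `⟨Xⁱ, ∂ⱼ⟩ = δᵢⱼ`. -/
def dual (i : Fin 2) (x : Plane) : R42 :=
  (L.Δ x)⁻¹ • (ip (pd (1 - i) L.φ x) (pd (1 - i) L.φ x) • pd i L.φ x
    - ip (pd 0 L.φ x) (pd 1 L.φ x) • pd (1 - i) L.φ x)

/-- The coordinates of the tangential component of an ambient vector. -/
def coord (x : Plane) (w : R42) : Plane :=
  ip (L.dual 0 x) w • basisVec 0 + ip (L.dual 1 x) w • basisVec 1

/-- The matrix of the shape operator in the coordinate frame. -/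
def s (i j : Fin 2) (x : Plane) : ℝ := -ip (L.dual i x) (pd j L.n x)

/-- The trace of the shape operator. -/
def t (x : Plane) : ℝ := L.s 0 0 x + L.s 1 1 x

/-- The determinant of the shape operator. -/
def d (x : Plane) : ℝ := L.s 0 0 x * L.s 1 1 x - L.s 0 1 x * L.s 1 0 x

/-- The shape operator in coordinates. -/
def S (x v : Plane) : Plane := -L.coord x (fderiv ℝ L.n x v)

variable {L}

theorem eps_sq : L.ε * L.ε = 1 := by rcases L.eps_eq with h | h <;> rw [h] <;> norm_num

theorem diff_φ (hx : x ∈ L.U) : DifferentiableAt ℝ L.φ x := diffAt_of_smooth L.isOpen L.smooth_φ hx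
theorem diff_n (hx : x ∈ L.U) : DifferentiableAt ℝ L.n x := diffAt_of_smooth L.isOpen L.smooth_n hx
theorem smooth_X (i : Fin 2) : ContDiffOn ℝ ∞ (pd i L.φ) L.U := smooth_pd L.isOpen L.smooth_φ i
theorem smooth_pn (i : Fin 2) : ContDiffOn ℝ ∞ (pd i L.n) L.U := smooth_pd L.isOpen L.smooth_n i
theorem diff_X (i : Fin 2) (hx : x ∈ L.U) : DifferentiableAt ℝ (pd i L.φ) x :=
  diffAt_of_smooth L.isOpen (smooth_X i) hx

theorem smooth_Δ : ContDiffOn ℝ ∞ L.Δ L.U :=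
  ((smooth_ip (smooth_X 0) (smooth_X 0)).mul (smooth_ip (smooth_X 1) (smooth_X 1))).sub
    ((smooth_ip (smooth_X 0) (smooth_X 1)).pow 2)

theorem Δ_ne (hx : x ∈ L.U) : L.Δ x ≠ 0 := L.gram_ne x hx

theorem smooth_dual (i : Fin 2) : ContDiffOn ℝ ∞ (L.dual i) L.U :=
  (smooth_Δ.inv fun _ hx => Δ_ne hx).smul
    (((smooth_ip (smooth_X (1 - i)) (smooth_X (1 - i))).smul (smooth_X i)).sub
    ((smooth_ip (smooth_X 0) (smooth_X 1)).smul (smooth_X (1 - i))))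

theorem smooth_s (i j : Fin 2) : ContDiffOn ℝ ∞ (L.s i j) L.U :=
  (smooth_ip (smooth_dual i) (smooth_pn j)).neg

theorem smooth_t : ContDiffOn ℝ ∞ L.t L.U := (smooth_s 0 0).add (smooth_s 1 1)

theorem smooth_d : ContDiffOn ℝ ∞ L.d L.U :=
  ((smooth_s 0 0).mul (smooth_s 1 1)).sub ((smooth_s 0 1).mul (smooth_s 1 0))

theorem smooth_coord {w : Plane → R42} (hw : ContDiffOn ℝ ∞ w L.U) :
    ContDiffOn ℝ ∞ (fun x => L.coord x (w x)) L.U :=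
  ((smooth_ip (smooth_dual 0) hw).smul contDiffOn_const).add
    ((smooth_ip (smooth_dual 1) hw).smul contDiffOn_const)

theorem dual_X (hx : x ∈ L.U) (i j : Fin 2) :
    ip (L.dual i x) (pd j L.φ x) = if i = j then 1 else 0 := by
  have h := Δ_ne hx
  have h10 := ip_comm (pd 1 L.φ x) (pd 0 L.φ x)
  rw [dual, ip_smul_left, inv_mul_eq_iff_eq_mul₀ h, Δ]
  fin_cases i <;> fin_cases j <;> simp [h10] <;> ring

theorem ip_n_pd (hx : x ∈ L.U) (i : Fin 2) : ip (L.n x) (pd i L.φ x) = 0 := L.n_tangent x hx _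

theorem ip_φ_der (hx : x ∈ L.U) (ξ : Plane → Plane) : ip (L.φ x) (der ξ L.φ x) = 0 := by
  have h := der_eq_zero (ξ := ξ) L.isOpen hx L.φ_φ
  rw [der_ip (diff_φ hx) (diff_φ hx), ip_comm] at h
  linarith

theorem ip_φ_pd (hx : x ∈ L.U) (i : Fin 2) : ip (L.φ x) (pd i L.φ x) = 0 := ip_φ_der hx _

theorem ip_n_dual (hx : x ∈ L.U) (i : Fin 2) : ip (L.n x) (L.dual i x) = 0 := by
  simp only [dual, ip_smul_right, ip_sub_right, ip_n_pd hx]; ring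

theorem ip_φ_dual (hx : x ∈ L.U) (i : Fin 2) : ip (L.φ x) (L.dual i x) = 0 := by
  simp only [dual, ip_smul_right, ip_sub_right, ip_φ_pd hx]; ring

theorem gram (hx : x ∈ L.U) : 0 < -L.ε * L.Δ x ∧ ∀ v, ip (pd 0 L.φ x) v = 0 →
    ip (pd 1 L.φ x) v = 0 → ip (L.n x) v = 0 → ip (L.φ x) v = 0 → v = 0 :=
  gram_pos_and_ext L.eps_eq (L.gram_ne x hx) (L.n_n x hx)
  (L.φ_φ x hx) (L.n_φ x hx) (ip_n_pd hx 0) (ip_n_pd hx 1) (ip_φ_pd hx 0) (ip_φ_pd hx 1)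

theorem eps_Δ (hx : x ∈ L.U) : 0 < -L.ε * L.Δ x := (gram hx).1

/-- Vectors are equal if they have the same products with a coordinate frame and the normals. -/
theorem ext_frame (hx : x ∈ L.U) {v w : R42} (h0 : ip (pd 0 L.φ x) v = ip (pd 0 L.φ x) w)
    (h1 : ip (pd 1 L.φ x) v = ip (pd 1 L.φ x) w) (hn : ip (L.n x) v = ip (L.n x) w)
    (hφ : ip (L.φ x) v = ip (L.φ x) w) : v = w := by
  rw [← sub_eq_zero]
  apply (gram hx).2 <;> rw [ip_sub_right, sub_eq_zero] <;> assumption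

/-- Decomposition of an ambient vector into tangential and normal components. -/
theorem decomp (hx : x ∈ L.U) (w : R42) :
    w = ip (L.dual 0 x) w • pd 0 L.φ x + ip (L.dual 1 x) w • pd 1 L.φ x
      + (L.ε * ip (L.n x) w) • L.n x - ip (L.φ x) w • L.φ x := by
  have hΔ := Δ_ne hx
  have h10 := ip_comm (pd 1 L.φ x) (pd 0 L.φ x)
  have e := eps_sq (L := L)
  have key : ∀ i, ip (L.dual i x) w * L.Δ x =
    (ip (pd (1 - i) L.φ x) (pd (1 - i) L.φ x) * ip (pd i L.φ x) w
    - ip (pd 0 L.φ x) (pd 1 L.φ x) * ip (pd (1 - i) L.φ x) w) := by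
    intro i
    rw [dual, ip_smul_left, ip_sub_left, ip_smul_left, ip_smul_left]
    field_simp
  have k0 := key 0
  have k1 := key 1
  simp only [sub_zero, sub_self] at k0 k1
  apply ext_frame hx
  all_goals simp only [ip_add_right, ip_sub_right, ip_smul_right, ip_n_pd hx, ip_φ_pd hx,
    L.n_n x hx, L.n_φ x hx, L.φ_φ x hx, ip_comm _ (L.n x), ip_comm _ (L.φ x), h10, mul_zero,
    add_zero, sub_zero, zero_add, zero_sub]
  · apply mul_right_cancel₀ hΔ
    rw [add_mul, mul_right_comm, k0, mul_right_comm, k1, Δ]; ring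
  · apply mul_right_cancel₀ hΔ
    rw [add_mul, mul_right_comm, k0, mul_right_comm, k1, Δ]; ring
  · linear_combination (-ip (L.n x) w) * e
  · ring

theorem fderiv_coord (hx : x ∈ L.U) (w : R42) : fderiv ℝ L.φ x (L.coord x w) =
    w - (L.ε * ip (L.n x) w) • L.n x + ip (L.φ x) w • L.φ x := by
  have h : fderiv ℝ L.φ x (L.coord x w) =
    ip (L.dual 0 x) w • pd 0 L.φ x + ip (L.dual 1 x) w • pd 1 L.φ x := by
    rw [coord, map_add, map_smul, map_smul]; rfl
  rw [h]
  have aux : ∀ v a b c : R42, v = a + b - c → a = v - b + c := by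
    rintro _ a b c rfl; abel
  exact aux _ _ _ _ (decomp hx w)

theorem coord_fderiv (hx : x ∈ L.U) (v : Plane) : L.coord x (fderiv ℝ L.φ x v) = v := by
  conv_rhs => rw [plane_eq v]
  rw [fderiv_eq_pd, coord]
  simp [ip_add_right, dual_X hx]

end LocalSurface

namespace LocalSurface

/-! ### The Gauss and Weingarten formulas -/

variable (L : LocalSurface) {x : Plane}

/-- Coefficients of the first fundamental form. -/
def g (i j : Fin 2) (x : Plane) : ℝ := ip (pd i L.φ x) (pd j L.φ x)

/-- Coefficients `⟨S ∂ᵢ, ∂ⱼ⟩` of the second fundamental form. -/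
def h (i j : Fin 2) (x : Plane) : ℝ := -ip (pd i L.n x) (pd j L.φ x)

/-- Christoffel symbols. -/
def Γ (k i j : Fin 2) (x : Plane) : ℝ := ip (L.dual k x) (pd i (pd j L.φ) x)

variable {L}

theorem diff_pn (i : Fin 2) (hx : x ∈ L.U) : DifferentiableAt ℝ (pd i L.n) x :=
  diffAt_of_smooth L.isOpen (smooth_pn i) hx

theorem Δ_eq : L.Δ x = L.g 0 0 x * L.g 1 1 x - L.g 0 1 x ^ 2 := rfl

theorem g_symm (i j : Fin 2) : L.g i j x = L.g j i x := ip_comm _ _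

theorem ip_n_der_n (hx : x ∈ L.U) (ξ : Plane → Plane) : ip (L.n x) (der ξ L.n x) = 0 := by
  have h := der_eq_zero (ξ := ξ) L.isOpen hx L.n_n
  rw [der_ip (diff_n hx) (diff_n hx), ip_comm] at h
  linarith

theorem ip_φ_der_n (hx : x ∈ L.U) (ξ : Plane → Plane) : ip (L.φ x) (der ξ L.n x) = 0 := by
  have h := der_eq_zero (ξ := ξ) L.isOpen hx L.n_φ
  rw [der_ip (diff_n hx) (diff_φ hx), ip_comm, show ip (L.n x) (der ξ L.φ x) = 0 from
    L.n_tangent x hx _] at h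
  linarith

theorem ip_n_pd2 (hx : x ∈ L.U) (i j : Fin 2) : ip (L.n x) (pd i (pd j L.φ) x) = L.h i j x := by
  have h : pd i (fun y => ip (L.n y) (pd j L.φ y)) x = 0 :=
    der_eq_zero L.isOpen hx fun y hy => ip_n_pd hy j
  rw [pd, der_ip (diff_n hx) (diff_X j hx)] at h
  simp only [LocalSurface.h, pd] at *
  linarith

theorem ip_φ_pd2 (hx : x ∈ L.U) (i j : Fin 2) :
    ip (L.φ x) (pd i (pd j L.φ) x) = -L.g i j x := by
  have h : pd i (fun y => ip (L.φ y) (pd j L.φ y)) x = 0 :=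
    der_eq_zero L.isOpen hx fun y hy => ip_φ_pd hy j
  rw [pd, der_ip (diff_φ hx) (diff_X j hx)] at h
  simp only [LocalSurface.g, pd] at *
  linarith

theorem h_symm (hx : x ∈ L.U) (i j : Fin 2) : L.h i j x = L.h j i x := by
  rw [← ip_n_pd2 hx, ← ip_n_pd2 hx, pd_comm L.isOpen hx L.smooth_φ]

theorem Γ_symm (hx : x ∈ L.U) (k i j : Fin 2) : L.Γ k i j x = L.Γ k j i x := by
  rw [Γ, Γ, pd_comm L.isOpen hx L.smooth_φ]

/-- Gauss formula. -/
theorem pd2_φ (hx : x ∈ L.U) (i j : Fin 2) : pd i (pd j L.φ) x =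
    L.Γ 0 i j x • pd 0 L.φ x + L.Γ 1 i j x • pd 1 L.φ x + (L.ε * L.h i j x) • L.n x
      + L.g i j x • L.φ x := by
  conv_lhs => rw [decomp hx (pd i (pd j L.φ) x)]
  rw [ip_n_pd2 hx, ip_φ_pd2 hx, neg_smul, sub_neg_eq_add]; rfl

/-- Weingarten formula. -/
theorem pd_n (hx : x ∈ L.U) (j : Fin 2) :
    pd j L.n x = -(L.s 0 j x • pd 0 L.φ x) - L.s 1 j x • pd 1 L.φ x := by
  conv_lhs => rw [decomp hx (pd j L.n x)]
  rw [pd, ip_n_der_n hx, ip_φ_der_n hx]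
  simp only [s, pd]
  module

theorem h_eq (hx : x ∈ L.U) (i j : Fin 2) :
    L.h i j x = L.s 0 i x * L.g 0 j x + L.s 1 i x * L.g 1 j x := by
  rw [h, pd_n hx, ip_sub_left, ip_neg_left, ip_smul_left, ip_smul_left]
  simp only [g]; ring

theorem d_mul_Δ (hx : x ∈ L.U) :
    L.d x * L.Δ x = L.h 0 0 x * L.h 1 1 x - L.h 0 1 x ^ 2 := by
  have h1 := h_symm hx 0 1
  rw [pow_two]
  nth_rw 2 [h1]
  simp only [h_eq hx, d, Δ_eq, g_symm 1 0]; ring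

theorem t_mul_Δ (hx : x ∈ L.U) : L.t x * L.Δ x =
    L.g 1 1 x * L.h 0 0 x - 2 * L.g 0 1 x * L.h 0 1 x + L.g 0 0 x * L.h 1 1 x := by
  have h1 := h_symm hx 0 1
  rw [h_eq hx, h_eq hx] at h1
  simp only [h_eq hx, t, Δ_eq, g_symm 1 0] at *
  linear_combination L.g 0 1 x * h1

theorem pd_g (hx : x ∈ L.U) (k i j : Fin 2) : pd k (L.g i j) x =
    L.Γ 0 k i x * L.g 0 j x + L.Γ 1 k i x * L.g 1 j x
      + L.Γ 0 k j x * L.g 0 i x + L.Γ 1 k j x * L.g 1 i x := by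
  have h : pd k (L.g i j) x = _ := der_ip (diff_X i hx) (diff_X j hx)
  rw [h]
  change ip (pd k (pd i L.φ) x) _ + ip _ (pd k (pd j L.φ) x) = _
  rw [pd2_φ hx, pd2_φ hx]
  simp only [ip_add_left, ip_smul_left, ip_n_pd hx, ip_φ_pd hx, g, ip_comm (pd i L.φ x)]
  ring

theorem pd_Δ (hx : x ∈ L.U) (k : Fin 2) :
    pd k L.Δ x = 2 * (L.Γ 0 k 0 x + L.Γ 1 k 1 x) * L.Δ x := by
  have hd : ∀ i j, DifferentiableAt ℝ (L.g i j) x := fun i j =>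
    diffAt_of_smooth L.isOpen (smooth_ip (smooth_X i) (smooth_X j)) hx
  have h : pd k L.Δ x = pd k (fun y => L.g 0 0 y * L.g 1 1 y - L.g 0 1 y * L.g 0 1 y) x :=
    der_congr L.isOpen hx fun y _ => by rw [Δ_eq]; ring
  rw [h, pd, der_sub ((hd _ _).fun_mul (hd _ _)) ((hd _ _).fun_mul (hd _ _)), der_mul (hd _ _) (hd _ _),
    der_mul (hd _ _) (hd _ _)]
  have e := fun i j => pd_g hx k i j
  simp only [pd] at e
  rw [e, e, e, Δ_eq, g_symm 1 0]
  ring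

theorem ip_pn_pd2 (hx : x ∈ L.U) (l i j : Fin 2) : ip (pd l L.n x) (pd i (pd j L.φ) x) =
    -(L.Γ 0 i j x * L.h l 0 x) - L.Γ 1 i j x * L.h l 1 x := by
  rw [pd2_φ hx]
  simp only [ip_add_right, ip_smul_right, ip_comm _ (L.n x), ip_comm _ (L.φ x), h]
  rw [pd, ip_n_der_n hx, ip_φ_der_n hx]
  ring

theorem pd_h (hx : x ∈ L.U) (k i j : Fin 2) : pd k (L.h i j) x =
    -ip (pd j L.φ x) (pd k (pd i L.n) x) + L.Γ 0 k j x * L.h i 0 x + L.Γ 1 k j x * L.h i 1 x := by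
  have e : pd k (fun y => ip (pd i L.n y) (pd j L.φ y)) x = _ :=
    der_ip (diff_pn i hx) (diff_X j hx)
  have e' : pd k (L.h i j) x = -pd k (fun y => ip (pd i L.n y) (pd j L.φ y)) x := der_neg
  have := ip_pn_pd2 hx i k j
  rw [e', e, ip_comm]
  change -(ip (pd j L.φ x) (pd k (pd i L.n) x) + ip _ (pd k (pd j L.φ) x)) = _
  rw [this]; ring

theorem smooth_h (i j : Fin 2) : ContDiffOn ℝ ∞ (L.h i j) L.U :=
  (smooth_ip (smooth_pn i) (smooth_X j)).neg

theorem pd_d (hx : x ∈ L.U) (k : Fin 2) :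
    pd k L.d x * L.Δ x + L.d x * pd k L.Δ x = pd k (L.h 0 0) x * L.h 1 1 x
      + L.h 0 0 x * pd k (L.h 1 1) x - (pd k (L.h 0 1) x * L.h 1 0 x
      + L.h 0 1 x * pd k (L.h 1 0) x) := by
  have hd : ∀ i j, DifferentiableAt ℝ (L.h i j) x := fun i j =>
    diffAt_of_smooth L.isOpen (smooth_h i j) hx
  have h : pd k (fun y => L.d y * L.Δ y) x =
      pd k (fun y => L.h 0 0 y * L.h 1 1 y - L.h 0 1 y * L.h 1 0 y) x :=
    der_congr L.isOpen hx fun y hy => by rw [d_mul_Δ hy, pow_two, h_symm hy 1 0]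
  rw [pd, der_mul (diffAt_of_smooth L.isOpen smooth_d hx) (diffAt_of_smooth L.isOpen smooth_Δ hx),
    pd, der_sub ((hd _ _).fun_mul (hd _ _)) ((hd _ _).fun_mul (hd _ _)), der_mul (hd _ _) (hd _ _),
    der_mul (hd _ _) (hd _ _)] at h
  simp only [pd] at *
  linarith

end LocalSurface

namespace LocalSurface

variable (L : LocalSurface) {x : Plane} {V : Type*} [NormedAddCommGroup V] [NormedSpace ℝ V]

/-! ### The Cheng-Yau operator in coordinates -/

/-- The second covariant derivative of `f` in the coordinate directions `i`, `j`. -/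
def cov2 (i j : Fin 2) (f : Plane → V) (x : Plane) : V :=
  pd i (pd j f) x - L.Γ 0 i j x • pd 0 f x - L.Γ 1 i j x • pd 1 f x

/-- The operator `L₁` in coordinates: minus the contraction of the covariant Hessian with the
cofactor matrix of the second fundamental form. -/
def lop (f : Plane → V) (x : Plane) : V :=
  (L.Δ x)⁻¹ • (-(L.h 1 1 x • L.cov2 0 0 f x) + (2 * L.h 0 1 x) • L.cov2 0 1 f x
    - L.h 0 0 x • L.cov2 1 1 f x)

/-- The gradient of a function, as a tangent vector field in `R^4_2`. -/
def gradVec (f : Plane → ℝ) (x : Plane) : R42 := pd 0 f x • L.dual 0 x + pd 1 f x • L.dual 1 x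

/-- The contraction of the Newton transformation with two differentials: the mixed term of the
product rule for `L₁`. -/
def cross (f : Plane → ℝ) (F : Plane → V) (x : Plane) : V :=
  (L.Δ x)⁻¹ • (-((L.h 1 1 x * pd 0 f x) • pd 0 F x)
    + (L.h 0 1 x * pd 0 f x) • pd 1 F x + (L.h 0 1 x * pd 1 f x) • pd 0 F x
    - (L.h 0 0 x * pd 1 f x) • pd 1 F x)

variable {L}

theorem ip_pd_pd (i j : Fin 2) : ip (pd i L.φ x) (pd j L.φ x) = L.g i j x := rfl

theorem cov2_φ (hx : x ∈ L.U) (i j : Fin 2) :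
    L.cov2 i j L.φ x = (L.ε * L.h i j x) • L.n x + L.g i j x • L.φ x := by
  rw [cov2, pd2_φ hx]; module

/-- `L₁ ψ = -2 ε d N - t ψ`, where `t` and `d` are the trace and determinant of `S`. -/
theorem lop_φ (hx : x ∈ L.U) :
    L.lop L.φ x = (-2 * L.ε * L.d x) • L.n x - L.t x • L.φ x := by
  have hΔ := Δ_ne hx
  rw [lop, inv_smul_eq_iff₀ hΔ, cov2_φ hx, cov2_φ hx, cov2_φ hx, smul_sub, smul_smul, smul_smul,
    show L.Δ x * (-2 * L.ε * L.d x) = -2 * L.ε * (L.d x * L.Δ x) by ring, mul_comm (L.Δ x) (L.t x),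
    d_mul_Δ hx, t_mul_Δ hx]
  module

theorem ip_X_pn (i j : Fin 2) : ip (pd j L.φ x) (pd i L.n x) = -L.h i j x := by
  rw [h, neg_neg, ip_comm]

theorem ip_X_gradVec (hx : x ∈ L.U) {f : Plane → ℝ} (k : Fin 2) :
    ip (pd k L.φ x) (L.gradVec f x) = pd k f x := by
  rw [gradVec, ip_add_right, ip_smul_right, ip_smul_right, ip_comm, dual_X hx, ip_comm,
    dual_X hx]
  fin_cases k <;> simp

theorem ip_n_gradVec (hx : x ∈ L.U) {f : Plane → ℝ} : ip (L.n x) (L.gradVec f x) = 0 := by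
  rw [gradVec, ip_add_right, ip_smul_right, ip_smul_right, ip_n_dual hx, ip_n_dual hx]; ring

theorem ip_φ_gradVec (hx : x ∈ L.U) {f : Plane → ℝ} : ip (L.φ x) (L.gradVec f x) = 0 := by
  rw [gradVec, ip_add_right, ip_smul_right, ip_smul_right, ip_φ_dual hx, ip_φ_dual hx]; ring

/-- `L₁ N = ∇d + ε t d N + 2 d ψ`. -/
theorem lop_n (hx : x ∈ L.U) :
    L.lop L.n x = L.gradVec L.d x + (L.ε * L.t x * L.d x) • L.n x + (2 * L.d x) • L.φ x := by
  have hΔ := Δ_ne hx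
  have hcomm := pd_comm L.isOpen hx L.smooth_n 1 0
  have eT : ∀ k, ip (pd k L.φ x) (L.lop L.n x) = pd k L.d x := by
    intro k
    have cod : pd k (L.h 0 1) x = pd k (L.h 1 0) x :=
      der_congr L.isOpen hx fun y hy => h_symm hy 0 1
    have cod0 : pd 0 (L.h 0 1) x = pd 0 (L.h 1 0) x :=
      der_congr L.isOpen hx fun y hy => h_symm hy 0 1
    have cod1 : pd 1 (L.h 0 1) x = pd 1 (L.h 1 0) x :=
      der_congr L.isOpen hx fun y hy => h_symm hy 0 1
    have h10 := h_symm hx 1 0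
    have e1 := pd_d hx k
    rw [pd_Δ hx] at e1
    have e2 := d_mul_Δ hx
    simp only [pd_h hx, h10, hcomm] at e1 cod0 cod1 cod
    rw [lop, ip_smul_right, inv_mul_eq_iff_eq_mul₀ hΔ]
    simp only [cov2, ip_add_right, ip_sub_right, ip_smul_right, ip_neg_right, ip_X_pn]
    have g1 := Γ_symm hx 0 1 0
    have g2 := Γ_symm hx 1 1 0
    fin_cases k <;> simp only [Fin.zero_eta, Fin.mk_one, g1, g2, h10, hcomm] at *
    · linear_combination -(L.h 0 0 x) * cod1 + L.h 0 1 x * cod0 - e1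
        + 2 * (L.Γ 0 0 0 x + L.Γ 1 0 1 x) * e2
    · linear_combination L.h 1 1 x * cod0 - L.h 0 1 x * cod1 - e1
        + 2 * (L.Γ 0 0 1 x + L.Γ 1 1 1 x) * e2
  have hX : ∀ k, ip (pd k L.φ x) (L.gradVec L.d x) = pd k L.d x := fun k => ip_X_gradVec hx k
  have e2 := d_mul_Δ hx
  have h10 := h_symm hx 1 0
  have es := eps_sq (L := L)
  apply ext_frame hx
  · rw [eT, ip_add_right, ip_add_right, hX, ip_smul_right, ip_smul_right, ip_comm _ (L.n x),
      ip_n_pd hx, ip_comm _ (L.φ x), ip_φ_pd hx]; ring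
  · rw [eT, ip_add_right, ip_add_right, hX, ip_smul_right, ip_smul_right, ip_comm _ (L.n x),
      ip_n_pd hx, ip_comm _ (L.φ x), ip_φ_pd hx]; ring
  · have e' : ∀ i j, ip (pd i L.n x) (pd j L.n x) =
        L.s 0 j x * L.h i 0 x + L.s 1 j x * L.h i 1 x := by
      intro i j
      rw [pd_n hx j, ip_sub_right, ip_neg_right, ip_smul_right, ip_smul_right, h, h]; ring
    have e3 := e' 0 1
    rw [ip_comm, e' 1 0] at e3
    have hn : ∀ i j, ip (L.n x) (pd i (pd j L.n) x) =
        -(L.s 0 j x * L.h i 0 x + L.s 1 j x * L.h i 1 x) := by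
      intro i j
      have e : pd i (fun y => ip (L.n y) (pd j L.n y)) x = 0 :=
        der_eq_zero L.isOpen hx fun y hy => ip_n_der_n hy _
      rw [pd, der_ip (diff_n hx) (diff_pn j hx)] at e
      rw [← e']
      simp only [pd] at *
      linarith
    have hn1 : ∀ i, ip (L.n x) (pd i L.n x) = 0 := fun i => ip_n_der_n hx _
    rw [lop, ip_smul_right, inv_mul_eq_iff_eq_mul₀ (Δ_ne hx)]
    simp only [cov2, ip_add_right, ip_sub_right, ip_smul_right, ip_neg_right, hn, hn1,
      ip_n_gradVec hx, L.n_n x hx, L.n_φ x hx, h10]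
    rw [h10] at e3
    simp only [t]
    linear_combination (-(L.s 0 0 x) - L.s 1 1 x) * e2
      - (L.d x * (L.s 0 0 x + L.s 1 1 x) * L.Δ x) * es + L.h 0 1 x * e3
  · have hn : ∀ i j, ip (L.φ x) (pd i (pd j L.n) x) = L.h j i x := by
      intro i j
      have e : pd i (fun y => ip (L.φ y) (pd j L.n y)) x = 0 :=
        der_eq_zero L.isOpen hx fun y hy => ip_φ_der_n hy _
      rw [pd, der_ip (diff_φ hx) (diff_pn j hx), ip_comm] at e
      simp only [pd, h] at *
      linarith
    have hn1 : ∀ i, ip (L.φ x) (pd i L.n x) = 0 := fun i => ip_φ_der_n hx _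
    rw [lop, ip_smul_right, inv_mul_eq_iff_eq_mul₀ (Δ_ne hx)]
    simp only [cov2, ip_add_right, ip_sub_right, ip_smul_right, ip_neg_right, hn, hn1,
      ip_φ_gradVec hx, L.φ_φ x hx, ip_comm (L.φ x) (L.n x), L.n_φ x hx, h10]
    linear_combination 2 * e2

theorem cov2_add {f F : Plane → V} (hx : x ∈ L.U) (hf : ContDiffOn ℝ ∞ f L.U)
    (hF : ContDiffOn ℝ ∞ F L.U) (i j : Fin 2) :
    L.cov2 i j (fun y => f y + F y) x = L.cov2 i j f x + L.cov2 i j F x := by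
  have d1 : ∀ y ∈ L.U, ∀ k, pd k (fun y => f y + F y) y = pd k f y + pd k F y :=
    fun y hy k => der_add (diffAt_of_smooth L.isOpen hf hy) (diffAt_of_smooth L.isOpen hF hy)
  have d2 : pd i (pd j (fun y => f y + F y)) x = pd i (pd j f) x + pd i (pd j F) x :=
    (der_congr L.isOpen hx fun y hy => d1 y hy j).trans
      (der_add (diffAt_of_smooth L.isOpen (smooth_pd L.isOpen hf j) hx)
        (diffAt_of_smooth L.isOpen (smooth_pd L.isOpen hF j) hx))
  rw [cov2, d2, d1 x hx, d1 x hx, cov2, cov2]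
  module

theorem cov2_smul {f : Plane → ℝ} {F : Plane → V} (hx : x ∈ L.U) (hf : ContDiffOn ℝ ∞ f L.U)
    (hF : ContDiffOn ℝ ∞ F L.U) (i j : Fin 2) :
    L.cov2 i j (fun y => f y • F y) x = f x • L.cov2 i j F x + L.cov2 i j f x • F x
      + pd i f x • pd j F x + pd j f x • pd i F x := by
  have df := fun y hy => diffAt_of_smooth (x := y) L.isOpen hf hy
  have dF := fun y hy => diffAt_of_smooth (x := y) L.isOpen hF hy
  have df1 := fun k => diffAt_of_smooth L.isOpen (smooth_pd L.isOpen hf k) hx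
  have dF1 := fun k => diffAt_of_smooth L.isOpen (smooth_pd L.isOpen hF k) hx
  have d1 : ∀ y ∈ L.U, ∀ k, pd k (fun y => f y • F y) y = f y • pd k F y + pd k f y • F y :=
    fun y hy k => der_smul (df y hy) (dF y hy)
  have d2 : pd i (pd j (fun y => f y • F y)) x = (f x • pd i (pd j F) x + pd i f x • pd j F x)
      + (pd j f x • pd i F x + pd i (pd j f) x • F x) :=
    (der_congr L.isOpen hx fun y hy => d1 y hy j).trans
      ((der_add ((df x hx).smul (dF1 j)) ((df1 j).smul (dF x hx))).trans
      (congrArg₂ _ (der_smul (df x hx) (dF1 j)) (der_smul (df1 j) (dF x hx))))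
  rw [cov2, d2, d1 x hx, d1 x hx, cov2, cov2]
  simp only [smul_eq_mul]
  module

theorem lop_add {f F : Plane → V} (hx : x ∈ L.U) (hf : ContDiffOn ℝ ∞ f L.U)
    (hF : ContDiffOn ℝ ∞ F L.U) : L.lop (fun y => f y + F y) x = L.lop f x + L.lop F x := by
  simp only [lop, cov2_add hx hf hF]
  module

theorem lop_const (v : V) : L.lop (fun _ => v) x = 0 := by
  have h : ∀ (v : V) k, pd k (fun _ : Plane => v) = fun _ => 0 :=
    fun v k => funext fun y => der_const
  simp only [lop, cov2, h]
  simp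

/-- Product rule for `L₁`. -/
theorem lop_smul {f : Plane → ℝ} {F : Plane → V} (hx : x ∈ L.U) (hf : ContDiffOn ℝ ∞ f L.U)
    (hF : ContDiffOn ℝ ∞ F L.U) : L.lop (fun y => f y • F y) x =
      f x • L.lop F x + L.lop f x • F x + (2 : ℝ) • L.cross f F x := by
  simp only [lop, cov2_smul hx hf hF, cross, smul_eq_mul]
  module

theorem lop_const_smul {F : Plane → V} (c : ℝ) (hx : x ∈ L.U)
    (hF : ContDiffOn ℝ ∞ F L.U) : L.lop (fun y => c • F y) x = c • L.lop F x := by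
  rw [lop_smul hx contDiffOn_const hF, lop_const, cross]
  simp [pd, der_const]

theorem lop_congr {f F : Plane → V} (hx : x ∈ L.U) (e : ∀ y ∈ L.U, f y = F y) :
    L.lop f x = L.lop F x := by
  have d1 : ∀ y ∈ L.U, ∀ k, pd k f y = pd k F y := fun y hy k => der_congr L.isOpen hy e
  have d2 : ∀ i j, pd i (pd j f) x = pd i (pd j F) x :=
    fun i j => der_congr L.isOpen hx fun y hy => d1 y hy j
  simp only [lop, cov2, d1 x hx, d2]

theorem lop_clm {V' : Type*} [NormedAddCommGroup V'] [NormedSpace ℝ V'] (ℓ : V →L[ℝ] V')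
    {f : Plane → V} (hx : x ∈ L.U) (hf : ContDiffOn ℝ ∞ f L.U) :
    L.lop (fun y => ℓ (f y)) x = ℓ (L.lop f x) := by
  have d1 : ∀ y ∈ L.U, ∀ k, pd k (fun y => ℓ (f y)) y = ℓ (pd k f y) :=
    fun y hy k => der_clm ℓ (diffAt_of_smooth L.isOpen hf hy)
  have d2 : ∀ i j, pd i (pd j (fun y => ℓ (f y))) x = ℓ (pd i (pd j f) x) :=
    fun i j => (der_congr L.isOpen hx fun y hy => d1 y hy j).trans
      (der_clm ℓ (diffAt_of_smooth L.isOpen (smooth_pd L.isOpen hf j) hx))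
  simp only [lop, cov2, d1 x hx, d2, map_add, map_sub, map_smul, map_neg]

theorem cross_n (hx : x ∈ L.U) (f : Plane → ℝ) :
    L.cross f L.n x = L.d x • L.gradVec f x := by
  have e2 := d_mul_Δ hx
  have h10 := h_symm hx 1 0
  have hn : ∀ i, ip (L.n x) (pd i L.n x) = 0 := fun i => ip_n_der_n hx _
  have hφ : ∀ i, ip (L.φ x) (pd i L.n x) = 0 := fun i => ip_φ_der_n hx _
  rw [cross, inv_smul_eq_iff₀ (Δ_ne hx)]
  apply ext_frame hx <;> simp only [ip_add_right, ip_sub_right, ip_neg_right, ip_smul_right,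
    ip_X_pn, hn, hφ, ip_X_gradVec hx, ip_n_gradVec hx, ip_φ_gradVec hx, h10]
  · linear_combination -(pd 0 f x) * e2
  · linear_combination -(pd 1 f x) * e2
  · ring
  · ring

/-- The contraction of the Newton transformation with `df` and the position vector is
`P₁ ∇f`. -/
theorem ip_X_cross_φ (hx : x ∈ L.U) (f : Plane → ℝ) (k : Fin 2) :
    ip (pd k L.φ x) (L.cross f L.φ x) =
      L.s 0 k x * pd 0 f x + L.s 1 k x * pd 1 f x - L.t x * pd k f x := by
  have h10 := h_symm hx 1 0
  rw [h_eq hx, h_eq hx] at h10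
  rw [cross, ip_smul_right, inv_mul_eq_iff_eq_mul₀ (Δ_ne hx)]
  simp only [ip_add_right, ip_sub_right, ip_neg_right, ip_smul_right, Δ_eq]
  fin_cases k <;> simp only [Fin.zero_eta, Fin.mk_one] <;>
  simp only [ip_pd_pd, h_eq hx, t, g_symm 1 0] at *
  · linear_combination -(L.g 0 1 x * pd 0 f x) * h10
  · linear_combination -(L.g 1 1 x * pd 0 f x) * h10

theorem ip_n_cross_φ (hx : x ∈ L.U) (f : Plane → ℝ) : ip (L.n x) (L.cross f L.φ x) = 0 := by
  simp only [cross, ip_add_right, ip_sub_right, ip_neg_right, ip_smul_right, ip_n_pd hx]; ring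

theorem ip_φ_cross_φ (hx : x ∈ L.U) (f : Plane → ℝ) : ip (L.φ x) (L.cross f L.φ x) = 0 := by
  simp only [cross, ip_add_right, ip_sub_right, ip_neg_right, ip_smul_right, ip_φ_pd hx]; ring

end LocalSurface

namespace LocalSurface

variable {L : LocalSurface} {x : Plane}

/-! ### Algebra of the shape operator -/

theorem S_eq (v : Plane) : L.S x v =
    (L.s 0 0 x * v 0 + L.s 0 1 x * v 1) • basisVec 0
      + (L.s 1 0 x * v 0 + L.s 1 1 x * v 1) • basisVec 1 := by
  rw [S, fderiv_eq_pd L.n x v, coord]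
  simp only [ip_add_right, ip_smul_right, s]
  module

theorem fderiv_S {V : Type*} [NormedAddCommGroup V] [NormedSpace ℝ V]
    (f : Plane → V) (v : Plane) : fderiv ℝ f x (L.S x v) =
    (L.s 0 0 x * v 0 + L.s 0 1 x * v 1) • pd 0 f x
      + (L.s 1 0 x * v 0 + L.s 1 1 x * v 1) • pd 1 f x := by
  rw [S_eq, map_add, map_smul, map_smul]; rfl

theorem S_add (v w : Plane) : L.S x (v + w) = L.S x v + L.S x w := by
  rw [S_eq, S_eq, S_eq]
  simp only [PiLp.add_apply]
  module

theorem S_smul (c : ℝ) (v : Plane) : L.S x (c • v) = c • L.S x v := by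
  rw [S_eq, S_eq]
  simp only [PiLp.smul_apply, smul_eq_mul]
  module

theorem S_sub (v w : Plane) : L.S x (v - w) = L.S x v - L.S x w := by
  rw [sub_eq_add_neg, sub_eq_add_neg, S_add, ← neg_one_smul ℝ w, S_smul, neg_one_smul]

/-- Weingarten formula. -/
theorem fderiv_φ_S (hx : x ∈ L.U) (v : Plane) :
    fderiv ℝ L.φ x (L.S x v) = -fderiv ℝ L.n x v := by
  rw [fderiv_S, fderiv_eq_pd L.n x v, pd_n hx, pd_n hx]
  module

/-- The Cayley-Hamilton identity for the shape operator. -/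
theorem S_S (v : Plane) : L.S x (L.S x v) = L.t x • L.S x v - L.d x • v := by
  have h0 : (L.S x v) 0 = L.s 0 0 x * v 0 + L.s 0 1 x * v 1 := by simp [S_eq, basisVec]
  have h1 : (L.S x v) 1 = L.s 1 0 x * v 0 + L.s 1 1 x * v 1 := by simp [S_eq, basisVec]
  conv_rhs => rw [plane_eq v]
  rw [S_eq, h0, h1, ← plane_eq v, S_eq v, t, d]
  conv_rhs => enter [2, 2]; rw [plane_eq v]
  module

/-! ### The fourth order equation of a surface of `L₁`-2-type -/

/-- The coordinate expression of the decomposition of a surface of `L₁`-2-type. -/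
structure TwoType (L : LocalSurface) (a : R42) (f₁ f₂ : Plane → R42) (l₁ l₂ : ℝ) : Prop where
  smooth₁ : ContDiffOn ℝ ∞ f₁ L.U
  smooth₂ : ContDiffOn ℝ ∞ f₂ L.U
  sum : ∀ x ∈ L.U, L.φ x = a + f₁ x + f₂ x
  lop₁ : ∀ x ∈ L.U, L.lop f₁ x = l₁ • f₁ x
  lop₂ : ∀ x ∈ L.U, L.lop f₂ x = l₂ • f₂ x

namespace TwoType

variable {a : R42} {f₁ f₂ : Plane → R42} {l₁ l₂ : ℝ} (T : TwoType L a f₁ f₂ l₁ l₂)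
include T

theorem lop_φ_eq (hx : x ∈ L.U) : L.lop L.φ x = l₁ • f₁ x + l₂ • f₂ x := by
  have e : L.lop L.φ x = L.lop (fun y => (a + f₁ y) + f₂ y) x := lop_congr hx T.sum
  rw [e, lop_add hx (contDiffOn_const.add T.smooth₁) T.smooth₂,
    lop_add hx contDiffOn_const T.smooth₁, lop_const, T.lop₁ x hx, T.lop₂ x hx, zero_add]

/-- Eliminating the two components gives a fourth order equation for the immersion. -/
theorem lop_lop (hx : x ∈ L.U) :
    L.lop (fun y => (-2 * L.ε * L.d y) • L.n y + (-L.t y) • L.φ y) x =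
      (l₁ + l₂) • ((-2 * L.ε * L.d x) • L.n x - L.t x • L.φ x) - (l₁ * l₂) • (L.φ x - a) := by
  have e : L.lop (fun y => (-2 * L.ε * L.d y) • L.n y + (-L.t y) • L.φ y) x =
      L.lop (fun y => l₁ • f₁ y + l₂ • f₂ y) x := lop_congr hx fun y hy => by
    rw [← T.lop_φ_eq hy, lop_φ hy]; module
  rw [e, lop_add (f := fun y => l₁ • f₁ y) (F := fun y => l₂ • f₂ y) hx
      (T.smooth₁.const_smul l₁) (T.smooth₂.const_smul l₂),
    lop_const_smul _ hx T.smooth₁, lop_const_smul _ hx T.smooth₂, T.lop₁ x hx, T.lop₂ x hx,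
    ← lop_φ hx, T.lop_φ_eq hx, T.sum x hx]
  module

omit T in
theorem lop_expand (hx : x ∈ L.U) :
    L.lop (fun y => (-2 * L.ε * L.d y) • L.n y + (-L.t y) • L.φ y) x =
      (-2 * L.ε * L.d x) • L.lop L.n x + (-2 * L.ε * L.lop L.d x) • L.n x
      + (2 : ℝ) • ((-2 * L.ε) • L.cross L.d L.n x)
      - L.t x • L.lop L.φ x - L.lop L.t x • L.φ x - (2 : ℝ) • L.cross L.t L.φ x := by
  have hd : ContDiffOn ℝ ∞ (fun y => -2 * L.ε * L.d y) L.U := contDiffOn_const.mul smooth_d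
  have ht : ContDiffOn ℝ ∞ (fun y => -L.t y) L.U := smooth_t.neg
  have pt : ∀ k, pd k (fun y => -L.t y) x = -pd k L.t x := fun k => der_neg
  have pdd : ∀ k, pd k (fun y => -2 * L.ε * L.d y) x = -2 * L.ε * pd k L.d x :=
    fun k => der_const_mul (diffAt_of_smooth L.isOpen smooth_d hx)
  have lt : L.lop (fun y => -L.t y) x = -L.lop L.t x := by
    have := lop_const_smul (-1) hx (smooth_t (L := L))
    simpa using this
  have ld : L.lop (fun y => -2 * L.ε * L.d y) x = -2 * L.ε * L.lop L.d x :=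
    lop_const_smul _ hx smooth_d
  rw [lop_add (f := fun y => (-2 * L.ε * L.d y) • L.n y) (F := fun y => (-L.t y) • L.φ y) hx
      (hd.smul L.smooth_n) (ht.smul L.smooth_φ), lop_smul hx hd L.smooth_n,
    lop_smul hx ht L.smooth_φ, lt, ld]
  simp only [cross, pt, pdd]
  module

/-- The tangential component of the fourth order equation. -/
theorem tangent_eq (hx : x ∈ L.U) (v : Plane) :
    l₁ * l₂ * ip a (fderiv ℝ L.φ x v) = -6 * L.ε * L.d x * fderiv ℝ L.d x v
      - 2 * fderiv ℝ L.t x (L.S x v) + 2 * L.t x * fderiv ℝ L.t x v := by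
  have key : ∀ k, l₁ * l₂ * ip a (pd k L.φ x) = -6 * L.ε * L.d x * pd k L.d x
      - 2 * (L.s 0 k x * pd 0 L.t x + L.s 1 k x * pd 1 L.t x) + 2 * L.t x * pd k L.t x := by
    intro k
    have e := congrArg (ip (pd k L.φ x)) (T.lop_lop hx)
    rw [lop_expand hx, lop_n hx, lop_φ hx, cross_n hx] at e
    simp only [ip_add_right, ip_sub_right, ip_smul_right, ip_X_cross_φ hx, ip_X_gradVec hx,
      ip_comm _ (L.n x), ip_comm _ (L.φ x), ip_n_pd hx, ip_φ_pd hx, ip_comm _ a] at e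
    linear_combination -e
  rw [fderiv_S, fderiv_eq_pd L.φ x v, fderiv_eq_pd L.d x v, fderiv_eq_pd L.t x v, ip_add_right,
    ip_smul_right, ip_smul_right]
  simp only [smul_eq_mul]
  linear_combination v 0 * key 0 + v 1 * key 1

/-- The component of the fourth order equation along the unit normal. -/
theorem normal_eq (hx : x ∈ L.U) : l₁ * l₂ * ip a (L.n x) =
    -2 * L.ε * L.t x * L.d x ^ 2 - 2 * L.lop L.d x + 2 * L.t x * L.d x
      + 2 * (l₁ + l₂) * L.d x := by
  have e := congrArg (ip (L.n x)) (T.lop_lop hx)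
  rw [lop_expand hx, lop_n hx, lop_φ hx, cross_n hx] at e
  simp only [ip_add_right, ip_sub_right, ip_smul_right, ip_n_cross_φ hx, ip_n_gradVec hx,
    L.n_n x hx, L.n_φ x hx, ip_comm _ a] at e
  have := eps_sq (L := L)
  linear_combination -e + (-2 * L.ε * L.t x * L.d x ^ 2 - 2 * L.lop L.d x
    + 2 * L.t x * L.d x + 2 * (l₁ + l₂) * L.d x) * this

/-- The component of the fourth order equation along the position vector. -/
theorem position_eq (hx : x ∈ L.U) : l₁ * l₂ * ip a (L.φ x) =
    4 * L.ε * L.d x ^ 2 - L.t x ^ 2 + L.lop L.t x - (l₁ + l₂) * L.t x - l₁ * l₂ := by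
  have e := congrArg (ip (L.φ x)) (T.lop_lop hx)
  rw [lop_expand hx, lop_n hx, lop_φ hx, cross_n hx] at e
  simp only [ip_add_right, ip_sub_right, ip_smul_right, ip_φ_cross_φ hx, ip_φ_gradVec hx,
    ip_comm (L.φ x) (L.n x), L.φ_φ x hx, L.n_φ x hx, ip_comm _ a] at e
  linear_combination -e

end TwoType

/-- `L₁` of the height function of the normal field. -/
theorem lop_ip_n (hx : x ∈ L.U) (a : R42) : L.lop (fun y => ip a (L.n y)) x =
    ip a (L.gradVec L.d x) + L.ε * L.t x * L.d x * ip a (L.n x) + 2 * L.d x * ip a (L.φ x) := by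
  have := lop_clm (LinearMap.toContinuousLinearMap (ip a)) hx L.smooth_n
  simp only [LinearMap.coe_toContinuousLinearMap'] at this
  rw [this, lop_n hx, ip_add_right, ip_add_right, ip_smul_right, ip_smul_right]

end LocalSurface

variable {M : Type*} [TopologicalSpace M] [ChartedSpace (EuclideanSpace ℝ (Fin 2)) M]
  [IsManifold (𝓡 2) ∞ M]

/-! ### Passage to a chart -/

section chart

variable {V : Type*} [NormedAddCommGroup V] [NormedSpace ℝ V]

/-- The coordinate expression of a map in the chart around `p`. -/
def inChart (p : M) (F : M → V) : Plane → V := F ∘ (extChartAt (𝓡 2) p).symm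

theorem smooth_inChart {F : M → V} (hF : ContMDiff (𝓡 2) 𝓘(ℝ, V) ∞ F) (p : M) :
    ContDiffOn ℝ ∞ (inChart p F) (extChartAt (𝓡 2) p).target :=
  contMDiffOn_iff_contDiffOn.1 (hF.comp_contMDiffOn (contMDiffOn_extChartAt_symm p))

/-- The differential of the chart around `p`. -/
def tau (p q : M) : TangentSpace (𝓡 2) q →ₗ[ℝ] Plane :=
  ContinuousLinearMap.toLinearMap (M₂ := Plane)
    (mfderiv (𝓡 2) 𝓘(ℝ, Plane) (extChartAt (𝓡 2) p) q)

omit [IsManifold (𝓡 2) ∞ M] [NormedAddCommGroup V] [NormedSpace ℝ V] in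
theorem inChart_apply {p q : M} (hq : q ∈ (extChartAt (𝓡 2) p).source) (F : M → V) :
    inChart p F (extChartAt (𝓡 2) p q) = F q := by
  rw [inChart, Function.comp_apply, (extChartAt (𝓡 2) p).left_inv hq]

/-- The differential of a map with values in a normed space. -/
def mdiff (F : M → V) (q : M) : TangentSpace (𝓡 2) q →ₗ[ℝ] V :=
  ContinuousLinearMap.toLinearMap (M₂ := V) (mfderiv (𝓡 2) 𝓘(ℝ, V) F q)

theorem mdiff_eq_of_differentiableAt {F : M → V} {p q : M}
    (hq : q ∈ (extChartAt (𝓡 2) p).source)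
    (hF : DifferentiableAt ℝ (inChart p F) (extChartAt (𝓡 2) p q)) (X : TangentSpace (𝓡 2) q) :
    mdiff F q X =
      fderiv ℝ (inChart p F) (extChartAt (𝓡 2) p q) (tau p q X) := by
  have h1 : HasMFDerivAt 𝓘(ℝ, Plane) 𝓘(ℝ, V) (inChart p F) (extChartAt (𝓡 2) p q) _ :=
    hF.hasFDerivAt.hasMFDerivAt
  have h2 := (mdifferentiableAt_extChartAt (I := 𝓡 2)
    (by rwa [extChartAt_source] at hq : q ∈ (chartAt _ p).source)).hasMFDerivAt
  have h3 := h1.comp q h2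
  have h4 : F =ᶠ[nhds q] inChart p F ∘ extChartAt (𝓡 2) p :=
    Filter.eventuallyEq_of_mem ((isOpen_extChartAt_source p).mem_nhds hq)
      fun y hy => (inChart_apply hy F).symm
  have h5 := (h3.congr_of_eventuallyEq h4).mfderiv
  rw [mdiff, h5]
  rfl

theorem mdiff_eq_inChart {F : M → V} (hF : ContMDiff (𝓡 2) 𝓘(ℝ, V) ∞ F) {p q : M}
    (hq : q ∈ (extChartAt (𝓡 2) p).source) (X : TangentSpace (𝓡 2) q) :
    mdiff F q X = fderiv ℝ (inChart p F) (extChartAt (𝓡 2) p q) (tau p q X) :=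
  mdiff_eq_of_differentiableAt hq (diffAt_of_smooth (isOpen_extChartAt_target p)
    (smooth_inChart hF p) ((extChartAt (𝓡 2) p).map_source hq)) X

theorem tau_bijective {p q : M} (hq : q ∈ (extChartAt (𝓡 2) p).source) :
    Function.Bijective (tau p q) := by
  obtain ⟨e, he⟩ := isInvertible_mfderiv_extChartAt (I := 𝓡 2) hq
  have : (tau p q : TangentSpace (𝓡 2) q → Plane) = e := by
    funext X; exact (congrArg (fun f => f X) he).symm
  rw [this]
  exact e.bijective

/-- The differential of the chart around `p`, as a linear equivalence. -/
def tauEquiv {p q : M} (hq : q ∈ (extChartAt (𝓡 2) p).source) :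
    TangentSpace (𝓡 2) q ≃ₗ[ℝ] Plane := LinearEquiv.ofBijective (tau p q) (tau_bijective hq)

end chart

theorem diff_eq {F : M → R42} (hF : ContMDiff (𝓡 2) 𝓘(ℝ, R42) ∞ F) {p q : M}
    (hq : q ∈ (extChartAt (𝓡 2) p).source) (X : TangentSpace (𝓡 2) q) :
    diff F q X = fderiv ℝ (inChart p F) (extChartAt (𝓡 2) p q) (tau p q X) :=
  mdiff_eq_inChart hF hq X

theorem diffFun_eq {F : M → ℝ} (hF : ContMDiff (𝓡 2) 𝓘(ℝ, ℝ) ∞ F) {p q : M}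
    (hq : q ∈ (extChartAt (𝓡 2) p).source) (X : TangentSpace (𝓡 2) q) :
    diffFun F q X = fderiv ℝ (inChart p F) (extChartAt (𝓡 2) p q) (tau p q X) :=
  mdiff_eq_inChart hF hq X

namespace OrientedSurface

variable (W : OrientedSurface M)

/-- The coordinate expression of the surface in the chart around `p`. -/
def loc (p : M) : LocalSurface where
  U := (extChartAt (𝓡 2) p).target
  φ := inChart p W.ψ
  n := inChart p W.N
  ε := W.ε
  isOpen := isOpen_extChartAt_target p
  smooth_φ := smooth_inChart W.smooth_ψ p
  smooth_n := smooth_inChart W.smooth_N p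
  eps_eq := W.eps_eq
  φ_φ _ _ := W.mem_AdS _
  n_n _ _ := W.ip_N_N _
  n_φ _ _ := W.ip_N_ψ _
  n_tangent x hx v := by
    have hq := (extChartAt (𝓡 2) p).map_target hx
    obtain ⟨X, rfl⟩ := (tau_bijective hq).2 v
    have := diff_eq W.smooth_ψ hq X
    rw [(extChartAt (𝓡 2) p).right_inv hx] at this
    rw [← this]
    exact W.ip_N_tangent _ X
  gram_ne x hx h0 := by
    have hq := (extChartAt (𝓡 2) p).map_target hx
    have key : ∀ v : Plane, (∀ i, ip (fderiv ℝ (inChart p W.ψ) x v) (pd i (inChart p W.ψ) x) = 0) →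
        v = 0 := by
      intro v hv
      obtain ⟨X, rfl⟩ := (tau_bijective hq).2 v
      have hX : X = 0 := by
        refine (W.nondegenerate _).1 X fun Y => ?_
        have e := diff_eq W.smooth_ψ hq
        rw [(extChartAt (𝓡 2) p).right_inv hx] at e
        rw [firstForm, LinearMap.BilinForm.comp_apply, e, e, fderiv_eq_pd _ _ (tau p _ Y),
          ip_add_right, ip_smul_right, ip_smul_right, hv, hv]
        ring
      rw [hX, map_zero]
    have he : ∀ i : Fin 2, basisVec i ≠ 0 := fun i h => by
      simpa [basisVec] using congrArg (fun v : Plane => v i) h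
    set E := ip (pd 0 (inChart p W.ψ) x) (pd 0 (inChart p W.ψ) x) with hE
    set F := ip (pd 0 (inChart p W.ψ) x) (pd 1 (inChart p W.ψ) x) with hF
    set G := ip (pd 1 (inChart p W.ψ) x) (pd 1 (inChart p W.ψ) x) with hG
    have hF' : ip (pd 1 (inChart p W.ψ) x) (pd 0 (inChart p W.ψ) x) = F := ip_comm _ _
    have comb : ∀ a b : ℝ, a * E + b * F = 0 → a * F + b * G = 0 → a = 0 ∧ b = 0 := by
      intro a b h1 h2
      have := key (a • basisVec 0 + b • basisVec 1) fun i => by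
        rw [map_add, map_smul, map_smul]
        change ip (a • pd 0 _ x + b • pd 1 _ x) _ = 0
        rw [ip_add_left, ip_smul_left, ip_smul_left]
        fin_cases i
        · exact (congrArg (fun z => a * E + b * z) hF').trans h1
        · exact h2
      constructor
      · simpa [basisVec] using congrArg (fun v : Plane => v 0) this
      · simpa [basisVec] using congrArg (fun v : Plane => v 1) this
    have c1 := comb G (-F) (by linear_combination h0) (by ring)
    have c2 := comb (-F) E (by ring) (by linear_combination h0)
    have c3 := comb 1 0 (by rw [c2.2]; ring) (by linear_combination -c1.2)
    exact one_ne_zero c3.1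

end OrientedSurface

/-! ### The intrinsic operators in a chart -/

namespace LocalSurface

variable (L : LocalSurface) {x : Plane}

/-- The coordinates of the tangential component, as a linear map. -/
def coordLin (x : Plane) : R42 →ₗ[ℝ] Plane :=
  (ip (L.dual 0 x)).smulRight (basisVec 0) + (ip (L.dual 1 x)).smulRight (basisVec 1)

/-- The shape operator in coordinates, as a linear map. -/
def SLin (x : Plane) : Module.End ℝ Plane :=
  -(L.coordLin x ∘ₗ (fderiv ℝ L.n x).toLinearMap)

theorem SLin_apply (v : Plane) : L.SLin x v = L.S x v := rfl

theorem toMatrix_apply (A : Module.End ℝ Plane) (i j : Fin 2) :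
    LinearMap.toMatrix (EuclideanSpace.basisFun (Fin 2) ℝ).toBasis
      (EuclideanSpace.basisFun (Fin 2) ℝ).toBasis A i j = A (basisVec j) i := by
  simp [LinearMap.toMatrix_apply, basisVec]

theorem trace_plane (A : Module.End ℝ Plane) :
    LinearMap.trace ℝ _ A = A (basisVec 0) 0 + A (basisVec 1) 1 := by
  rw [LinearMap.trace_eq_matrix_trace ℝ (EuclideanSpace.basisFun (Fin 2) ℝ).toBasis,
    Matrix.trace_fin_two, toMatrix_apply, toMatrix_apply]

theorem det_plane (A : Module.End ℝ Plane) : LinearMap.det A =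
    A (basisVec 0) 0 * A (basisVec 1) 1 - A (basisVec 1) 0 * A (basisVec 0) 1 := by
  rw [← LinearMap.det_toMatrix (EuclideanSpace.basisFun (Fin 2) ℝ).toBasis,
    Matrix.det_fin_two]
  simp only [toMatrix_apply]

theorem coord_zero (w : R42) : L.coord x w 0 = ip (L.dual 0 x) w := by simp [coord, basisVec]
theorem coord_one (w : R42) : L.coord x w 1 = ip (L.dual 1 x) w := by simp [coord, basisVec]

theorem S_basis (i j : Fin 2) : L.S x (basisVec j) i = L.s i j x := by
  change -(L.coord x (pd j L.n x) i) = _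
  fin_cases i
  · exact congrArg Neg.neg (L.coord_zero _)
  · exact congrArg Neg.neg (L.coord_one _)

theorem trace_S : LinearMap.trace ℝ _ (L.SLin x) = L.t x := by
  rw [trace_plane, SLin_apply, SLin_apply, S_basis, S_basis, t]

theorem det_S : LinearMap.det (L.SLin x) = L.d x := by
  rw [det_plane, SLin_apply, SLin_apply, S_basis, S_basis, S_basis, S_basis, d]

variable {L}

/-- The trace of `P₁ ∘ ∇²f` is the operator `lop`. -/
theorem trace_newton_hess (hx : x ∈ L.U) {f : Plane → ℝ} (hf : ContDiffOn ℝ ∞ f L.U) :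
    LinearMap.trace ℝ _ (((-L.t x) • LinearMap.id + L.SLin x) ∘ₗ
      (L.coordLin x ∘ₗ (fderiv ℝ (L.gradVec f) x).toLinearMap)) = L.lop f x := by
  have hG : ContDiffOn ℝ ∞ (L.gradVec f) L.U :=
    ((smooth_pd L.isOpen hf 0).smul (smooth_dual 0)).add
      ((smooth_pd L.isOpen hf 1).smul (smooth_dual 1))
  set A : Fin 2 → Fin 2 → ℝ := fun i j => ip (L.dual i x) (pd j (L.gradVec f) x) with hA
  have key : ∀ j k, ip (pd k L.φ x) (pd j (L.gradVec f) x) = L.cov2 j k f x := by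
    intro j k
    have e : pd j (fun y => ip (pd k L.φ y) (L.gradVec f y)) x = pd j (pd k f) x :=
      der_congr L.isOpen hx fun y hy => ip_X_gradVec hy k
    rw [pd, der_ip (diff_X k hx) (diffAt_of_smooth L.isOpen hG hx)] at e
    change ip (pd j (pd k L.φ) x) _ + ip _ (pd j (L.gradVec f) x) = _ at e
    rw [gradVec, ip_add_right, ip_smul_right, ip_smul_right, ip_comm _ (L.dual 0 x),
      ip_comm _ (L.dual 1 x)] at e
    rw [cov2, smul_eq_mul, smul_eq_mul, Γ, Γ]
    linear_combination e
  have key2 : ∀ j k, L.cov2 j k f x = L.g 0 k x * A 0 j + L.g 1 k x * A 1 j := by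
    intro j k
    rw [← key]
    nth_rw 1 [decomp hx (pd j (L.gradVec f) x)]
    simp only [ip_add_right, ip_sub_right, ip_smul_right, ip_comm _ (L.n x), ip_comm _ (L.φ x),
      ip_n_pd hx, ip_φ_pd hx, hA, ip_pd_pd, g_symm k]
    ring
  have csymm : L.cov2 0 1 f x = L.cov2 1 0 f x := by
    rw [cov2, cov2, pd_comm L.isOpen hx hf 0 1, Γ_symm hx 0 0 1, Γ_symm hx 1 0 1]
  rw [trace_plane]
  have e1 : ∀ (B : Module.End ℝ Plane) (j : Fin 2), ((((-L.t x) • LinearMap.id + L.SLin x) ∘ₗ B)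
      (basisVec j)) = (-L.t x) • B (basisVec j) + L.S x (B (basisVec j)) := fun B j => rfl
  have e2 : ∀ j, (L.coordLin x ∘ₗ (fderiv ℝ (L.gradVec f) x).toLinearMap) (basisVec j) =
      A 0 j • basisVec 0 + A 1 j • basisVec 1 := fun j => rfl
  rw [e1, e1, e2, e2, S_add, S_add, S_smul, S_smul, S_smul, S_smul]
  simp only [PiLp.add_apply, PiLp.smul_apply, S_basis, smul_eq_mul]
  rw [lop, smul_eq_mul, eq_inv_mul_iff_mul_eq₀ (Δ_ne hx)]
  have h10 := h_symm hx 1 0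
  rw [h_eq hx, h_eq hx] at h10
  rw [key2, key2] at csymm
  simp only [key2, h_eq hx, t, Δ_eq, g_symm 1 0, smul_eq_mul, basisVec] at *
  simp
  linear_combination -(L.s 0 0 x * L.g 0 1 x + L.s 1 0 x * L.g 1 1 x) * csymm
    + (L.g 0 1 x * A 0 0 + L.g 1 1 x * A 1 0) * h10

theorem ip_n_fderiv (hx : x ∈ L.U) (v : Plane) : ip (L.n x) (fderiv ℝ L.φ x v) = 0 :=
  L.n_tangent x hx v

theorem ip_φ_fderiv (hx : x ∈ L.U) (v : Plane) : ip (L.φ x) (fderiv ℝ L.φ x v) = 0 :=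
  ip_φ_der hx fun _ => v

/-- Tangent vectors are determined by their products with tangent vectors. -/
theorem plane_ext (hx : x ∈ L.U) {v w : Plane} (h : ∀ z, ip (fderiv ℝ L.φ x v) (fderiv ℝ L.φ x z) =
    ip (fderiv ℝ L.φ x w) (fderiv ℝ L.φ x z)) : v = w := by
  rw [← coord_fderiv hx v, ← coord_fderiv hx w]
  congr 1
  apply ext_frame hx
  · rw [ip_comm, ip_comm (pd 0 L.φ x)]; exact h (basisVec 0)
  · rw [ip_comm, ip_comm (pd 1 L.φ x)]; exact h (basisVec 1)
  · rw [ip_n_fderiv hx, ip_n_fderiv hx]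
  · rw [ip_φ_fderiv hx, ip_φ_fderiv hx]

theorem ip_fderiv_coord (hx : x ∈ L.U) (w : R42) (z : Plane) :
    ip (fderiv ℝ L.φ x (L.coord x w)) (fderiv ℝ L.φ x z) = ip w (fderiv ℝ L.φ x z) := by
  rw [fderiv_coord hx, ip_add_left, ip_sub_left, ip_smul_left, ip_smul_left, ip_n_fderiv hx,
    ip_φ_fderiv hx]
  ring

end LocalSurface

namespace OrientedSurface

variable {M : Type*} [TopologicalSpace M] [ChartedSpace (EuclideanSpace ℝ (Fin 2)) M]
  [IsManifold (𝓡 2) ∞ M] (W : OrientedSurface M) {p q : M}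
  (hq : q ∈ (extChartAt (𝓡 2) p).source)
include hq

theorem mem_loc : extChartAt (𝓡 2) p q ∈ (W.loc p).U := (extChartAt (𝓡 2) p).map_source hq

theorem fderiv_tau (X : TangentSpace (𝓡 2) q) :
    fderiv ℝ (W.loc p).φ (extChartAt (𝓡 2) p q) (tau p q X) = diff W.ψ q X :=
  (diff_eq W.smooth_ψ hq X).symm

omit hq in
omit [IsManifold (𝓡 2) ∞ M] in
theorem firstForm_flat_symm (w : Module.Dual ℝ (TangentSpace (𝓡 2) q))
    (Z : TangentSpace (𝓡 2) q) : firstForm W.ψ q ((W.flat q).symm w) Z = w Z :=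
  LinearMap.BilinForm.apply_toDual_symm_apply (hB := W.nondegenerate q) w Z

theorem tau_flat_symm (w : Module.Dual ℝ (TangentSpace (𝓡 2) q)) {u : R42}
    (hu : ∀ Z, w Z = ip u (diff W.ψ q Z)) :
    tau p q ((W.flat q).symm w) = (W.loc p).coord (extChartAt (𝓡 2) p q) u := by
  have hx := W.mem_loc hq
  refine LocalSurface.plane_ext hx fun z => ?_
  obtain ⟨Z, rfl⟩ := (tau_bijective hq).2 z
  rw [LocalSurface.ip_fderiv_coord hx, W.fderiv_tau hq, W.fderiv_tau hq, ← hu]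
  exact W.firstForm_flat_symm w Z

theorem tau_tang (u : R42) :
    tau p q (W.tang q u) = (W.loc p).coord (extChartAt (𝓡 2) p q) u :=
  W.tau_flat_symm hq _ fun _ => rfl

theorem tau_shape (X : TangentSpace (𝓡 2) q) :
    tau p q (W.shape q X) = (W.loc p).S (extChartAt (𝓡 2) p q) (tau p q X) := by
  have : W.shape q X = -(W.tang q (diff W.N q X)) := rfl
  rw [this, map_neg, W.tau_tang hq, diff_eq W.smooth_N hq]
  rfl

theorem conj_shape : (tauEquiv hq).conj (W.shape q) = (W.loc p).SLin (extChartAt (𝓡 2) p q) := by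
  ext1 v
  obtain ⟨X, rfl⟩ := (tauEquiv hq).surjective v
  rw [LinearEquiv.conj_apply_apply, LinearEquiv.symm_apply_apply]
  exact W.tau_shape hq X

theorem trace_shape : LinearMap.trace ℝ _ (W.shape q) = (W.loc p).t (extChartAt (𝓡 2) p q) := by
  rw [← LocalSurface.trace_S, ← W.conj_shape hq, LinearMap.trace_conj']

theorem det_shape : LinearMap.det (W.shape q) = (W.loc p).d (extChartAt (𝓡 2) p q) := by
  rw [← LocalSurface.det_S, ← W.conj_shape hq, LinearEquiv.conj_apply, LinearMap.comp_assoc,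
    LinearMap.det_conj]

theorem gradField_eq {f : M → ℝ} (hf : ContMDiff (𝓡 2) 𝓘(ℝ, ℝ) ∞ f) :
    W.gradField f q = (W.loc p).gradVec (inChart p f) (extChartAt (𝓡 2) p q) := by
  have hx := W.mem_loc hq
  set u := (W.loc p).gradVec (inChart p f) (extChartAt (𝓡 2) p q) with hu
  have hu' : ∀ Z, diffFun f q Z = ip u (diff W.ψ q Z) := by
    intro Z
    rw [diffFun_eq hf hq, ← W.fderiv_tau hq, fderiv_eq_pd, fderiv_eq_pd (W.loc p).φ, ip_add_right,
      ip_smul_right, ip_smul_right, ip_comm u, ip_comm u, LocalSurface.ip_X_gradVec hx,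
      LocalSurface.ip_X_gradVec hx]
    rfl
  have h1 : tau p q (W.grad f q) = _ := W.tau_flat_symm hq _ hu'
  rw [gradField, ← W.fderiv_tau hq, h1, LocalSurface.fderiv_coord hx,
    LocalSurface.ip_n_gradVec hx, LocalSurface.ip_φ_gradVec hx]
  simp

omit hq in
theorem inChart_gradField {f : M → ℝ} (hf : ContMDiff (𝓡 2) 𝓘(ℝ, ℝ) ∞ f) :
    ∀ y ∈ (W.loc p).U, inChart p (W.gradField f) y = (W.loc p).gradVec (inChart p f) y := by
  intro y hy
  have := W.gradField_eq ((extChartAt (𝓡 2) p).map_target hy) hf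
  rwa [(extChartAt (𝓡 2) p).right_inv hy] at this

theorem L1_eq {f : M → ℝ} (hf : ContMDiff (𝓡 2) 𝓘(ℝ, ℝ) ∞ f) :
    W.L1 f q = (W.loc p).lop (inChart p f) (extChartAt (𝓡 2) p q) := by
  have hx := W.mem_loc hq
  have hf' := smooth_inChart hf p
  set x := extChartAt (𝓡 2) p q with hxdef
  rw [← LocalSurface.trace_newton_hess hx hf', L1, ← LinearMap.trace_conj' _ (tauEquiv hq)]
  congr 1
  ext1 v
  obtain ⟨X, rfl⟩ := (tauEquiv hq).surjective v
  rw [LinearEquiv.conj_apply_apply, LinearEquiv.symm_apply_apply]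
  have e1 : ∀ Y, tau p q (W.newton q Y) =
      -(W.loc p).t x • tau p q Y + (W.loc p).S x (tau p q Y) := by
    intro Y
    have : W.newton q Y = (-2 * W.ε * W.meanCurv q) • Y + W.shape q Y := rfl
    rw [this, map_add, map_smul, W.tau_shape hq, meanCurv, W.trace_shape hq]
    have := LocalSurface.eps_sq (L := W.loc p)
    change W.ε * W.ε = 1 at this
    congr 2
    linear_combination -(W.loc p).t x * this
  have e2 : diff (W.gradField f) q X =
      fderiv ℝ ((W.loc p).gradVec (inChart p f)) x (tau p q X) := by
    have hG : ContDiffOn ℝ ∞ ((W.loc p).gradVec (inChart p f)) (W.loc p).U :=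
      ((smooth_pd (W.loc p).isOpen hf' 0).smul (LocalSurface.smooth_dual 0)).add
        ((smooth_pd (W.loc p).isOpen hf' 1).smul (LocalSurface.smooth_dual 1))
    have ev : inChart p (W.gradField f) =ᶠ[nhds x] (W.loc p).gradVec (inChart p f) :=
      Filter.eventuallyEq_of_mem ((W.loc p).isOpen.mem_nhds hx) (W.inChart_gradField hf)
    rw [← ev.fderiv_eq]
    exact mdiff_eq_of_differentiableAt hq
      (ev.differentiableAt_iff.2 (diffAt_of_smooth (W.loc p).isOpen hG hx)) X
  have e3 : tau p q (W.hess f q X) = (W.loc p).coord x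
      (fderiv ℝ ((W.loc p).gradVec (inChart p f)) x (tau p q X)) := by
    rw [← e2]; exact W.tau_tang hq _
  change tau p q (W.newton q (W.hess f q X)) = _
  rw [e1, e3]
  rfl

theorem L1vec_eq {F : M → R42} (hF : ContMDiff (𝓡 2) 𝓘(ℝ, R42) ∞ F) :
    W.L1vec F q = (W.loc p).lop (inChart p F) (extChartAt (𝓡 2) p q) := by
  funext i
  have h1 : ContMDiff (𝓡 2) 𝓘(ℝ, ℝ) ∞ (fun y => F y i) := contMDiff_pi_space.1 hF i
  have h2 := LocalSurface.lop_clm (ContinuousLinearMap.proj (R := ℝ) (φ := fun _ : Fin 4 => ℝ) i)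
    (W.mem_loc hq) (smooth_inChart hF p)
  rw [L1vec, W.L1_eq hq h1]
  exact h2

omit hq in
/-- The chart expression of a surface of `L₁`-2-type. -/
theorem twoType_loc {a : R42} {ψ₁ ψ₂ : M → R42} {l₁ l₂ : ℝ}
    (h₁ : ContMDiff (𝓡 2) 𝓘(ℝ, R42) ∞ ψ₁) (h₂ : ContMDiff (𝓡 2) 𝓘(ℝ, R42) ∞ ψ₂)
    (hs : ∀ p, W.ψ p = a + ψ₁ p + ψ₂ p) (e₁ : ∀ p, W.L1vec ψ₁ p = l₁ • ψ₁ p)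
    (e₂ : ∀ p, W.L1vec ψ₂ p = l₂ • ψ₂ p) (p : M) :
    (W.loc p).TwoType a (inChart p ψ₁) (inChart p ψ₂) l₁ l₂ where
  smooth₁ := smooth_inChart h₁ p
  smooth₂ := smooth_inChart h₂ p
  sum x _ := hs _
  lop₁ x hx := by
    have := W.L1vec_eq ((extChartAt (𝓡 2) p).map_target hx) h₁
    rw [(extChartAt (𝓡 2) p).right_inv hx] at this
    rw [← this, e₁]; rfl
  lop₂ x hx := by
    have := W.L1vec_eq ((extChartAt (𝓡 2) p).map_target hx) h₂
    rw [(extChartAt (𝓡 2) p).right_inv hx] at this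
    rw [← this, e₂]; rfl

/-! ### Constancy of functions on a connected surface -/

/-- The trace of the shape operator. -/
def tr (q : M) : ℝ := LinearMap.trace ℝ _ (W.shape q)

/-- The determinant of the shape operator. -/
def dt (q : M) : ℝ := LinearMap.det (W.shape q)

omit hq in
theorem tr_symm {x : Plane} (hx : x ∈ (W.loc p).U) : inChart p W.tr x = (W.loc p).t x := by
  have := W.trace_shape ((extChartAt (𝓡 2) p).map_target hx)
  rwa [(extChartAt (𝓡 2) p).right_inv hx] at this

omit hq in
theorem dt_symm {x : Plane} (hx : x ∈ (W.loc p).U) : inChart p W.dt x = (W.loc p).d x := by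
  have := W.det_shape ((extChartAt (𝓡 2) p).map_target hx)
  rwa [(extChartAt (𝓡 2) p).right_inv hx] at this

end OrientedSurface

section constancy

variable {M : Type*} [TopologicalSpace M] [ChartedSpace (EuclideanSpace ℝ (Fin 2)) M]

theorem locallyConst_of_chart {Z : Type*} {F : M → Z}
    (h : ∀ p, ∀ x ∈ (extChartAt (𝓡 2) p).target, ∃ U ∈ nhds x, ∀ y ∈ U,
      inChart p F y = inChart p F x) : IsLocallyConstant F := by
  rw [IsLocallyConstant.iff_eventually_eq]
  intro p
  obtain ⟨U, hU, hc⟩ := h p _ (mem_extChartAt_target (I := 𝓡 2) p)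
  have h1 : ∀ᶠ q in nhds p, extChartAt (𝓡 2) p q ∈ U :=
    (continuousAt_extChartAt (I := 𝓡 2) p).preimage_mem_nhds hU
  filter_upwards [h1, extChartAt_source_mem_nhds (I := 𝓡 2) p] with q h2 h3
  have := hc _ h2
  rwa [inChart_apply h3, inChart_apply (mem_extChartAt_source p)] at this

/-- A map on a connected surface whose derivative vanishes in every chart is constant. -/
theorem const_of_fderiv_eq_zero [ConnectedSpace M] {V : Type*} [NormedAddCommGroup V]
    [NormedSpace ℝ V] {F : M → V}
    (hF : ∀ p, DifferentiableOn ℝ (inChart p F) (extChartAt (𝓡 2) p).target)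
    (h : ∀ p, ∀ x ∈ (extChartAt (𝓡 2) p).target, fderiv ℝ (inChart p F) x = 0) :
    ∃ c, ∀ q, F q = c := by
  have hl : IsLocallyConstant F := by
    refine locallyConst_of_chart fun p x hx => ?_
    obtain ⟨r, hr, hb⟩ := Metric.isOpen_iff.1 (isOpen_extChartAt_target (I := 𝓡 2) p) x hx
    refine ⟨_, Metric.ball_mem_nhds x hr, fun y hy => ?_⟩
    refine (convex_ball x r).is_const_of_fderivWithin_eq_zero ((hF p).mono hb) (fun z hz => ?_) hy
      (Metric.mem_ball_self hr)
    rw [fderivWithin_of_isOpen Metric.isOpen_ball hz, h p z (hb hz)]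
  exact ⟨F (Classical.arbitrary M), fun q => hl.apply_eq_of_preconnectedSpace _ _⟩

theorem exists_derivative_eq (R : Polynomial ℝ) : ∃ Q : Polynomial ℝ, Q.derivative = R := by
  induction R using Polynomial.induction_on' with
  | add p q hp hq =>
    obtain ⟨P, rfl⟩ := hp
    obtain ⟨Q, rfl⟩ := hq
    exact ⟨P + Q, Polynomial.derivative_add⟩
  | monomial n c =>
    refine ⟨Polynomial.monomial (n + 1) (c / (n + 1)), ?_⟩
    rw [Polynomial.derivative_monomial]
    have : (n : ℝ) + 1 ≠ 0 := by positivity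
    congr 1
    push_cast
    field_simp

/-- If a non-zero polynomial in a function annihilates its differential, the function is
constant. -/
theorem const_of_poly_smul [ConnectedSpace M] {f : M → ℝ}
    (hf : ∀ p, DifferentiableOn ℝ (inChart p f) (extChartAt (𝓡 2) p).target)
    {R : Polynomial ℝ} (hR : R ≠ 0)
    (h : ∀ p, ∀ x ∈ (extChartAt (𝓡 2) p).target, ∀ v,
      R.eval (inChart p f x) * fderiv ℝ (inChart p f) x v = 0) : ∃ c, ∀ q, f q = c := by
  obtain ⟨Q, hQ⟩ := exists_derivative_eq R
  have hopen := fun p : M => isOpen_extChartAt_target (I := 𝓡 2) p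
  have hd : ∀ p, ∀ x ∈ (extChartAt (𝓡 2) p).target, HasFDerivAt
      (inChart p fun q => Q.eval (f q)) (R.eval (inChart p f x) • fderiv ℝ (inChart p f) x) x := by
    intro p x hx
    have h1 := (Q.hasDerivAt (inChart p f x)).comp_hasFDerivAt x
      ((hf p).differentiableAt ((hopen p).mem_nhds hx)).hasFDerivAt
    rwa [hQ] at h1
  obtain ⟨c, hc⟩ := const_of_fderiv_eq_zero (F := fun q => Q.eval (f q))
    (fun p x hx => (hd p x hx).differentiableAt.differentiableWithinAt)
    (fun p x hx => by
      rw [(hd p x hx).fderiv]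
      ext v
      exact h p x hx v)
  have hne : Q - Polynomial.C c ≠ 0 := by
    intro h0
    apply hR
    rw [← hQ, sub_eq_zero.1 h0, Polynomial.derivative_C]
  have hcont : Continuous f := by
    rw [continuous_iff_continuousAt]
    intro p
    have h1 : ContinuousAt (inChart p f ∘ extChartAt (𝓡 2) p) p :=
      ContinuousAt.comp ((hf p).differentiableAt ((hopen p).mem_nhds
        (mem_extChartAt_target p))).continuousAt (continuousAt_extChartAt p)
    exact h1.congr (Filter.eventuallyEq_of_mem (extChartAt_source_mem_nhds (I := 𝓡 2) p)
      fun q hq => inChart_apply hq f)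
  -- `f` takes its values in the finite set of roots of `Q - c`
  have hsub : Set.range f ⊆ (Q - Polynomial.C c).rootSet ℝ := by
    rintro _ ⟨q, rfl⟩
    rw [Polynomial.mem_rootSet]
    refine ⟨hne, ?_⟩
    simp [hc q]
  have hss := ((Polynomial.rootSet_finite _ ℝ).countable.isTotallyDisconnected) _ hsub
    (isPreconnected_range hcont)
  exact ⟨f (Classical.arbitrary M), fun q => hss ⟨q, rfl⟩ ⟨_, rfl⟩⟩

end constancy

namespace LocalSurface

variable {L : LocalSurface} {x : Plane}

/-! ### Moving frames -/

/-- Restriction of a surface to a smaller coordinate domain. -/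
def restrict (L : LocalSurface) {V : Set Plane} (hV : IsOpen V) (hVU : V ⊆ L.U) :
    LocalSurface where
  U := V
  φ := L.φ
  n := L.n
  ε := L.ε
  isOpen := hV
  smooth_φ := L.smooth_φ.mono hVU
  smooth_n := L.smooth_n.mono hVU
  eps_eq := L.eps_eq
  φ_φ x hx := L.φ_φ x (hVU hx)
  n_n x hx := L.n_n x (hVU hx)
  n_φ x hx := L.n_φ x (hVU hx)
  n_tangent x hx := L.n_tangent x (hVU hx)
  gram_ne x hx := L.gram_ne x (hVU hx)

/-- The ambient metric evaluated on tangent vectors. -/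
def met (L : LocalSurface) (x v w : Plane) : ℝ := ip (fderiv ℝ L.φ x v) (fderiv ℝ L.φ x w)

theorem met_comm (v w : Plane) : L.met x v w = L.met x w v := ip_comm _ _
theorem met_add_left (u v w : Plane) : L.met x (u + v) w = L.met x u w + L.met x v w := by
  simp only [met, map_add, LinearMap.add_apply]
theorem met_add_right (u v w : Plane) : L.met x u (v + w) = L.met x u v + L.met x u w := by
  simp only [met, map_add]
theorem met_sub_left (u v w : Plane) : L.met x (u - v) w = L.met x u w - L.met x v w := by
  simp only [met, map_sub, LinearMap.sub_apply]
theorem met_sub_right (u v w : Plane) : L.met x u (v - w) = L.met x u v - L.met x u w := by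
  simp only [met, map_sub]
theorem met_smul_left (c : ℝ) (v w : Plane) : L.met x (c • v) w = c * L.met x v w := by
  simp only [met, map_smul, LinearMap.smul_apply, smul_eq_mul]
theorem met_smul_right (c : ℝ) (v w : Plane) : L.met x v (c • w) = c * L.met x v w := by
  simp only [met, map_smul, smul_eq_mul]

theorem smooth_met {v w : Plane → Plane} (hv : ContDiffOn ℝ ∞ v L.U) (hw : ContDiffOn ℝ ∞ w L.U) :
    ContDiffOn ℝ ∞ (fun x => L.met x (v x) (w x)) L.U :=
  smooth_ip (smooth_der L.isOpen hv L.smooth_φ) (smooth_der L.isOpen hw L.smooth_φ)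

theorem smooth_S {v : Plane → Plane} (hv : ContDiffOn ℝ ∞ v L.U) :
    ContDiffOn ℝ ∞ (fun x => L.S x (v x)) L.U :=
  (smooth_coord (smooth_der L.isOpen hv L.smooth_n)).neg

theorem met_S (hx : x ∈ L.U) (v w : Plane) : L.met x (L.S x v) w = L.met x v (L.S x w) := by
  have h10 := h_symm hx 1 0
  have e : ∀ v w : Plane, L.met x (L.S x v) w = v 0 * w 0 * L.h 0 0 x + v 0 * w 1 * L.h 0 1 x
      + v 1 * w 0 * L.h 1 0 x + v 1 * w 1 * L.h 1 1 x := by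
    intro v w
    rw [met, fderiv_φ_S hx, fderiv_eq_pd L.n, fderiv_eq_pd L.φ]
    simp only [h, ip_neg_left, ip_add_left, ip_smul_left, ip_add_right, ip_smul_right]
    ring
  rw [e, met_comm, e, h10]
  ring

/-- The area form of the coordinate plane. -/
def area (v w : Plane) : ℝ := v 0 * w 1 - v 1 * w 0

theorem met_gram (v w : Plane) :
    L.met x v v * L.met x w w - L.met x v w ^ 2 = area v w ^ 2 * L.Δ x := by
  simp only [met, fderiv_eq_pd L.φ, ip_add_left, ip_smul_left, ip_add_right, ip_smul_right, area,
    Δ, ip_comm (pd 1 L.φ x) (pd 0 L.φ x)]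
  ring

theorem t_mul_area (v w : Plane) :
    L.t x * area v w = area (L.S x v) w + area v (L.S x w) := by
  simp [area, t, S_eq, basisVec]; ring

theorem d_mul_area (v w : Plane) : L.d x * area v w = area (L.S x v) (L.S x w) := by
  simp [area, d, S_eq, basisVec]; ring

theorem fderiv_φ_injective (hx : x ∈ L.U) {v w : Plane}
    (h : fderiv ℝ L.φ x v = fderiv ℝ L.φ x w) : v = w := by
  rw [← coord_fderiv hx v, h, coord_fderiv hx]

/-- Ambient vectors are equal if they have the same products with a tangent frame and the
normals. -/
theorem ext_tangent (hx : x ∈ L.U) {ξ η : Plane}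
    (hm : L.met x ξ ξ * L.met x η η - L.met x ξ η ^ 2 ≠ 0) {v w : R42}
    (h1 : ip (fderiv ℝ L.φ x ξ) v = ip (fderiv ℝ L.φ x ξ) w)
    (h2 : ip (fderiv ℝ L.φ x η) v = ip (fderiv ℝ L.φ x η) w)
    (hn : ip (L.n x) v = ip (L.n x) w) (hφ : ip (L.φ x) v = ip (L.φ x) w) : v = w := by
  rw [← sub_eq_zero]
  refine (gram_pos_and_ext L.eps_eq hm (L.n_n x hx) (L.φ_φ x hx) (L.n_φ x hx) (ip_n_fderiv hx _)
    (ip_n_fderiv hx _) (ip_φ_fderiv hx _) (ip_φ_fderiv hx _)).2 _ ?_ ?_ ?_ ?_ <;>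
  rw [ip_sub_right, sub_eq_zero] <;> assumption

theorem met_ext (hx : x ∈ L.U) {ξ η : Plane}
    (hm : L.met x ξ ξ * L.met x η η - L.met x ξ η ^ 2 ≠ 0) {v w : Plane}
    (h1 : L.met x ξ v = L.met x ξ w) (h2 : L.met x η v = L.met x η w) : v = w := by
  apply fderiv_φ_injective hx
  apply ext_tangent hx hm h1 h2
  · rw [ip_n_fderiv hx, ip_n_fderiv hx]
  · rw [ip_φ_fderiv hx, ip_φ_fderiv hx]

section fields

variable {ξ η : Plane → Plane}

theorem smooth_derφ (hξ : ContDiffOn ℝ ∞ ξ L.U) : ContDiffOn ℝ ∞ (der ξ L.φ) L.U :=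
  smooth_der L.isOpen hξ L.smooth_φ

theorem diffU {V : Type*} [NormedAddCommGroup V] [NormedSpace ℝ V] {f : Plane → V}
    (hx : x ∈ L.U) (hf : ContDiffOn ℝ ∞ f L.U) : DifferentiableAt ℝ f x :=
  diffAt_of_smooth L.isOpen hf hx

/-- The `φ`-component of the second derivative of the immersion. -/
theorem ip_φ_der2 (hx : x ∈ L.U) (hη : ContDiffOn ℝ ∞ η L.U) :
    ip (L.φ x) (der ξ (der η L.φ) x) = -L.met x (ξ x) (η x) := by
  have h := der_eq_zero (ξ := ξ) L.isOpen hx fun y hy => ip_φ_der (L := L) hy η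
  rw [der_ip (diff_φ hx) (diffU hx (smooth_derφ hη))] at h
  change L.met x (ξ x) (η x) + _ = 0 at h
  linarith

/-- The normal component of the second derivative of the immersion. -/
theorem ip_n_der2 (hx : x ∈ L.U) (hη : ContDiffOn ℝ ∞ η L.U) :
    ip (L.n x) (der ξ (der η L.φ) x) = L.met x (L.S x (ξ x)) (η x) := by
  have h := der_eq_zero (ξ := ξ) L.isOpen hx fun y hy => ip_n_fderiv (L := L) hy (η y)
  change der ξ (fun y => ip (L.n y) (der η L.φ y)) x = 0 at h
  rw [der_ip (diff_n hx) (diffU hx (smooth_derφ hη))] at h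
  rw [met, fderiv_φ_S hx, ip_neg_left]
  change ip (fderiv ℝ L.n x (ξ x)) (fderiv ℝ L.φ x (η x)) + _ = 0 at h
  linarith

/-- The commutator of two vector fields acts on functions by the tangent vector
`D_ξ η - D_η ξ`. -/
theorem der_comm (hx : x ∈ L.U) (hξ : ContDiffOn ℝ ∞ ξ L.U) (hη : ContDiffOn ℝ ∞ η L.U) {b : Plane}
    (hb : der ξ (der η L.φ) x - der η (der ξ L.φ) x = fderiv ℝ L.φ x b)
    {V : Type*} [NormedAddCommGroup V] [NormedSpace ℝ V] {f : Plane → V}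
    (hf : ContDiffOn ℝ ∞ f L.U) :
    der ξ (der η f) x - der η (der ξ f) x = fderiv ℝ f x b := by
  rw [der_bracket L.isOpen hx hξ hη L.smooth_φ] at hb
  rw [der_bracket L.isOpen hx hξ hη hf, fderiv_φ_injective hx hb]

end fields

/-! ### Frames of principal directions -/

/-- An orthonormal frame of eigenvectors of the shape operator. -/
structure EigenFrame (L : LocalSurface) (ξ η : Plane → Plane) (k l : Plane → ℝ) (σ τ : ℝ) :
    Prop where
  smooth_ξ : ContDiffOn ℝ ∞ ξ L.U
  smooth_η : ContDiffOn ℝ ∞ η L.U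
  smooth_k : ContDiffOn ℝ ∞ k L.U
  smooth_l : ContDiffOn ℝ ∞ l L.U
  S_ξ : ∀ x ∈ L.U, L.S x (ξ x) = k x • ξ x
  S_η : ∀ x ∈ L.U, L.S x (η x) = l x • η x
  ξ_ξ : ∀ x ∈ L.U, L.met x (ξ x) (ξ x) = σ
  η_η : ∀ x ∈ L.U, L.met x (η x) (η x) = τ
  ξ_η : ∀ x ∈ L.U, L.met x (ξ x) (η x) = 0
  σ_sq : σ * σ = 1
  τ_sq : τ * τ = 1

namespace EigenFrame

variable {ξ η : Plane → Plane} {k l : Plane → ℝ} {σ τ : ℝ} (E : EigenFrame L ξ η k l σ τ)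

include E

theorem gram_ne (hx : x ∈ L.U) :
    L.met x (ξ x) (ξ x) * L.met x (η x) (η x) - L.met x (ξ x) (η x) ^ 2 ≠ 0 := by
  rw [E.ξ_ξ x hx, E.η_η x hx, E.ξ_η x hx]
  intro h
  have : (σ * τ) * (σ * τ) = 1 := by linear_combination τ * τ * E.σ_sq + E.τ_sq
  rw [show σ * τ = 0 by linarith] at this
  norm_num at this

omit E in
/-- The connection coefficient `⟨∇_ξ η, ξ⟩ / ⟨ξ, ξ⟩`. -/
def conn (L : LocalSurface) (ξ η : Plane → Plane) (σ : ℝ) (x : Plane) : ℝ :=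
  σ * ip (der ξ L.φ x) (der ξ (der η L.φ) x)

theorem smooth_α : ContDiffOn ℝ ∞ (conn L ξ η σ) L.U :=
  contDiffOn_const.mul (smooth_ip (smooth_derφ E.smooth_ξ)
    (smooth_der L.isOpen E.smooth_ξ (smooth_derφ E.smooth_η)))

theorem swap : EigenFrame L η ξ l k τ σ where
  smooth_ξ := E.smooth_η
  smooth_η := E.smooth_ξ
  smooth_k := E.smooth_l
  smooth_l := E.smooth_k
  S_ξ := E.S_η
  S_η := E.S_ξ
  ξ_ξ := E.η_η
  η_η := E.ξ_ξ
  ξ_η x hx := (met_comm _ _).trans (E.ξ_η x hx)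
  σ_sq := E.τ_sq
  τ_sq := E.σ_sq

theorem der_ξ_η (hx : x ∈ L.U) : der ξ (der η L.φ) x = conn L ξ η σ x • der ξ L.φ x := by
  have h2 := der_eq_zero (ξ := ξ) L.isOpen hx E.η_η
  change der ξ (fun y => ip (der η L.φ y) (der η L.φ y)) x = 0 at h2
  rw [der_ip (diffU hx (smooth_derφ E.smooth_η)) (diffU hx (smooth_derφ E.smooth_η)),
    ip_comm] at h2
  apply ext_tangent hx (E.gram_ne hx)
  · change ip (der ξ L.φ x) _ = ip (der ξ L.φ x) _
    have h := E.ξ_ξ x hx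
    change ip (der ξ L.φ x) (der ξ L.φ x) = σ at h
    rw [ip_smul_right, h, conn]
    linear_combination -ip (der ξ L.φ x) (der ξ (der η L.φ) x) * E.σ_sq
  · change ip (der η L.φ x) _ = ip (der η L.φ x) _
    have h := E.ξ_η x hx
    change ip (der ξ L.φ x) (der η L.φ x) = 0 at h
    rw [ip_smul_right, ip_comm _ (der ξ L.φ x), h]
    linarith
  · rw [ip_n_der2 hx E.smooth_η, E.S_ξ x hx, met_smul_left, E.ξ_η x hx, ip_smul_right,
      show ip (L.n x) (der ξ L.φ x) = 0 from ip_n_fderiv hx _]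
    ring
  · rw [ip_φ_der2 hx E.smooth_η, E.ξ_η x hx, ip_smul_right, ip_φ_der hx]; ring

theorem der_ξ_ξ (hx : x ∈ L.U) : der ξ (der ξ L.φ) x =
    -(σ * τ * conn L ξ η σ x) • der η L.φ x + (σ * L.ε * k x) • L.n x + σ • L.φ x := by
  have h1 := der_eq_zero (ξ := ξ) L.isOpen hx E.ξ_ξ
  have h2 := der_eq_zero (ξ := ξ) L.isOpen hx E.ξ_η
  have sξ := diffU hx (smooth_derφ E.smooth_ξ)
  have sη := diffU hx (smooth_derφ E.smooth_η)
  change der ξ (fun y => ip (der ξ L.φ y) (der ξ L.φ y)) x = 0 at h1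
  change der ξ (fun y => ip (der ξ L.φ y) (der η L.φ y)) x = 0 at h2
  rw [der_ip sξ sξ, ip_comm] at h1
  rw [der_ip sξ sη, E.der_ξ_η hx, ip_smul_right] at h2
  have hn : ∀ v, ip (L.n x) (fderiv ℝ L.φ x v) = 0 := ip_n_fderiv hx
  have hφ : ∀ v, ip (L.φ x) (fderiv ℝ L.φ x v) = 0 := ip_φ_fderiv hx
  have m1 : ip (der ξ L.φ x) (der ξ L.φ x) = σ := E.ξ_ξ x hx
  have m2 : ip (der ξ L.φ x) (der η L.φ x) = 0 := E.ξ_η x hx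
  have m3 : ip (der η L.φ x) (der η L.φ x) = τ := E.η_η x hx
  apply ext_tangent hx (E.gram_ne hx)
  · change ip (der ξ L.φ x) _ = ip (der ξ L.φ x) _
    simp only [ip_add_right, ip_smul_right, m2]
    rw [ip_comm (der ξ L.φ x) (L.n x), ip_comm (der ξ L.φ x) (L.φ x), der, hn, hφ]
    simp only [der] at *
    linarith
  · change ip (der η L.φ x) _ = ip (der η L.φ x) _
    simp only [ip_add_right, ip_smul_right, m3]
    rw [ip_comm (der η L.φ x) (L.n x), ip_comm (der η L.φ x) (L.φ x)]
    rw [ip_comm, m1] at h2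
    have a1 : ip (L.n x) (der η L.φ x) = 0 := hn _
    have a2 : ip (L.φ x) (der η L.φ x) = 0 := hφ _
    rw [a1, a2]
    linear_combination h2 + σ * conn L ξ η σ x * E.τ_sq
  · rw [ip_n_der2 hx E.smooth_ξ, E.S_ξ x hx, met_smul_left, E.ξ_ξ x hx]
    simp only [ip_add_right, ip_smul_right, L.n_n x hx, L.n_φ x hx]
    have a1 : ip (L.n x) (der η L.φ x) = 0 := hn _
    rw [a1]
    linear_combination -(σ * k x) * eps_sq (L := L)
  · rw [ip_φ_der2 hx E.smooth_ξ, E.ξ_ξ x hx]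
    simp only [ip_add_right, ip_smul_right, L.φ_φ x hx, ip_comm (L.φ x) (L.n x), L.n_φ x hx]
    have a1 : ip (L.φ x) (der η L.φ x) = 0 := hφ _
    rw [a1]
    ring

theorem der_n (hx : x ∈ L.U) : der ξ L.n x = -(k x • der ξ L.φ x) := by
  have h := fderiv_φ_S hx (ξ x)
  rw [E.S_ξ x hx, map_smul] at h
  rw [der, der, h, neg_neg]

theorem comm (hx : x ∈ L.U) {V : Type*} [NormedAddCommGroup V] [NormedSpace ℝ V] {f : Plane → V}
    (hf : ContDiffOn ℝ ∞ f L.U) : der ξ (der η f) x - der η (der ξ f) x =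
      conn L ξ η σ x • der ξ f x - conn L η ξ τ x • der η f x := by
  have h := der_comm hx E.smooth_ξ E.smooth_η
    (b := conn L ξ η σ x • ξ x - conn L η ξ τ x • η x)
    (by rw [E.der_ξ_η hx, E.swap.der_ξ_η hx, map_sub, map_smul, map_smul]; rfl) hf
  rw [h, map_sub, map_smul, map_smul]; rfl

/-- Codazzi equation. -/
theorem codazzi (hx : x ∈ L.U) : der η k x = (l x - k x) * conn L ξ η σ x := by
  have sξ := diffU hx (smooth_derφ E.smooth_ξ)
  have sη := diffU hx (smooth_derφ E.smooth_η)
  have h1 : der ξ (der η L.n) x = der ξ (fun y => -(l y • der η L.φ y)) x :=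
    der_congr L.isOpen hx fun y hy => E.swap.der_n hy
  have h2 : der η (der ξ L.n) x = der η (fun y => -(k y • der ξ L.φ y)) x :=
    der_congr L.isOpen hx fun y hy => E.der_n hy
  rw [der_neg, der_smul (diffU hx E.smooth_l) sη, E.der_ξ_η hx] at h1
  rw [der_neg, der_smul (diffU hx E.smooth_k) sξ, E.swap.der_ξ_η hx] at h2
  have h3 := E.comm hx L.smooth_n
  rw [h1, h2, E.der_n hx, E.swap.der_n hx] at h3
  have h4 := congrArg (ip (der ξ L.φ x)) h3
  have m1 : ip (der ξ L.φ x) (der ξ L.φ x) = σ := E.ξ_ξ x hx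
  have m2 : ip (der ξ L.φ x) (der η L.φ x) = 0 := E.ξ_η x hx
  simp only [ip_sub_right, ip_neg_right, ip_add_right, ip_smul_right, m1, m2] at h4
  linear_combination σ * h4 + (-(der η k x) + (l x - k x) * conn L ξ η σ x) * E.σ_sq

/-- Gauss equation. -/
theorem gauss (hx : x ∈ L.U) : der ξ (conn L η ξ τ) x + σ * τ * der η (conn L ξ η σ) x
    + σ * (L.ε * k x * l x - 1) = -(σ * τ * conn L ξ η σ x ^ 2) - conn L η ξ τ x ^ 2 := by
  have sξ := diffU hx (smooth_derφ E.smooth_ξ)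
  have sη := diffU hx (smooth_derφ E.smooth_η)
  have sα := diffU hx E.smooth_α
  have sβ := diffU hx E.swap.smooth_α
  have h1 : der ξ (der η (der ξ L.φ)) x = der ξ (fun y => conn L η ξ τ y • der η L.φ y) x :=
    der_congr L.isOpen hx fun y hy => E.swap.der_ξ_η hy
  have h2 : der η (der ξ (der ξ L.φ)) x = der η (fun y => ((-(σ * τ)) * conn L ξ η σ y) • der η L.φ y
      + ((σ * L.ε) * k y) • L.n y + σ • L.φ y) x :=
    der_congr L.isOpen hx fun y hy => by rw [E.der_ξ_ξ hy]; module
  have c1 : DifferentiableAt ℝ (fun y => (-(σ * τ)) * conn L ξ η σ y) x := sα.const_mul _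
  have c2 : DifferentiableAt ℝ (fun y => (σ * L.ε) * k y) x :=
    (diffU hx E.smooth_k).const_mul _
  rw [der_smul sβ sη] at h1
  rw [der_add ((c1.fun_smul sη).fun_add (c2.fun_smul (diff_n hx))) ((diff_φ hx).fun_const_smul σ),
    der_add (c1.fun_smul sη) (c2.fun_smul (diff_n hx)), der_smul c1 sη, der_smul c2 (diff_n hx),
    der_const_smul (diff_φ hx), der_const_mul sα, der_const_mul (diffU hx E.smooth_k),
    E.swap.der_n hx] at h2
  have h3 := E.comm hx (smooth_derφ E.smooth_ξ)
  rw [h1, h2, E.der_ξ_ξ hx, E.swap.der_ξ_η hx, E.der_ξ_η hx, E.swap.der_ξ_ξ hx] at h3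
  have h4 := congrArg (ip (der η L.φ x)) h3
  have m2 : ip (der η L.φ x) (der ξ L.φ x) = 0 := E.swap.ξ_η x hx
  have m3 : ip (der η L.φ x) (der η L.φ x) = τ := E.η_η x hx
  have a1 : ip (L.n x) (der η L.φ x) = 0 := ip_n_fderiv hx _
  have a2 : ip (L.φ x) (der η L.φ x) = 0 := ip_φ_fderiv hx _
  simp only [ip_sub_right, ip_neg_right, ip_add_right, ip_smul_right, m2, m3,
    ip_comm _ (L.n x), ip_comm _ (L.φ x), a1, a2] at h4
  linear_combination τ * h4 - (der ξ (conn L η ξ τ) x + σ * τ * der η (conn L ξ η σ) x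
    + σ * (L.ε * k x * l x - 1) + (σ * τ * conn L ξ η σ x ^ 2) + conn L η ξ τ x ^ 2) * E.τ_sq

end EigenFrame
end LocalSurface

namespace LocalSurface

/-! ### Frames of principal directions with a constant principal curvature -/

variable {L : LocalSurface} {x : Plane}

namespace EigenFrame

variable {ξ η : Plane → Plane} {k l : Plane → ℝ} {σ τ : ℝ} (E : EigenFrame L ξ η k l σ τ)

include E

theorem d_eq (hx : x ∈ L.U) : L.d x = k x * l x := by
  have h := d_mul_area (L := L) (x := x) (ξ x) (η x)
  have hne : area (ξ x) (η x) ≠ 0 := fun h0 => E.gram_ne hx (by rw [met_gram, h0]; ring)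
  rw [E.S_ξ x hx, E.S_η x hx] at h
  apply mul_right_cancel₀ hne
  rw [h]
  simp [area]; ring

theorem t_eq (hx : x ∈ L.U) : L.t x = k x + l x := by
  have h := t_mul_area (L := L) (x := x) (ξ x) (η x)
  have hne : area (ξ x) (η x) ≠ 0 := fun h0 => E.gram_ne hx (by rw [met_gram, h0]; ring)
  rw [E.S_ξ x hx, E.S_η x hx] at h
  apply mul_right_cancel₀ hne
  rw [h]
  simp [area]; ring

/-- If the principal curvatures are constant and distinct, the principal directions are
parallel. -/
theorem conn_eq_zero {c : ℝ} (hk : ∀ x ∈ L.U, k x = c) (hkl : ∀ x ∈ L.U, l x ≠ k x)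
    (hx : x ∈ L.U) : conn L ξ η σ x = 0 := by
  have h := E.codazzi hx
  rw [der_eq_zero L.isOpen hx hk] at h
  exact (mul_eq_zero.1 h.symm).resolve_left (sub_ne_zero.2 (hkl x hx))

/-- A surface with two distinct constant principal curvatures is flat. -/
theorem eps_mul_eq_one {c c' : ℝ} (hk : ∀ x ∈ L.U, k x = c) (hl : ∀ x ∈ L.U, l x = c')
    (hkl : c ≠ c') (hx : x ∈ L.U) : L.ε * c * c' = 1 := by
  have h1 : ∀ y ∈ L.U, conn L ξ η σ y = 0 := fun y hy =>
    E.conn_eq_zero hk (fun z hz => by rw [hk z hz, hl z hz]; exact hkl.symm) hy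
  have h2 : ∀ y ∈ L.U, conn L η ξ τ y = 0 := fun y hy =>
    E.swap.conn_eq_zero hl (fun z hz => by rw [hk z hz, hl z hz]; exact hkl) hy
  have h := E.gauss hx
  rw [der_eq_zero L.isOpen hx h1, der_eq_zero L.isOpen hx h2, h1 x hx, h2 x hx, hk x hx,
    hl x hx] at h
  linear_combination σ * h - (L.ε * c * c' - 1) * E.σ_sq

/-- There is no surface of `L₁`-2-type with one principal curvature zero and the other nowhere
zero: along the geodesics tangent to the kernel of the shape operator the connection coefficient
`β` satisfies both `β' = σ - β²` and a polynomial equation. -/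
theorem false_of_twoType {a : R42} {f₁ f₂ : Plane → R42} {l₁ l₂ : ℝ}
    (T : TwoType L a f₁ f₂ l₁ l₂) (hk : ∀ x ∈ L.U, k x = 0) (hl : ∀ x ∈ L.U, l x ≠ 0)
    (hx : x ∈ L.U) : False := by
  have hα : ∀ y ∈ L.U, conn L ξ η σ y = 0 := fun y hy =>
    E.conn_eq_zero hk (fun z hz => by rw [hk z hz]; exact hl z hz) hy
  set β := conn L η ξ τ with hβdef
  have sβ : ∀ y ∈ L.U, DifferentiableAt ℝ β y := fun y hy => diffU hy E.swap.smooth_α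
  have sl : ∀ y ∈ L.U, DifferentiableAt ℝ l y := fun y hy => diffU hy E.smooth_l
  have sξ : ∀ y ∈ L.U, DifferentiableAt ℝ (der ξ L.φ) y := fun y hy =>
    diffU hy (smooth_derφ E.smooth_ξ)
  have dl : ∀ y ∈ L.U, der ξ l y = -(l y * β y) := fun y hy => by
    have h : der ξ l y = (k y - l y) * β y := E.swap.codazzi hy
    rw [h, hk y hy]; ring
  have dβ : ∀ y ∈ L.U, der ξ β y = σ - β y ^ 2 := fun y hy => by
    have h := E.gauss hy
    rw [der_eq_zero L.isOpen hy hα, hα y hy, hk y hy] at h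
    change der ξ β y + _ + _ = _ - β y ^ 2 at h
    linear_combination h
  have t_eq : ∀ y ∈ L.U, L.t y = l y := fun y hy => by rw [E.t_eq hy, hk y hy, zero_add]
  have d_eq : ∀ y ∈ L.U, L.d y = 0 := fun y hy => by rw [E.d_eq hy, hk y hy, zero_mul]
  -- the tangential equation along the kernel direction, and its first two derivatives
  have e0 : ∀ y ∈ L.U, l₁ * l₂ * ip a (der ξ L.φ y) = -2 * (l y ^ 2 * β y) := by
    intro y hy
    have h := T.tangent_eq hy (ξ y)
    have hd : fderiv ℝ L.d y (ξ y) = 0 := der_eq_zero (ξ := ξ) L.isOpen hy d_eq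
    have ht : fderiv ℝ L.t y (ξ y) = -(l y * β y) :=
      (der_congr (ξ := ξ) L.isOpen hy t_eq).trans (dl y hy)
    rw [E.S_ξ y hy, hk y hy, zero_smul, map_zero, hd, ht, t_eq y hy] at h
    change l₁ * l₂ * ip a (der ξ L.φ y) = _ at h
    rw [h]; ring
  have hξξ : ∀ y ∈ L.U, der ξ (der ξ L.φ) y = σ • L.φ y := fun y hy => by
    rw [E.der_ξ_ξ hy, hα y hy, hk y hy]; simp
  have dip : ∀ y, ∀ f : Plane → R42, DifferentiableAt ℝ f y →
      der ξ (fun z => l₁ * l₂ * ip a (f z)) y = l₁ * l₂ * ip a (der ξ f y) := by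
    intro y f hf
    have h1 : DifferentiableAt ℝ (fun z => ip a (f z)) y := by
      have := (LinearMap.toContinuousLinearMap (ip a)).differentiableAt (x := f y)
      exact this.comp y hf
    rw [der_const_mul h1, der_ip (differentiableAt_const a) hf, der_const, ip_zero_left, zero_add]
  have e1 : ∀ y ∈ L.U, l₁ * l₂ * ip a (σ • L.φ y) =
      (l y * l y) * (6 * (β y * β y) - 2 * σ) := by
    intro y hy
    have h := der_congr (ξ := ξ) L.isOpen hy e0
    have c1 : DifferentiableAt ℝ (fun z => l z * l z) y := (sl y hy).fun_mul (sl y hy)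
    have h' : der ξ (fun z => -2 * (l z ^ 2 * β z)) y = der ξ (fun z => -2 * ((l z * l z) * β z)) y :=
      der_congr L.isOpen hy fun z _ => by ring
    rw [dip y _ (sξ y hy), hξξ y hy, h', der_const_mul (c1.fun_mul (sβ y hy)),
      der_mul c1 (sβ y hy), der_mul (sl y hy) (sl y hy), dl y hy, dβ y hy] at h
    linear_combination h
  have e2 : ∀ y ∈ L.U, β y * (4 * (β y * β y) - 3 * σ) = 0 := by
    intro y hy
    have h := der_congr (ξ := ξ) L.isOpen hy e1
    have c1 : DifferentiableAt ℝ (fun z => l z * l z) y := (sl y hy).fun_mul (sl y hy)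
    have c2 : DifferentiableAt ℝ (fun z => β z * β z) y := (sβ y hy).fun_mul (sβ y hy)
    have c3 : DifferentiableAt ℝ (fun z => 6 * (β z * β z)) y := c2.const_mul _
    rw [dip y _ ((diff_φ hy).fun_const_smul σ), der_const_smul (diff_φ hy), ip_smul_right,
      der_mul c1 (c3.sub_const _), der_sub c3 (differentiableAt_const _), der_const,
      der_const_mul c2, der_mul (sl y hy) (sl y hy), der_mul (sβ y hy) (sβ y hy), dl y hy,
      dβ y hy] at h
    apply mul_left_cancel₀ (pow_ne_zero 2 (hl y hy))
    linear_combination (1 / 6) * h - (σ / 6) * e0 y hy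
  have e3 : ∀ y ∈ L.U, (12 * β y ^ 2 - 3 * σ) * (σ - β y ^ 2) = 0 := by
    intro y hy
    have h := der_eq_zero (ξ := ξ) L.isOpen hy e2
    have c2 : DifferentiableAt ℝ (fun z => β z * β z) y := (sβ y hy).fun_mul (sβ y hy)
    have c3 : DifferentiableAt ℝ (fun z => 4 * (β z * β z)) y := c2.const_mul _
    rw [der_mul (sβ y hy) (c3.sub_const _), der_sub c3 (differentiableAt_const _), der_const,
      der_const_mul c2, der_mul (sβ y hy) (sβ y hy), dβ y hy] at h
    linear_combination h
  have h3 := e3 x hx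
  have hσ := E.σ_sq
  rcases mul_eq_zero.1 (e2 x hx) with h | h
  · rw [h] at h3
    linarith
  · have hb : β x ^ 2 = 3 / 4 * σ := by linarith
    rw [hb] at h3
    linarith

end EigenFrame
end LocalSurface

namespace LocalSurface

variable {L : LocalSurface} {x : Plane}

/-! ### Null frames -/

/-- A frame of null vector fields with `⟨ξ, η⟩ = -1`. -/
structure NullFrame (L : LocalSurface) (ξ η : Plane → Plane) : Prop where
  smooth_ξ : ContDiffOn ℝ ∞ ξ L.U
  smooth_η : ContDiffOn ℝ ∞ η L.U
  ξ_ξ : ∀ x ∈ L.U, L.met x (ξ x) (ξ x) = 0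
  η_η : ∀ x ∈ L.U, L.met x (η x) (η x) = 0
  ξ_η : ∀ x ∈ L.U, L.met x (ξ x) (η x) = -1

namespace NullFrame

variable {ξ η : Plane → Plane} (E : NullFrame L ξ η)

/-- The coefficient `α` in `S ξ = (t / 2) ξ + α η`. -/
def off (L : LocalSurface) (ξ : Plane → Plane) (x : Plane) : ℝ := -L.met x (L.S x (ξ x)) (ξ x)

/-- The connection coefficient `p` in `∇_ξ ξ = p ξ`. -/
def conn₁ (L : LocalSurface) (ξ η : Plane → Plane) (x : Plane) : ℝ :=
  -ip (der η L.φ x) (der ξ (der ξ L.φ) x)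

/-- The connection coefficient `q` in `∇_η ξ = q ξ`. -/
def conn₂ (L : LocalSurface) (ξ η : Plane → Plane) (x : Plane) : ℝ :=
  -ip (der η L.φ x) (der η (der ξ L.φ) x)

include E

theorem swap : NullFrame L η ξ where
  smooth_ξ := E.smooth_η
  smooth_η := E.smooth_ξ
  ξ_ξ := E.η_η
  η_η := E.ξ_ξ
  ξ_η x hx := (met_comm _ _).trans (E.ξ_η x hx)

theorem gram_ne (hx : x ∈ L.U) :
    L.met x (ξ x) (ξ x) * L.met x (η x) (η x) - L.met x (ξ x) (η x) ^ 2 ≠ 0 := by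
  rw [E.ξ_ξ x hx, E.η_η x hx, E.ξ_η x hx]
  norm_num

theorem area_ne (hx : x ∈ L.U) : area (ξ x) (η x) ≠ 0 := fun h0 =>
  E.gram_ne hx (by rw [met_gram, h0]; ring)

theorem expand (hx : x ∈ L.U) (v : Plane) :
    v = -(L.met x (η x) v) • ξ x - L.met x (ξ x) v • η x := by
  have h1 := E.ξ_ξ x hx
  have h2 := E.η_η x hx
  have h3 := E.ξ_η x hx
  have h4 := (met_comm (L := L) (x := x) (η x) (ξ x)).trans h3
  apply met_ext hx (E.gram_ne hx)
  · rw [met_sub_right, met_smul_right, met_smul_right, h1, h3]; ring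
  · rw [met_sub_right, met_smul_right, met_smul_right, h2, h4]; ring

theorem S_ξ (hx : x ∈ L.U) : L.S x (ξ x) = (L.t x / 2) • ξ x + off L ξ x • η x := by
  have h1 := E.expand hx (L.S x (ξ x))
  have h2 := E.expand hx (L.S x (η x))
  have h := t_mul_area (L := L) (x := x) (ξ x) (η x)
  have e : L.met x (ξ x) (L.S x (η x)) = L.met x (η x) (L.S x (ξ x)) := by
    rw [← met_S hx, met_comm]
  rw [e] at h2
  rw [h1, h2] at h
  have h' : L.t x = -2 * L.met x (η x) (L.S x (ξ x)) := by
    apply mul_right_cancel₀ (E.area_ne hx)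
    rw [h]
    simp [area]; ring
  rw [h', off, met_comm (L.S x (ξ x))]
  conv_lhs => rw [h1]
  module

theorem d_eq (hx : x ∈ L.U) : L.t x ^ 2 / 4 - off L ξ x * off L η x = L.d x := by
  have h := d_mul_area (L := L) (x := x) (ξ x) (η x)
  rw [E.S_ξ hx, E.swap.S_ξ hx] at h
  apply mul_right_cancel₀ (E.area_ne hx)
  rw [h]
  simp [area]; ring

theorem der_n (hx : x ∈ L.U) :
    der ξ L.n x = -((L.t x / 2) • der ξ L.φ x) - off L ξ x • der η L.φ x := by
  have h := fderiv_φ_S hx (ξ x)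
  rw [E.S_ξ hx, map_add, map_smul, map_smul] at h
  rw [der, ← neg_neg (fderiv ℝ L.n x (ξ x)), ← h, der, der]
  module

theorem smooth_off : ContDiffOn ℝ ∞ (off L ξ) L.U :=
  (smooth_met (smooth_S E.smooth_ξ) E.smooth_ξ).neg

theorem smooth_conn₁ : ContDiffOn ℝ ∞ (conn₁ L ξ η) L.U :=
  (smooth_ip (smooth_derφ E.smooth_η)
    (smooth_der L.isOpen E.smooth_ξ (smooth_derφ E.smooth_ξ))).neg

theorem smooth_conn₂ : ContDiffOn ℝ ∞ (conn₂ L ξ η) L.U :=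
  (smooth_ip (smooth_derφ E.smooth_η)
    (smooth_der L.isOpen E.smooth_η (smooth_derφ E.smooth_ξ))).neg

theorem ip_facts (hx : x ∈ L.U) : ip (der ξ L.φ x) (der ξ L.φ x) = 0 ∧
    ip (der η L.φ x) (der η L.φ x) = 0 ∧ ip (der ξ L.φ x) (der η L.φ x) = -1 ∧
    ip (der η L.φ x) (der ξ L.φ x) = -1 ∧
    ip (L.n x) (der ξ L.φ x) = 0 ∧ ip (L.n x) (der η L.φ x) = 0 ∧
    ip (L.φ x) (der ξ L.φ x) = 0 ∧ ip (L.φ x) (der η L.φ x) = 0 :=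
  ⟨E.ξ_ξ x hx, E.η_η x hx, E.ξ_η x hx, (met_comm _ _).trans (E.ξ_η x hx), ip_n_fderiv hx _,
    ip_n_fderiv hx _, ip_φ_fderiv hx _, ip_φ_fderiv hx _⟩

theorem der_ξ_ξ (hx : x ∈ L.U) : der ξ (der ξ L.φ) x =
    conn₁ L ξ η x • der ξ L.φ x - (L.ε * off L ξ x) • L.n x := by
  obtain ⟨m1, m2, m3, m4, m5, m6, m7, m8⟩ := E.ip_facts hx
  have sξ := diffU hx (smooth_derφ E.smooth_ξ)
  have h1 := der_eq_zero (ξ := ξ) L.isOpen hx E.ξ_ξ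
  change der ξ (fun y => ip (der ξ L.φ y) (der ξ L.φ y)) x = 0 at h1
  rw [der_ip sξ sξ, ip_comm] at h1
  apply ext_tangent hx (E.gram_ne hx)
  · change ip (der ξ L.φ x) _ = ip (der ξ L.φ x) _
    rw [ip_sub_right, ip_smul_right, ip_smul_right, m1, ip_comm _ (L.n x), m5]
    linarith
  · change ip (der η L.φ x) _ = ip (der η L.φ x) _
    rw [ip_sub_right, ip_smul_right, ip_smul_right, m4, ip_comm _ (L.n x), m6, conn₁]
    ring
  · rw [ip_n_der2 hx E.smooth_ξ, ip_sub_right, ip_smul_right, ip_smul_right, m5, L.n_n x hx, off]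
    linear_combination (-L.met x (L.S x (ξ x)) (ξ x)) * eps_sq (L := L)
  · rw [ip_φ_der2 hx E.smooth_ξ, ip_sub_right, ip_smul_right, ip_smul_right, m7, E.ξ_ξ x hx,
      ip_comm, L.n_φ x hx]
    ring

theorem der_η_ξ (hx : x ∈ L.U) : der η (der ξ L.φ) x =
    conn₂ L ξ η x • der ξ L.φ x - (L.ε * (L.t x / 2)) • L.n x - L.φ x := by
  obtain ⟨m1, m2, m3, m4, m5, m6, m7, m8⟩ := E.ip_facts hx
  have sξ := diffU hx (smooth_derφ E.smooth_ξ)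
  have h1 := der_eq_zero (ξ := η) L.isOpen hx E.ξ_ξ
  change der η (fun y => ip (der ξ L.φ y) (der ξ L.φ y)) x = 0 at h1
  rw [der_ip sξ sξ, ip_comm] at h1
  apply ext_tangent hx (E.gram_ne hx)
  · change ip (der ξ L.φ x) _ = ip (der ξ L.φ x) _
    rw [ip_sub_right, ip_sub_right, ip_smul_right, ip_smul_right, m1, ip_comm _ (L.n x), m5,
      ip_comm _ (L.φ x), m7]
    linarith
  · change ip (der η L.φ x) _ = ip (der η L.φ x) _
    rw [ip_sub_right, ip_sub_right, ip_smul_right, ip_smul_right, m4, ip_comm _ (L.n x), m6,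
      ip_comm _ (L.φ x), m8, conn₂]
    ring
  · rw [ip_n_der2 hx E.smooth_ξ, ip_sub_right, ip_sub_right, ip_smul_right, ip_smul_right, m5,
      L.n_n x hx, L.n_φ x hx, E.swap.S_ξ hx, met_add_left, met_smul_left, met_smul_left,
      E.ξ_ξ x hx, E.swap.ξ_η x hx]
    linear_combination (L.t x / 2) * eps_sq (L := L)
  · rw [ip_φ_der2 hx E.smooth_ξ, ip_sub_right, ip_sub_right, ip_smul_right, ip_smul_right, m7,
      E.swap.ξ_η x hx, L.φ_φ x hx, ip_comm, L.n_φ x hx]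
    ring

theorem conn_swap (hx : x ∈ L.U) :
    conn₂ L η ξ x = -conn₁ L ξ η x ∧ conn₁ L η ξ x = -conn₂ L ξ η x := by
  have sξ := diffU hx (smooth_derφ E.smooth_ξ)
  have sη := diffU hx (smooth_derφ E.smooth_η)
  have key : ∀ ζ : Plane → Plane, ip (der ζ (der ξ L.φ) x) (der η L.φ x)
      + ip (der ξ L.φ x) (der ζ (der η L.φ) x) = 0 := by
    intro ζ
    rw [← der_ip sξ sη]
    exact der_eq_zero (ξ := ζ) L.isOpen hx E.ξ_η
  have k1 := key ξ
  have k2 := key η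
  rw [ip_comm] at k1 k2
  simp only [conn₁, conn₂]
  constructor <;> linarith

theorem comm (hx : x ∈ L.U) {V : Type*} [NormedAddCommGroup V] [NormedSpace ℝ V] {f : Plane → V}
    (hf : ContDiffOn ℝ ∞ f L.U) : der ξ (der η f) x - der η (der ξ f) x =
      -(conn₁ L ξ η x • der η f x) - conn₂ L ξ η x • der ξ f x := by
  have h := der_comm hx E.smooth_ξ E.smooth_η
    (b := -(conn₁ L ξ η x • η x) - conn₂ L ξ η x • ξ x)
    (by
      rw [E.der_η_ξ hx, E.swap.der_η_ξ hx, (E.conn_swap hx).1, map_sub, map_neg, map_smul,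
        map_smul, der, der]
      module) hf
  rw [h, map_sub, map_neg, map_smul, map_smul]; rfl

/-- Codazzi equation for constant mean curvature. -/
theorem codazzi {c : ℝ} (ht : ∀ y ∈ L.U, L.t y = c) (hx : x ∈ L.U) :
    der η (off L ξ) x = 2 * conn₂ L ξ η x * off L ξ x := by
  obtain ⟨m1, m2, m3, m4, m5, m6, m7, m8⟩ := E.ip_facts hx
  have sξ := diffU hx (smooth_derφ E.smooth_ξ)
  have sη := diffU hx (smooth_derφ E.smooth_η)
  have h1 : der ξ (der η L.n) x =
      der ξ (fun y => (-(c / 2)) • der η L.φ y - off L η y • der ξ L.φ y) x :=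
    der_congr L.isOpen hx fun y hy => by rw [E.swap.der_n hy, ht y hy]; module
  have h2 : der η (der ξ L.n) x =
      der η (fun y => (-(c / 2)) • der ξ L.φ y - off L ξ y • der η L.φ y) x :=
    der_congr L.isOpen hx fun y hy => by rw [E.der_n hy, ht y hy]; module
  have oξ := diffU hx E.smooth_off
  have oη := diffU hx E.swap.smooth_off
  rw [der_sub (sη.fun_const_smul _) (oη.fun_smul sξ), der_const_smul sη, der_smul oη sξ] at h1
  rw [der_sub (sξ.fun_const_smul _) (oξ.fun_smul sη), der_const_smul sξ, der_smul oξ sη] at h2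
  have h3 := E.comm hx L.smooth_n
  rw [h1, h2, E.der_n hx, E.swap.der_n hx, E.der_ξ_ξ hx, E.der_η_ξ hx, E.swap.der_ξ_ξ hx,
    E.swap.der_η_ξ hx, (E.conn_swap hx).1, (E.conn_swap hx).2, ht x hx] at h3
  have h4 := congrArg (ip (der ξ L.φ x)) h3
  simp only [ip_sub_right, ip_neg_right, ip_add_right, ip_smul_right, m1, m3,
    ip_comm _ (L.n x), ip_comm _ (L.φ x), m5, m7] at h4
  linear_combination -h4

/-- Gauss equation. -/
theorem gauss {c : ℝ} (ht : ∀ y ∈ L.U, L.t y = c) (hx : x ∈ L.U) :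
    der ξ (conn₂ L ξ η) x - der η (conn₁ L ξ η) x + 2 * conn₁ L ξ η x * conn₂ L ξ η x
      + (L.ε * L.d x - 1) = 0 := by
  obtain ⟨m1, m2, m3, m4, m5, m6, m7, m8⟩ := E.ip_facts hx
  have sξ := diffU hx (smooth_derφ E.smooth_ξ)
  have h1 : der ξ (der η (der ξ L.φ)) x =
      der ξ (fun y => conn₂ L ξ η y • der ξ L.φ y - (L.ε * (c / 2)) • L.n y - L.φ y) x :=
    der_congr L.isOpen hx fun y hy => by rw [E.der_η_ξ hy, ht y hy]
  have h2 : der η (der ξ (der ξ L.φ)) x =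
      der η (fun y => conn₁ L ξ η y • der ξ L.φ y - (L.ε * off L ξ y) • L.n y) x :=
    der_congr L.isOpen hx fun y hy => E.der_ξ_ξ hy
  have o1 := diffU hx E.smooth_conn₁
  have o2 := diffU hx E.smooth_conn₂
  have o3 := diffU hx E.smooth_off
  have o4 : DifferentiableAt ℝ (fun y => L.ε * off L ξ y) x := o3.const_mul _
  rw [der_sub ((o2.fun_smul sξ).fun_sub ((diff_n hx).fun_const_smul _)) (diff_φ hx),
    der_sub (o2.fun_smul sξ) ((diff_n hx).fun_const_smul _), der_smul o2 sξ,
    der_const_smul (diff_n hx)] at h1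
  rw [der_sub (o1.fun_smul sξ) (o4.fun_smul (diff_n hx)), der_smul o1 sξ, der_smul o4 (diff_n hx),
    der_const_mul o3] at h2
  have h3 := E.comm hx (smooth_derφ E.smooth_ξ)
  rw [h1, h2, E.der_n hx, E.swap.der_n hx, E.der_ξ_ξ hx, E.der_η_ξ hx, ht x hx] at h3
  have h4 := congrArg (ip (der η L.φ x)) h3
  simp only [ip_sub_right, ip_neg_right, ip_add_right, ip_smul_right, m2, m4,
    ip_comm _ (L.n x), ip_comm _ (L.φ x), m6, m8] at h4
  rw [← E.d_eq hx, ht x hx]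
  linear_combination -h4

/-- If the shape operator has constant characteristic polynomial without double root, the
surface is flat. -/
theorem eps_d_eq_one {c c' : ℝ} (ht : ∀ y ∈ L.U, L.t y = c) (hd : ∀ y ∈ L.U, L.d y = c')
    (hcc : c ^ 2 ≠ 4 * c') (hx : x ∈ L.U) : L.ε * c' = 1 := by
  have o1 := fun y hy => diffU (L := L) (x := y) hy E.smooth_conn₁
  have o2 := fun y hy => diffU (L := L) (x := y) hy E.smooth_conn₂
  have o3 := fun y hy => diffU (L := L) (x := y) hy E.smooth_off
  have o4 := fun y hy => diffU (L := L) (x := y) hy E.swap.smooth_off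
  have prod : ∀ y ∈ L.U, off L ξ y * off L η y = c ^ 2 / 4 - c' := fun y hy => by
    have := E.d_eq hy
    rw [ht y hy, hd y hy] at this
    linarith
  have ne : ∀ y ∈ L.U, off L ξ y ≠ 0 ∧ off L η y ≠ 0 := fun y hy => by
    have h1 : off L ξ y * off L η y ≠ 0 := by
      rw [prod y hy]; intro h; exact hcc (by linarith)
    exact ⟨left_ne_zero_of_mul h1, right_ne_zero_of_mul h1⟩
  have e2 : ∀ y ∈ L.U, der η (off L ξ) y = 2 * (conn₂ L ξ η y * off L ξ y) := fun y hy => by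
    rw [E.codazzi ht hy]; ring
  have e1 : ∀ y ∈ L.U, der ξ (off L ξ) y = 2 * (conn₁ L ξ η y * off L ξ y) := fun y hy => by
    have h := der_eq_zero (ξ := ξ) L.isOpen hy prod
    rw [der_mul (o3 y hy) (o4 y hy), E.swap.codazzi ht hy, (E.conn_swap hy).1] at h
    apply mul_right_cancel₀ (ne y hy).2
    linear_combination h
  have h := E.comm hx E.smooth_off
  rw [der_congr L.isOpen hx e1, der_congr L.isOpen hx e2,
    der_const_mul ((o1 x hx).fun_mul (o3 x hx)), der_const_mul ((o2 x hx).fun_mul (o3 x hx)),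
    der_mul (o1 x hx) (o3 x hx), der_mul (o2 x hx) (o3 x hx), e1 x hx, e2 x hx] at h
  simp only [smul_eq_mul] at h
  have g := E.gauss ht hx
  rw [hd x hx] at g
  have h' : 2 * off L ξ x * (L.ε * c' - 1) = 0 := by
    linear_combination 2 * off L ξ x * g - h
  have := (mul_eq_zero.1 h').resolve_left (mul_ne_zero two_ne_zero (ne x hx).1)
  linarith

end NullFrame
end LocalSurface

namespace LocalSurface

variable {L : LocalSurface} {x : Plane}

/-! ### Existence of adapted frames -/

theorem met_ext_all (hx : x ∈ L.U) {v w : Plane} (h : ∀ z, L.met x v z = L.met x w z) : v = w :=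
  plane_ext hx h

/-- A self-adjoint operator is determined by its quadratic form. -/
theorem exists_met_ne_zero (hx : x ∈ L.U) {A : Plane → Plane} (hadd : ∀ v w, A (v + w) = A v + A w)
    (hself : ∀ v w, L.met x (A v) w = L.met x (A w) v) {u : Plane} (hu : A u ≠ 0) :
    ∃ v, L.met x (A v) v ≠ 0 := by
  by_contra! h
  apply hu
  have h0 : ∀ z, L.met x z 0 = 0 := fun z => by simp [met]
  refine met_ext_all hx fun z => ?_
  have h1 := h (u + z)
  rw [hadd, met_add_left, met_add_right, met_add_right, h u, h z, hself z u] at h1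
  rw [met_comm 0, h0]
  linarith

theorem isOpen_pos {f : Plane → ℝ} (hf : ContDiffOn ℝ ∞ f L.U) : IsOpen {x ∈ L.U | 0 < f x} := by
  have := hf.continuousOn.isOpen_inter_preimage L.isOpen isOpen_Ioi (t := Set.Ioi (0 : ℝ))
  exact this

theorem isOpen_ne_zero {f : Plane → ℝ} (hf : ContDiffOn ℝ ∞ f L.U) : IsOpen {x ∈ L.U | f x ≠ 0} := by
  have := hf.continuousOn.isOpen_inter_preimage L.isOpen _root_.isOpen_ne (t := {y : ℝ | y ≠ 0})
  exact this

/-- Normalization of a non-null vector field. -/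
theorem exists_normalized (hx : x ∈ L.U) {ζ : Plane → Plane} (hζ : ContDiffOn ℝ ∞ ζ L.U)
    (hne : L.met x (ζ x) (ζ x) ≠ 0) : ∃ (V : Set Plane) (c : Plane → ℝ) (σ : ℝ), IsOpen V ∧
      x ∈ V ∧ V ⊆ L.U ∧ ContDiffOn ℝ ∞ c V ∧ σ * σ = 1 ∧ (∀ y ∈ V, c y ≠ 0) ∧
      ∀ y ∈ V, L.met y (c y • ζ y) (c y • ζ y) = σ := by
  have hm := smooth_met hζ hζ
  obtain ⟨σ, hσ, hpos⟩ : ∃ σ : ℝ, σ * σ = 1 ∧ 0 < σ * L.met x (ζ x) (ζ x) := by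
    rcases lt_or_gt_of_ne hne with h | h
    · exact ⟨-1, by norm_num, by linarith⟩
    · exact ⟨1, by norm_num, by linarith⟩
  have hs : ContDiffOn ℝ ∞ (fun y => σ * L.met y (ζ y) (ζ y)) L.U := contDiffOn_const.mul hm
  refine ⟨_, fun y => (Real.sqrt (σ * L.met y (ζ y) (ζ y)))⁻¹, σ, isOpen_pos hs, ⟨hx, hpos⟩,
    fun y hy => hy.1, ?_, hσ, fun y hy => (inv_pos.2 (Real.sqrt_pos.2 hy.2)).ne', fun y hy => ?_⟩
  · have hs' := hs.mono (fun y hy => hy.1 : {y ∈ L.U | 0 < σ * L.met y (ζ y) (ζ y)} ⊆ L.U)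
    exact (hs'.sqrt fun y hy => hy.2.ne').inv fun y hy => (Real.sqrt_pos.2 hy.2).ne'
  · have h := hy.2
    rw [met_smul_left, met_smul_right, ← mul_assoc, ← mul_inv, Real.mul_self_sqrt h.le]
    field_simp
    have h0 : L.met y (ζ y) (ζ y) ≠ 0 := fun h0 => by rw [h0] at h; simp at h
    have h1 : σ ≠ 0 := fun h0 => by rw [h0] at hσ; simp at hσ
    field_simp
    linarith

/-- Near a point with two distinct real principal curvatures there is an orthonormal frame of
principal directions. -/
theorem exists_eigenFrame (hx : x ∈ L.U) {k l : Plane → ℝ} (hk : ContDiffOn ℝ ∞ k L.U)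
    (hl : ContDiffOn ℝ ∞ l L.U) (ht : ∀ y ∈ L.U, L.t y = k y + l y)
    (hd : ∀ y ∈ L.U, L.d y = k y * l y) (hne : k x ≠ l x) :
    ∃ (V : Set Plane) (hV : IsOpen V) (hVU : V ⊆ L.U) (ξ η : Plane → Plane) (σ τ : ℝ), x ∈ V ∧
      EigenFrame (L.restrict hV hVU) ξ η k l σ τ := by
  have key : ∀ k l : Plane → ℝ, ContDiffOn ℝ ∞ k L.U → ContDiffOn ℝ ∞ l L.U →
      (∀ y ∈ L.U, L.t y = k y + l y) → (∀ y ∈ L.U, L.d y = k y * l y) → k x ≠ l x →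
      ∃ (V : Set Plane) (ξ : Plane → Plane) (σ : ℝ), IsOpen V ∧ x ∈ V ∧ V ⊆ L.U ∧
        ContDiffOn ℝ ∞ ξ V ∧ σ * σ = 1 ∧ (∀ y ∈ V, L.S y (ξ y) = k y • ξ y) ∧
        ∀ y ∈ V, L.met y (ξ y) (ξ y) = σ := by
    intro k l hk hl ht hd hne
    obtain ⟨u, hu⟩ : ∃ u, L.S x u - l x • u ≠ 0 := by
      by_contra! h
      have h1 := t_mul_area (L := L) (x := x) (basisVec 0) (basisVec 1)
      rw [sub_eq_zero.1 (h _), sub_eq_zero.1 (h _), ht x hx] at h1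
      simp [area, basisVec] at h1
      exact hne (by linarith)
    obtain ⟨v, hv⟩ := exists_met_ne_zero hx (A := fun v => L.S x v - l x • v)
      (fun v w => by rw [S_add]; module)
      (fun v w => by
        rw [met_sub_left, met_sub_left, met_S hx, met_smul_left, met_smul_left, met_comm v,
          met_comm v]) hu
    set ζ : Plane → Plane := fun y => L.S y v - l y • v with hζ
    have sζ : ContDiffOn ℝ ∞ ζ L.U :=
      (smooth_S contDiffOn_const).sub (hl.smul contDiffOn_const)
    have Sζ : ∀ y ∈ L.U, L.S y (ζ y) = k y • ζ y := fun y hy => by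
      rw [hζ]
      simp only
      rw [S_sub, S_smul, S_S, ht y hy, hd y hy]
      module
    have hn : L.met x (ζ x) (ζ x) ≠ 0 := by
      have e : L.met x (ζ x) (ζ x) = (k x - l x) * L.met x (ζ x) v := by
        conv_lhs => rw [hζ]
        simp only
        rw [met_sub_left, met_S hx, Sζ x hx, met_smul_left, met_smul_right, met_comm v]
        ring
      rw [e]
      exact mul_ne_zero (sub_ne_zero.2 hne) hv
    obtain ⟨V, c, σ, hV, hxV, hVU, hc, hσ, -, hm⟩ := exists_normalized hx sζ hn
    exact ⟨V, fun y => c y • ζ y, σ, hV, hxV, hVU, hc.smul (sζ.mono hVU), hσ,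
      fun y hy => by rw [S_smul, Sζ y (hVU hy)]; module, hm⟩
  obtain ⟨V₁, ξ, σ, o₁, x₁, U₁, s₁, hσ, S₁, m₁⟩ := key k l hk hl ht hd hne
  obtain ⟨V₂, η, τ, o₂, x₂, U₂, s₂, hτ, S₂, m₂⟩ := key l k hl hk
    (fun y hy => by rw [ht y hy, add_comm]) (fun y hy => by rw [hd y hy, mul_comm]) hne.symm
  have o₃ := isOpen_ne_zero (hk.sub hl)
  refine ⟨V₁ ∩ V₂ ∩ _, (o₁.inter o₂).inter o₃, fun y hy => U₁ hy.1.1, ξ, η, σ, τ,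
    ⟨⟨x₁, x₂⟩, hx, sub_ne_zero.2 hne⟩, ?_⟩
  exact
    { smooth_ξ := s₁.mono fun y hy => hy.1.1
      smooth_η := s₂.mono fun y hy => hy.1.2
      smooth_k := hk.mono fun y hy => hy.2.1
      smooth_l := hl.mono fun y hy => hy.2.1
      S_ξ := fun y hy => S₁ y hy.1.1
      S_η := fun y hy => S₂ y hy.1.2
      ξ_ξ := fun y hy => m₁ y hy.1.1
      η_η := fun y hy => m₂ y hy.1.2
      ξ_η := fun y hy => by
        have h := met_S (L := L) (x := y) hy.2.1 (ξ y) (η y)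
        rw [S₁ y hy.1.1, S₂ y hy.1.2, met_smul_left, met_smul_right] at h
        have h2 : (k y - l y) * L.met y (ξ y) (η y) = 0 := by linarith
        exact (mul_eq_zero.1 h2).resolve_left hy.2.2
      σ_sq := hσ
      τ_sq := hτ }

theorem exists_met_self_ne_zero (hx : x ∈ L.U) : ∃ v, L.met x v v ≠ 0 := by
  refine exists_met_ne_zero hx (A := id) (fun _ _ => rfl) (fun v w => met_comm _ _)
    (u := basisVec 0) fun h => ?_
  simpa [basisVec] using congrArg (fun v : Plane => v 0) h

/-- A Lorentzian surface has local null frames. -/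
theorem exists_nullFrame (hε : L.ε = 1) (hx : x ∈ L.U) :
    ∃ (V : Set Plane) (hV : IsOpen V) (hVU : V ⊆ L.U) (ξ η : Plane → Plane), x ∈ V ∧
      NullFrame (L.restrict hV hVU) ξ η := by
  have hΔ : ∀ y ∈ L.U, 0 < -L.Δ y := fun y hy => by
    have := eps_Δ hy
    rw [hε] at this
    linarith
  obtain ⟨v, hv⟩ := exists_met_self_ne_zero hx
  have c : ∀ u : Plane, ContDiffOn ℝ ∞ (fun _ : Plane => u) L.U := fun u => contDiffOn_const
  -- `w` is orthogonal to `v` and `⟨w, w⟩ = Δ ⟨v, v⟩`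
  set w : Plane → Plane := fun y =>
    (-L.met y v (basisVec 1)) • basisVec 0 + L.met y v (basisVec 0) • basisVec 1 with hw
  have sw : ContDiffOn ℝ ∞ w L.U :=
    ((smooth_met (c v) (c (basisVec 1))).neg.smul (c _)).add
      ((smooth_met (c v) (c (basisVec 0))).smul (c _))
  set r : Plane → ℝ := fun y => (Real.sqrt (-L.Δ y))⁻¹ with hr
  have sr : ContDiffOn ℝ ∞ r L.U :=
    (smooth_Δ.neg.sqrt fun y hy => (hΔ y hy).ne').inv fun y hy => (Real.sqrt_pos.2 (hΔ y hy)).ne'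
  have hrr : ∀ y ∈ L.U, r y * r y * L.Δ y = -1 := fun y hy => by
    have := hΔ y hy
    rw [hr]
    simp only
    rw [← mul_inv, Real.mul_self_sqrt this.le]
    field_simp
    rw [div_self (by intro h; rw [h] at this; simp at this)]
  have hvw : ∀ y, L.met y v (w y) = 0 := fun y => by
    rw [hw]
    simp only
    rw [met_add_right, met_smul_right, met_smul_right]
    ring
  have hww : ∀ y, L.met y v v ≠ 0 → L.met y (w y) (w y) = L.Δ y * L.met y v v := fun y hy => by
    have h := met_gram (L := L) (x := y) v (w y)
    have ha : area v (w y) = L.met y v v := by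
      have hv : v = v 0 • basisVec 0 + v 1 • basisVec 1 := plane_eq v
      have h2 : L.met y v v = v 0 * L.met y v (basisVec 0) + v 1 * L.met y v (basisVec 1) := by
        conv_lhs => rw [show L.met y v v = L.met y v (v 0 • basisVec 0 + v 1 • basisVec 1) by
          rw [← hv]]
        rw [met_add_right, met_smul_right, met_smul_right]
      rw [h2, hw]
      simp [area, basisVec]
    rw [hvw, ha] at h
    apply mul_left_cancel₀ hy
    linear_combination h
  have hQ := smooth_met (c v) (c v)
  refine ⟨_, isOpen_ne_zero hQ, fun y hy => hy.1, fun y => v + r y • w y,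
    fun y => (-(2 * L.met y v v)⁻¹) • (v - r y • w y), ⟨hx, hv⟩, ?_⟩
  have sub : {y ∈ L.U | L.met y v v ≠ 0} ⊆ L.U := fun y hy => hy.1
  exact
    { smooth_ξ := ((c v).add (sr.smul sw)).mono sub
      smooth_η := by
        have s₁ : ContDiffOn ℝ ∞ (fun y => -(2 * L.met y v v)⁻¹) {y ∈ L.U | L.met y v v ≠ 0} :=
          (((contDiffOn_const.mul hQ).mono sub).inv fun y hy => mul_ne_zero two_ne_zero hy.2).neg
        exact s₁.smul (((c v).sub (sr.smul sw)).mono sub)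
      ξ_ξ := fun y hy => by
        change L.met y _ _ = 0
        rw [met_add_left, met_add_right, met_add_right, met_smul_left, met_smul_left,
          met_smul_right, met_smul_right, met_comm (w y) v, hvw, hww y hy.2]
        linear_combination L.met y v v * hrr y hy.1
      η_η := fun y hy => by
        change L.met y _ _ = 0
        rw [met_smul_left, met_smul_right, met_sub_left, met_sub_right, met_sub_right,
          met_smul_left, met_smul_left, met_smul_right, met_smul_right, met_comm (w y) v, hvw, hww y hy.2]
        linear_combination (2 * L.met y v v)⁻¹ * (2 * L.met y v v)⁻¹ * L.met y v v * hrr y hy.1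
      ξ_η := fun y hy => by
        change L.met y _ _ = -1
        have h2 : (2 * L.met y v v)⁻¹ * (2 * L.met y v v) = 1 :=
          inv_mul_cancel₀ (mul_ne_zero two_ne_zero hy.2)
        rw [met_smul_right, met_add_left, met_sub_right, met_sub_right,
          met_smul_left, met_smul_left, met_smul_right, met_smul_right, met_comm (w y) v, hvw, hww y hy.2]
        linear_combination (2 * L.met y v v)⁻¹ * L.met y v v * hrr y hy.1 - h2 }

end LocalSurface

/-! ### The Gauss equation -/

namespace LocalSurface

variable {L : LocalSurface} {x : Plane}

theorem diff_pd2 (i j : Fin 2) (hx : x ∈ L.U) : DifferentiableAt ℝ (pd i (pd j L.φ)) x :=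
  diffAt_of_smooth L.isOpen (smooth_pd L.isOpen (smooth_X j) i) hx

theorem pd_g' (hx : x ∈ L.U) (k i j : Fin 2) : pd k (L.g i j) x =
    ip (pd k (pd i L.φ) x) (pd j L.φ x) + ip (pd i L.φ x) (pd k (pd j L.φ) x) :=
  der_ip (diff_X i hx) (diff_X j hx)

theorem pd_pd_g (hx : x ∈ L.U) (l k i j : Fin 2) : pd l (pd k (L.g i j)) x =
    ip (pd l (pd k (pd i L.φ)) x) (pd j L.φ x) + ip (pd k (pd i L.φ) x) (pd l (pd j L.φ) x)
      + (ip (pd l (pd i L.φ) x) (pd k (pd j L.φ) x)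
        + ip (pd i L.φ x) (pd l (pd k (pd j L.φ)) x)) := by
  have h : pd l (pd k (L.g i j)) x = pd l (fun y => ip (pd k (pd i L.φ) y) (pd j L.φ y)
      + ip (pd i L.φ y) (pd k (pd j L.φ) y)) x := der_congr L.isOpen hx fun y hy => pd_g' hy k i j
  have d1 := diffAt_of_smooth L.isOpen
    (smooth_ip (smooth_pd L.isOpen (smooth_X i) k) (smooth_X j)) hx
  have d2 := diffAt_of_smooth L.isOpen
    (smooth_ip (smooth_X i) (smooth_pd L.isOpen (smooth_X j) k)) hx
  rw [h, pd, der_add d1 d2, der_ip (diff_pd2 k i hx) (diff_X j hx),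
    der_ip (diff_X i hx) (diff_pd2 k j hx)]
  rfl

theorem ip_pd2_pd2 (hx : x ∈ L.U) (i j k l : Fin 2) :
    ip (pd i (pd j L.φ) x) (pd k (pd l L.φ) x) =
      L.Γ 0 i j x * (L.Γ 0 k l x * L.g 0 0 x + L.Γ 1 k l x * L.g 0 1 x)
      + L.Γ 1 i j x * (L.Γ 0 k l x * L.g 0 1 x + L.Γ 1 k l x * L.g 1 1 x)
      + L.ε * L.h i j x * L.h k l x - L.g i j x * L.g k l x := by
  rw [pd2_φ hx i j]
  simp only [ip_add_left, ip_smul_left, ip_n_pd2 hx, ip_φ_pd2 hx]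
  rw [pd2_φ hx k l]
  simp only [ip_add_right, ip_smul_right, ip_comm _ (L.n x), ip_comm _ (L.φ x), ip_n_pd hx,
    ip_φ_pd hx]
  simp only [g, ip_comm (pd 1 L.φ x) (pd 0 L.φ x)]
  ring

theorem brioschi_eq (hx : x ∈ L.U) :
    brioschi (L.g 0 0) (L.g 0 1) (L.g 1 1) x = L.ε * L.d x - 1 := by
  have hΔ := Δ_ne hx
  rw [Δ_eq] at hΔ
  have key : -(pd 1 (pd 1 (L.g 0 0)) x) / 2 + pd 0 (pd 1 (L.g 0 1)) x
      - pd 0 (pd 0 (L.g 1 1)) x / 2 =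
      ip (pd 0 (pd 0 L.φ) x) (pd 1 (pd 1 L.φ) x) - ip (pd 0 (pd 1 L.φ) x) (pd 0 (pd 1 L.φ) x) := by
    have c1 : pd 1 (pd 0 L.φ) x = pd 0 (pd 1 L.φ) x := pd_comm L.isOpen hx L.smooth_φ _ _
    have c2 : pd 1 (pd 1 (pd 0 L.φ)) x = pd 0 (pd 1 (pd 1 L.φ)) x := by
      rw [pd_comm L.isOpen hx (smooth_X 1) 0 1]
      exact der_congr L.isOpen hx fun y hy => pd_comm L.isOpen hy L.smooth_φ _ _
    have c3 : pd 0 (pd 1 (pd 0 L.φ)) x = pd 0 (pd 0 (pd 1 L.φ)) x :=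
      der_congr L.isOpen hx fun y hy => pd_comm L.isOpen hy L.smooth_φ _ _
    rw [pd_pd_g hx, pd_pd_g hx, pd_pd_g hx, c1, c2, c3]
    rw [ip_comm (pd 0 L.φ x), ip_comm (pd 1 L.φ x)]
    ring
  change (Matrix.det
      !![-(pd 1 (pd 1 (L.g 0 0)) x) / 2 + pd 0 (pd 1 (L.g 0 1)) x - pd 0 (pd 0 (L.g 1 1)) x / 2,
          pd 0 (L.g 0 0) x / 2, pd 0 (L.g 0 1) x - pd 1 (L.g 0 0) x / 2;
        pd 1 (L.g 0 1) x - pd 0 (L.g 1 1) x / 2, L.g 0 0 x, L.g 0 1 x;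
        pd 1 (L.g 1 1) x / 2, L.g 0 1 x, L.g 1 1 x]
    - Matrix.det
      !![0, pd 1 (L.g 0 0) x / 2, pd 0 (L.g 1 1) x / 2;
        pd 1 (L.g 0 0) x / 2, L.g 0 0 x, L.g 0 1 x;
        pd 0 (L.g 1 1) x / 2, L.g 0 1 x, L.g 1 1 x])
    / (L.g 0 0 x * L.g 1 1 x - L.g 0 1 x ^ 2) ^ 2 = _
  rw [key, div_eq_iff (pow_ne_zero 2 hΔ), Matrix.det_fin_three, Matrix.det_fin_three]
  simp only [Matrix.of_apply, Matrix.cons_val', Matrix.cons_val_zero, Matrix.cons_val_one,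
    Matrix.cons_val]
  rw [ip_pd2_pd2 hx, ip_pd2_pd2 hx, pd_g hx, pd_g hx, pd_g hx, pd_g hx, pd_g hx, pd_g hx,
    Γ_symm hx 0 1 0, Γ_symm hx 1 1 0, g_symm 1 0]
  have hd := d_mul_Δ hx
  rw [Δ_eq] at hd
  linear_combination -L.ε * (L.g 0 0 x * L.g 1 1 x - L.g 0 1 x ^ 2) * hd

end LocalSurface

namespace OrientedSurface

variable {M : Type*} [TopologicalSpace M] [ChartedSpace (EuclideanSpace ℝ (Fin 2)) M]
  [IsManifold (𝓡 2) ∞ M] (W : OrientedSurface M)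

/-- The Gauss equation. -/
theorem gaussCurv_eq (p : M) : W.gaussCurv p = W.ε * W.dt p - 1 := by
  have h := LocalSurface.brioschi_eq (L := W.loc p) (mem_extChartAt_target (I := 𝓡 2) p)
  have e : (W.loc p).d (extChartAt (𝓡 2) p p) = W.dt p :=
    (W.det_shape (mem_extChartAt_source (I := 𝓡 2) p)).symm
  rw [e] at h
  exact h

end OrientedSurface

/-! ### Constancy of the principal curvatures -/

namespace LocalSurface

variable {L : LocalSurface} {x : Plane}

/-- The differential of a function that is a cubic polynomial in another one. -/
theorem fderiv_of_cubic {F f : Plane → ℝ} {a b c e : ℝ} (hx : x ∈ L.U)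
    (hf : DifferentiableAt ℝ f x)
    (h : ∀ y ∈ L.U, F y = a * f y ^ 3 + b * f y ^ 2 + c * f y + e) (v : Plane) :
    fderiv ℝ F x v = (3 * a * f x ^ 2 + 2 * b * f x + c) * fderiv ℝ f x v := by
  have e1 : fderiv ℝ F x v = fderiv ℝ (fun y => a * f y ^ 3 + b * f y ^ 2 + c * f y + e) x v :=
    der_congr (ξ := fun _ => v) L.isOpen hx h
  have hd := hf.hasFDerivAt
  have h1 := (((hd.pow 3).const_mul a).add ((hd.pow 2).const_mul b)).add (hd.const_mul c)
  have h2 := (h1.add_const e).fderiv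
  have h3 := congrArg (fun A : Plane →L[ℝ] ℝ => A v) h2
  rw [e1]
  refine h3.trans ?_
  simp
  ring

theorem fderiv_mul_ip {f : Plane → R42} (m : ℝ) (a : R42) (hf : DifferentiableAt ℝ f x)
    (v : Plane) : fderiv ℝ (fun y => m * ip a (f y)) x v = m * ip a (fderiv ℝ f x v) :=
  der_clm (ξ := fun _ => v) (m • LinearMap.toContinuousLinearMap (ip a)) hf

theorem diff_t (hx : x ∈ L.U) : DifferentiableAt ℝ L.t x := diffU hx smooth_t

theorem diff_d (hx : x ∈ L.U) : DifferentiableAt ℝ L.d x := diffU hx smooth_d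

theorem fderiv_eq_zero {f : Plane → ℝ} {c : ℝ} (hx : x ∈ L.U) (h : ∀ y ∈ L.U, f y = c)
    (v : Plane) : fderiv ℝ f x v = 0 := der_eq_zero (ξ := fun _ => v) L.isOpen hx h

theorem lop_eq_zero {f : Plane → ℝ} {c : ℝ} (hx : x ∈ L.U) (h : ∀ y ∈ L.U, f y = c) :
    L.lop f x = 0 := by rw [lop_congr (F := fun _ => c) hx h, lop_const]

theorem gradVec_eq_zero {f : Plane → ℝ} {c : ℝ} (hx : x ∈ L.U) (h : ∀ y ∈ L.U, f y = c) :
    L.gradVec f x = 0 := by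
  have e : ∀ i, pd i f x = 0 := fun i => der_eq_zero L.isOpen hx h
  rw [gradVec, e, e, zero_smul, zero_smul, add_zero]

namespace TwoType

variable {a : R42} {f₁ f₂ : Plane → R42} {l₁ l₂ : ℝ} (T : TwoType L a f₁ f₂ l₁ l₂)
include T

theorem mono {V : Set Plane} (hV : IsOpen V) (hVU : V ⊆ L.U) :
    TwoType (L.restrict hV hVU) a f₁ f₂ l₁ l₂ where
  smooth₁ := T.smooth₁.mono hVU
  smooth₂ := T.smooth₂.mono hVU
  sum x hx := T.sum x (hVU hx)
  lop₁ x hx := T.lop₁ x (hVU hx)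
  lop₂ x hx := T.lop₂ x (hVU hx)

/-- If the mean curvature is constant, comparing the derivative of the `ψ`-component of the
fourth order equation with its tangential part shows that `det S` is constant. -/
theorem d_mul_fderiv_d {c : ℝ} (ht : ∀ y ∈ L.U, L.t y = c) (hx : x ∈ L.U) (v : Plane) :
    L.d x * fderiv ℝ L.d x v = 0 := by
  have h1 := T.tangent_eq hx v
  rw [fderiv_eq_zero hx ht, fderiv_eq_zero hx ht] at h1
  have h2 := fderiv_of_cubic (a := 0) (b := 4 * L.ε) (c := 0)
    (e := -c ^ 2 - (l₁ + l₂) * c - l₁ * l₂) hx (diff_d hx)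
    (F := fun y => l₁ * l₂ * ip a (L.φ y)) (fun y hy => by
      rw [T.position_eq hy, lop_eq_zero hy ht, ht y hy]; ring) v
  rw [fderiv_mul_ip _ _ (diff_φ hx), h1] at h2
  have h3 : (14 * L.ε * L.ε) * (L.d x * fderiv ℝ L.d x v) = 0 := by
    linear_combination -L.ε * h2
  linear_combination h3 / 14 - L.d x * fderiv ℝ L.d x v * L.eps_sq

/-- If `det S` is a constant `c`, then `tr S` is constant unless `c = 0` or `c = 2 ε`. -/
theorem mul_fderiv_t {c : ℝ} (hd : ∀ y ∈ L.U, L.d y = c) (hx : x ∈ L.U) (v : Plane) :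
    c * (c - 2 * L.ε) * fderiv ℝ L.t x v = 0 := by
  have h1 := T.tangent_eq hx (L.S x v)
  have h2 := fderiv_of_cubic (a := 0) (b := 0) (c := -2 * L.ε * c ^ 2 + 2 * c)
    (e := 2 * (l₁ + l₂) * c) hx (diff_t hx)
    (F := fun y => l₁ * l₂ * ip a (L.n y)) (fun y hy => by
      rw [T.normal_eq hy, lop_eq_zero hy hd, hd y hy]; ring) v
  rw [fderiv_mul_ip _ _ (diff_n hx)] at h2
  rw [fderiv_φ_S hx, ip_neg_right, fderiv_eq_zero hx hd, S_S, map_sub, map_smul, map_smul,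
    smul_eq_mul, smul_eq_mul, hd x hx] at h1
  linear_combination L.ε / 2 * h2 + L.ε / 2 * h1 -
    (c ^ 2 * fderiv ℝ L.t x v) * L.eps_sq

/-- The exceptional case `det S = 2 ε`. -/
theorem mul_fderiv_t_of_d_eq (hd : ∀ y ∈ L.U, L.d y = 2 * L.ε) (hx : x ∈ L.U) (v : Plane) :
    (9 * (l₁ + l₂) ^ 2 + 32 * L.ε - 4 * L.t x ^ 2) * fderiv ℝ L.t x v = 0 := by
  have he := L.eps_sq
  have hn : ∀ y ∈ L.U, l₁ * l₂ * ip a (L.n y) = -4 * L.ε * L.t y + 4 * L.ε * (l₁ + l₂) :=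
    fun y hy => by
      rw [T.normal_eq hy, lop_eq_zero hy hd, hd y hy]
      linear_combination (-8 * L.ε * L.t y) * he
  -- applying `L₁` to the previous identity expresses `L₁ t` through `⟨a, ψ⟩`
  have hp : ∀ y ∈ L.U, l₁ * l₂ * ip a (L.φ y) = 0 * L.t y ^ 3 + 1 / 2 * L.t y ^ 2
      + (-3 / 2 * (l₁ + l₂)) * L.t y + (8 * L.ε - l₁ * l₂ / 2) := fun y hy => by
    have e1 : L.lop (fun y => (l₁ * l₂) • ip a (L.n y)) y
        = L.lop (fun y => (-4 * L.ε) • L.t y + 4 * L.ε * (l₁ + l₂)) y :=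
      lop_congr hy fun z hz => hn z hz
    have st : ContDiffOn ℝ ∞ (fun y => (-4 * L.ε) • L.t y) L.U := contDiffOn_const.mul smooth_t
    have sn : ContDiffOn ℝ ∞ (fun y => ip a (L.n y)) L.U := smooth_ip contDiffOn_const L.smooth_n
    rw [lop_const_smul (F := fun y => ip a (L.n y)) _ hy sn, lop_ip_n hy,
      lop_add (f := fun y => (-4 * L.ε) • L.t y) (F := fun _ => 4 * L.ε * (l₁ + l₂)) hy st
        contDiffOn_const, lop_const,
      lop_const_smul (F := L.t) _ hy smooth_t, gradVec_eq_zero hy hd, ip_zero_right, hd y hy] at e1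
    simp only [smul_eq_mul] at e1
    have e2 := T.position_eq hy
    rw [hd y hy] at e2
    have e3 := hn y hy
    linear_combination (L.ε / 8) * e1 + 1 / 2 * e2 - L.t y / 4 * L.ε * L.ε * L.ε * e3
      + (-(l₁ * l₂ * ip a (L.φ y)) / 2 - L.lop L.t y / 2 + 8 * L.ε
        + (L.ε * L.ε + 1) * (L.t y ^ 2 - (l₁ + l₂) * L.t y)) * he
  have h2 := fderiv_of_cubic hx (diff_t hx) hp
  have key : ∀ v, 4 * fderiv ℝ L.t x (L.S x v) =
      (2 * L.t x + 3 * (l₁ + l₂)) * fderiv ℝ L.t x v := fun v => by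
    have h3 := T.tangent_eq hx v
    have h4 := h2 v
    rw [fderiv_mul_ip _ _ (diff_φ hx)] at h4
    rw [fderiv_eq_zero hx hd] at h3
    linear_combination 2 * h3 - 2 * h4
  -- with the Cayley-Hamilton identity, `key` leaves a polynomial relation without `S`
  have h5 := key (L.S x v)
  rw [S_S, map_sub, map_smul, map_smul, smul_eq_mul, smul_eq_mul, hd x hx] at h5
  linear_combination (-4) * h5 + (4 * L.t x - (2 * L.t x + 3 * (l₁ + l₂))) * key v

/-- If one principal curvature is a constant `k`, the other one satisfies a polynomial equation
wherever its derivative does not vanish. -/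
theorem mul_fderiv_sub {k : ℝ} (hk : ∀ y ∈ L.U, k ^ 2 - L.t y * k + L.d y = 0) (hx : x ∈ L.U)
    (v : Plane) :
    (6 * L.ε * k ^ 2 * (L.t x - k) ^ 2 - 18 * L.ε * k ^ 3 * (L.t x - k) + 2 * k * (L.t x - k)
        + 2 * k ^ 2) *
      (12 * L.ε * k ^ 2 * (L.t x - k) ^ 2 - 24 * L.ε * k ^ 3 * (L.t x - k) - 2 * k * (L.t x - k)
        + 6 * k ^ 2) * (L.t x - k - k) * fderiv ℝ L.t x v = 0 := by
  set μ : Plane → ℝ := fun y => L.t y - k with hμ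
  have hd : ∀ y ∈ L.U, L.d y = 0 * μ y ^ 3 + 0 * μ y ^ 2 + k * μ y + 0 := fun y hy => by
    have := hk y hy
    simp only [hμ]; linear_combination this
  have dμ : DifferentiableAt ℝ μ x := (diff_t hx).sub_const k
  have eμ : ∀ v, fderiv ℝ μ x v = fderiv ℝ L.t x v := fun v => by
    rw [hμ, fderiv_sub_const]
  have hdd := fun v => fderiv_of_cubic hx dμ hd v
  have e1 := fun v => T.tangent_eq hx v
  -- eliminating `L₁ t` between the components along `N` and along `ψ`
  have e2 := fderiv_of_cubic (a := -2 * L.ε * k ^ 2) (b := 6 * L.ε * k ^ 3) (c := -2 * k ^ 2)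
    (e := -2 * k ^ 3 - 2 * k * (l₁ * l₂) - 2 * (l₁ + l₂) * k ^ 2) hx dμ
    (F := fun y => l₁ * l₂ * ip a (L.n y + (2 * k) • L.φ y)) (fun y hy => by
      have h1 := T.normal_eq hy
      have h2 := T.position_eq hy
      have h3 : L.lop L.d y = k * L.lop L.t y := by
        have st : ContDiffOn ℝ ∞ (fun y => k • L.t y) L.U := contDiffOn_const.mul smooth_t
        rw [lop_congr (F := fun y => k • L.t y + (-k ^ 2)) hy fun z hz => by
          have := hk z hz
          simp only [smul_eq_mul]; linear_combination this,
          lop_add (f := fun y => k • L.t y) (F := fun _ => -k ^ 2) hy st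
            contDiffOn_const, lop_const,
          lop_const_smul (F := L.t) _ hy smooth_t, smul_eq_mul, add_zero]
      have h4 : L.t y = μ y + k := by simp [hμ]
      rw [ip_add_right, ip_smul_right, mul_add, h1, mul_left_comm, h2, h3, hd y hy, h4]
      ring)
  have e3 : ∀ v, l₁ * l₂ * (-ip a (fderiv ℝ L.φ x (L.S x v)) + 2 * k * ip a (fderiv ℝ L.φ x v))
      = (3 * (-2 * L.ε * k ^ 2) * μ x ^ 2 + 2 * (6 * L.ε * k ^ 3) * μ x + -2 * k ^ 2)
        * fderiv ℝ μ x v := fun v => by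
    have h := e2 v
    rw [fderiv_mul_ip _ _ ((diff_n hx).fun_add ((diff_φ hx).fun_const_smul _)),
      fderiv_fun_add (diff_n hx) ((diff_φ hx).fun_const_smul _),
      fderiv_fun_const_smul (diff_φ hx)] at h
    rw [fderiv_φ_S hx, ip_neg_right, neg_neg]
    refine Eq.trans ?_ h
    simp only [add_apply, smul_apply, ip_add_right,
      ip_smul_right]
  simp only [hdd, eμ] at e1 e3
  have hS : ∀ v, L.S x (L.S x v) = (μ x + k) • L.S x v - (k * μ x) • v := fun v => by
    rw [S_S, hd x hx]
    congr 2 <;> simp [hμ]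
  have ht : L.t x = μ x + k := by simp [hμ]
  have hdx : L.d x = k * μ x := by rw [hd x hx]; ring
  have h1 : L.S x (L.S x v - k • v) = μ x • (L.S x v - k • v) := by
    rw [S_sub, S_smul, hS]; module
  have h2 : L.S x (L.S x v - μ x • v) = k • (L.S x v - μ x • v) := by
    rw [S_sub, S_smul, hS]; module
  have a1 := e1 (L.S x v - k • v)
  have b1 := e3 (L.S x v - k • v)
  have a2 := e1 (L.S x v - μ x • v)
  have b2 := e3 (L.S x v - μ x • v)
  rw [h1, map_smul, smul_eq_mul, ht, hdx] at a1
  rw [h1, map_smul, ip_smul_right] at b1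
  rw [h2, map_smul, smul_eq_mul, ht, hdx] at a2
  rw [h2, map_smul, ip_smul_right] at b2
  change _ * (μ x - k) * _ = 0
  -- the derivatives of `t` along the eigenvectors for `μ` and for `k`
  set p := fderiv ℝ L.t x (L.S x v - k • v) with hp
  set q := fderiv ℝ L.t x (L.S x v - μ x • v) with hq
  have hpq : p - q = (μ x - k) * fderiv ℝ L.t x v := by
    rw [hp, hq, ← map_sub, ← smul_eq_mul, ← map_smul]
    congr 1
    module
  have r1 : (12 * L.ε * k ^ 2 * μ x ^ 2 - 24 * L.ε * k ^ 3 * μ x - 2 * k * μ x + 6 * k ^ 2) * p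
      = 0 := by
    linear_combination b1 - (2 * k - μ x) * a1
  have r2 : (6 * L.ε * k ^ 2 * μ x ^ 2 - 18 * L.ε * k ^ 3 * μ x + 2 * k * μ x + 2 * k ^ 2) * q
      = 0 := by
    linear_combination b2 - k * a2
  rw [mul_assoc, ← hpq]
  change (6 * L.ε * k ^ 2 * μ x ^ 2 - 18 * L.ε * k ^ 3 * μ x + 2 * k * μ x + 2 * k ^ 2) *
    (12 * L.ε * k ^ 2 * μ x ^ 2 - 24 * L.ε * k ^ 3 * μ x - 2 * k * μ x + 6 * k ^ 2) * (p - q) = 0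
  linear_combination (6 * L.ε * k ^ 2 * μ x ^ 2 - 18 * L.ε * k ^ 3 * μ x + 2 * k * μ x
      + 2 * k ^ 2) * r1 - (12 * L.ε * k ^ 2 * μ x ^ 2 - 24 * L.ε * k ^ 3 * μ x - 2 * k * μ x
      + 6 * k ^ 2) * r2

/-- A surface of `L₁`-2-type with singular shape operator is minimal. -/
theorem t_eq_zero (hd : ∀ y ∈ L.U, L.d y = 0) (hx : x ∈ L.U) : L.t x = 0 := by
  by_contra h
  have hV := isOpen_ne_zero (L := L) smooth_t
  have hVU : {x ∈ L.U | L.t x ≠ 0} ⊆ L.U := fun y hy => hy.1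
  have hx' : x ∈ (L.restrict hV hVU).U := ⟨hx, h⟩
  obtain ⟨V', hV', hVU', ξ, η, σ, τ, hxV, E⟩ := exists_eigenFrame (L := L.restrict hV hVU)
    (k := fun _ => 0) (l := L.t) hx' contDiffOn_const (smooth_t.mono hVU)
    (fun y _ => (zero_add _).symm) (fun y hy => (hd y hy.1).trans (zero_mul _).symm) (Ne.symm h)
  exact E.false_of_twoType ((T.mono hV hVU).mono hV' hVU') (fun _ _ => rfl)
    (fun y hy => (hVU' hy).2) hxV

end TwoType
end LocalSurface

namespace OrientedSurface

variable {M : Type*} [TopologicalSpace M] [ChartedSpace (EuclideanSpace ℝ (Fin 2)) M]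
  [IsManifold (𝓡 2) ∞ M] (W : OrientedSurface M)

theorem t_eq {c : ℝ} (h : ∀ q, W.tr q = c) (p : M) : ∀ x ∈ (W.loc p).U, (W.loc p).t x = c :=
  fun _ hx => (W.tr_symm hx).symm.trans (h _)

theorem d_eq {c : ℝ} (h : ∀ q, W.dt q = c) (p : M) : ∀ x ∈ (W.loc p).U, (W.loc p).d x = c :=
  fun _ hx => (W.dt_symm hx).symm.trans (h _)

/-- A function whose chart expressions satisfy `R(g) dg = 0` with a fixed non-zero polynomial `R` is
constant. -/
theorem const_of_loc [ConnectedSpace M] {f : M → ℝ} {g : M → Plane → ℝ}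
    (hg : ∀ p, ContDiffOn ℝ ∞ (g p) (W.loc p).U)
    (hfg : ∀ p, ∀ x ∈ (W.loc p).U, inChart p f x = g p x) {R : Polynomial ℝ} (hR : R ≠ 0)
    (h : ∀ p, ∀ x ∈ (W.loc p).U, ∀ v, R.eval (g p x) * fderiv ℝ (g p) x v = 0) :
    ∃ c, ∀ q, f q = c := by
  refine const_of_poly_smul (fun p => ?_) hR fun p x hx v => ?_
  · exact ((hg p).congr (hfg p)).differentiableOn (by simp)
  · have e : inChart p f =ᶠ[nhds x] g p :=
      Filter.eventuallyEq_of_mem ((W.loc p).isOpen.mem_nhds hx) (hfg p)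
    rw [hfg p x hx, e.fderiv_eq]
    exact h p x hx v

theorem tr_const [ConnectedSpace M] {R : Polynomial ℝ} (hR : R ≠ 0)
    (h : ∀ p, ∀ x ∈ (W.loc p).U, ∀ v, R.eval ((W.loc p).t x) * fderiv ℝ (W.loc p).t x v = 0) :
    ∃ c, ∀ q, W.tr q = c :=
  W.const_of_loc (g := fun p => (W.loc p).t) (fun _ => LocalSurface.smooth_t)
    (fun _ _ hx => W.tr_symm hx) hR h

theorem dt_const [ConnectedSpace M] {R : Polynomial ℝ} (hR : R ≠ 0)
    (h : ∀ p, ∀ x ∈ (W.loc p).U, ∀ v, R.eval ((W.loc p).d x) * fderiv ℝ (W.loc p).d x v = 0) :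
    ∃ c, ∀ q, W.dt q = c :=
  W.const_of_loc (g := fun p => (W.loc p).d) (fun _ => LocalSurface.smooth_d)
    (fun _ _ hx => W.dt_symm hx) hR h

theorem char_eq_of_hasEigenvalue {q : M} {k : ℝ}
    (h : Module.End.HasEigenvalue (W.shape q) k) : k ^ 2 - W.tr q * k + W.dt q = 0 := by
  obtain ⟨X, hX, hX0⟩ := h.exists_hasEigenvector
  rw [Module.End.mem_eigenspace_iff] at hX
  have hq := mem_extChartAt_source (I := 𝓡 2) q
  have e := W.tau_shape hq X
  rw [hX, map_smul] at e
  have h2 := LocalSurface.S_S (L := W.loc q) (x := extChartAt (𝓡 2) q q) (tau q q X)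
  rw [← e, LocalSurface.S_smul, ← e, ← W.trace_shape hq, ← W.det_shape hq] at h2
  have h3 : (k ^ 2 - W.tr q * k + W.dt q) • tau q q X = 0 := by
    rw [add_smul, sub_smul, sub_add, sub_eq_zero, tr, dt, mul_smul, ← h2, pow_two, mul_smul]
  refine (smul_eq_zero.1 h3).resolve_right fun h0 => hX0 ?_
  exact (tau_bijective hq).1 (h0.trans (map_zero _).symm)

section

variable [ConnectedSpace M] {a : R42} {ψ₁ ψ₂ : M → R42} {l₁ l₂ : ℝ}
  (T : ∀ p, (W.loc p).TwoType a (inChart p ψ₁) (inChart p ψ₂) l₁ l₂)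
include T

theorem dt_const_of_tr_const {c : ℝ} (ht : ∀ q, W.tr q = c) : ∃ c, ∀ q, W.dt q = c :=
  W.dt_const Polynomial.X_ne_zero fun p x hx v => by
    rw [Polynomial.eval_X]
    exact (T p).d_mul_fderiv_d (W.t_eq ht p) hx v

/-- The trace is constant if the determinant `c` is; `c = 0` and `c = 2 ε` are special cases. -/
theorem tr_const_of_dt_const {c : ℝ} (hd : ∀ q, W.dt q = c) : ∃ c, ∀ q, W.tr q = c := by
  by_cases h0 : c = 0
  · refine ⟨0, fun q => ?_⟩
    have := (T q).t_eq_zero (h0 ▸ W.d_eq hd q) (mem_extChartAt_target (I := 𝓡 2) q)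
    rwa [← W.trace_shape (mem_extChartAt_source (I := 𝓡 2) q)] at this
  by_cases h2 : c = 2 * W.ε
  · refine W.tr_const (R := Polynomial.C (9 * (l₁ + l₂) ^ 2 + 32 * W.ε)
      - Polynomial.C 4 * Polynomial.X ^ 2) (fun h => ?_) fun p x hx v => ?_
    · have e0 := congrArg (Polynomial.eval 0) h
      have e1 := congrArg (Polynomial.eval 1) h
      simp only [Polynomial.eval_sub, Polynomial.eval_mul, Polynomial.eval_pow, Polynomial.eval_X,
        Polynomial.eval_C, Polynomial.eval_zero] at e0 e1
      linarith
    · have := (T p).mul_fderiv_t_of_d_eq (h2 ▸ W.d_eq hd p) hx v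
      rw [Polynomial.eval_sub, Polynomial.eval_mul, Polynomial.eval_pow, Polynomial.eval_X,
        Polynomial.eval_C, Polynomial.eval_C]
      exact this
  · refine W.tr_const (R := Polynomial.C (c * (c - 2 * W.ε))) (fun h => ?_) fun p x hx v => ?_
    · rw [Polynomial.C_eq_zero] at h
      exact mul_ne_zero h0 (sub_ne_zero.2 h2) h
    · rw [Polynomial.eval_C]
      exact (T p).mul_fderiv_t (W.d_eq hd p) hx v

/-- The other principal curvature `t - k` is a root of the product of three non-zero polynomials
wherever its differential does not vanish. -/
theorem tr_const_of_eigenvalue {k : ℝ} (hk : ∀ q, k ^ 2 - W.tr q * k + W.dt q = 0) :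
    ∃ c, ∀ q, W.tr q = c := by
  by_cases h0 : k = 0
  · refine W.tr_const_of_dt_const T (c := 0) fun q => ?_
    have := hk q
    rw [h0] at this
    linarith
  set R₁ : Polynomial ℝ := Polynomial.C (6 * W.ε * k ^ 2) * Polynomial.X ^ 2
    + Polynomial.C (-18 * W.ε * k ^ 3 + 2 * k) * Polynomial.X + Polynomial.C (2 * k ^ 2) with hR₁
  set R₂ : Polynomial ℝ := Polynomial.C (12 * W.ε * k ^ 2) * Polynomial.X ^ 2
    + Polynomial.C (-24 * W.ε * k ^ 3 - 2 * k) * Polynomial.X + Polynomial.C (6 * k ^ 2) with hR₂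
  have n₁ : R₁ ≠ 0 := fun h => by
    have := congrArg (Polynomial.eval 0) h
    simp [hR₁, h0] at this
  have n₂ : R₂ ≠ 0 := fun h => by
    have := congrArg (Polynomial.eval 0) h
    simp [hR₂, h0] at this
  have hne : (R₁ * R₂ * (Polynomial.X - Polynomial.C k)).comp
      (Polynomial.X - Polynomial.C k) ≠ 0 := by
    intro h
    have h2 := congrArg (fun R => Polynomial.comp R (Polynomial.X + Polynomial.C k)) h
    simp only [Polynomial.comp_assoc] at h2
    simp only [Polynomial.sub_comp, Polynomial.X_comp, Polynomial.C_comp, add_sub_cancel_right,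
      Polynomial.comp_X, Polynomial.zero_comp] at h2
    exact mul_ne_zero (mul_ne_zero n₁ n₂) (Polynomial.X_sub_C_ne_zero k) h2
  refine W.tr_const hne fun p x hx v => ?_
  have h := (T p).mul_fderiv_sub (k := k) (fun y hy => by
    rw [← W.tr_symm hy, ← W.dt_symm hy]; exact hk _) hx v
  change (6 * W.ε * k ^ 2 * _ - 18 * W.ε * k ^ 3 * _ + _ + _) * (12 * W.ε * k ^ 2 * _
    - 24 * W.ε * k ^ 3 * _ - _ + _) * _ * _ = 0 at h
  simp only [hR₁, hR₂, Polynomial.eval_comp, Polynomial.eval_mul, Polynomial.eval_add,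
    Polynomial.eval_sub, Polynomial.eval_pow, Polynomial.eval_X, Polynomial.eval_C]
  linear_combination h

/-- If the mean curvature, the Gaussian curvature or a principal curvature of a surface of
`L₁`-2-type is constant, then its shape operator has constant trace and determinant. -/
theorem tr_dt_const (h : (∃ c, ∀ p, W.meanCurv p = c) ∨ (∃ c, ∀ p, W.gaussCurv p = c) ∨
      ∃ c, ∀ p, Module.End.HasEigenvalue (W.shape p) c) :
    ∃ c c', (∀ q, W.tr q = c) ∧ ∀ q, W.dt q = c' := by
  have hε : W.ε * W.ε = 1 := by rcases W.eps_eq with h | h <;> rw [h] <;> norm_num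
  have key : ∃ c, ∀ q, W.tr q = c := by
    rcases h with ⟨c, hc⟩ | ⟨c, hc⟩ | ⟨c, hc⟩
    · refine ⟨2 * W.ε * c, fun q => ?_⟩
      have : W.ε / 2 * W.tr q = c := hc q
      linear_combination 2 * W.ε * this - W.tr q * hε
    · refine W.tr_const_of_dt_const T (c := W.ε * (c + 1)) fun q => ?_
      have := hc q
      rw [gaussCurv_eq] at this
      linear_combination W.ε * this - W.dt q * hε
    · exact W.tr_const_of_eigenvalue T fun q => W.char_eq_of_hasEigenvalue (hc q)
  obtain ⟨c, hc⟩ := key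
  obtain ⟨c', hc'⟩ := W.dt_const_of_tr_const T hc
  exact ⟨c, c', hc, hc'⟩

end

end OrientedSurface

/-! ### Surfaces whose shape operator has constant trace and determinant -/

namespace LocalSurface

variable {L : LocalSurface} {x : Plane}

/-- The square of the traceless part of the shape operator is a multiple of the identity. -/
theorem met_traceless (hx : x ∈ L.U) (v : Plane) :
    L.met x (L.S x v - (L.t x / 2) • v) (L.S x v - (L.t x / 2) • v) =
      (L.t x ^ 2 / 4 - L.d x) * L.met x v v := by
  have h1 : L.met x (L.S x v) (L.S x v) = L.t x * L.met x (L.S x v) v - L.d x * L.met x v v := by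
    rw [← met_S hx, S_S, met_sub_left, met_smul_left, met_smul_left]
  rw [met_sub_left, met_sub_right, met_sub_right, met_smul_left, met_smul_left, met_smul_right,
    met_smul_right, h1, met_comm v (L.S x v)]
  ring

/-- The principal curvatures of a Riemannian surface are real. -/
theorem disc_nonneg (hε : L.ε = -1) (hx : x ∈ L.U) : 0 ≤ L.t x ^ 2 - 4 * L.d x := by
  have hΔ := eps_Δ hx
  rw [hε] at hΔ
  obtain ⟨v, hv⟩ := exists_met_self_ne_zero hx
  have h1 := met_gram (L := L) (x := x) (L.S x v - (L.t x / 2) • v) v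
  rw [met_traceless hx] at h1
  have h2 : 0 ≤ (L.t x ^ 2 / 4 - L.d x) * L.met x v v ^ 2 := by
    nlinarith [sq_nonneg (L.met x (L.S x v - (L.t x / 2) • v) v),
      mul_nonneg (sq_nonneg (area (L.S x v - (L.t x / 2) • v) v)) hΔ.le]
  have h3 : 0 < L.met x v v ^ 2 := by positivity
  have := nonneg_of_mul_nonneg_left h2 h3
  linarith

/-- On a Riemannian surface, points where the principal curvatures coincide are umbilical. -/
theorem umbilical_of_disc_eq_zero (hε : L.ε = -1) (hx : x ∈ L.U)
    (h : L.t x ^ 2 = 4 * L.d x) (v : Plane) : L.S x v = (L.t x / 2) • v := by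
  have hΔ := eps_Δ hx
  rw [hε] at hΔ
  rw [← sub_eq_zero]
  refine met_ext_all hx fun w => ?_
  have h1 := met_gram (L := L) (x := x) (L.S x v - (L.t x / 2) • v) w
  rw [met_traceless hx] at h1
  have h0 : L.met x 0 w = 0 := by simp [met]
  have hz : L.t x ^ 2 / 4 - L.d x = 0 := by linarith
  rw [hz] at h1
  rw [h0]
  have := mul_nonneg (sq_nonneg (area (L.S x v - (L.t x / 2) • v) w)) hΔ.le
  apply pow_eq_zero_iff (two_ne_zero) |>.1
  nlinarith [sq_nonneg (L.met x (L.S x v - (L.t x / 2) • v) w)]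

namespace TwoType

variable {a : R42} {f₁ f₂ : Plane → R42} {l₁ l₂ : ℝ} (T : TwoType L a f₁ f₂ l₁ l₂)
include T

theorem swap : TwoType L a f₂ f₁ l₂ l₁ where
  smooth₁ := T.smooth₂
  smooth₂ := T.smooth₁
  sum x hx := by rw [T.sum x hx]; abel
  lop₁ := T.lop₂
  lop₂ := T.lop₁

/-- If `L₁ ψ = c ψ + b`, then `(l₁ - c) ψ₁ + (l₂ - c) ψ₂` is constant; applying `L₁` to it
isolates `ψ₁`. -/
theorem smul_eq_of_affine {c : ℝ} {b : R42} (h : ∀ x ∈ L.U, L.lop L.φ x = c • L.φ x + b)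
    (hx : x ∈ L.U) : ((l₁ - c) * (l₁ - l₂)) • f₁ x = -l₂ • (c • a + b) := by
  have e : ∀ y ∈ L.U, (l₁ - c) • f₁ y + (l₂ - c) • f₂ y = c • a + b := fun y hy => by
    have h1 := h y hy
    rw [T.lop_φ_eq hy, T.sum y hy] at h1
    rw [sub_smul, sub_smul, sub_add_sub_comm, h1]
    module
  have h2 : L.lop (fun y => (l₁ - c) • f₁ y + (l₂ - c) • f₂ y) x = 0 := by
    rw [lop_congr (F := fun _ => c • a + b) hx e, lop_const]
  have s1 : ContDiffOn ℝ ∞ (fun y => (l₁ - c) • f₁ y) L.U := T.smooth₁.const_smul _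
  have s2 : ContDiffOn ℝ ∞ (fun y => (l₂ - c) • f₂ y) L.U := T.smooth₂.const_smul _
  rw [lop_add (f := fun y => (l₁ - c) • f₁ y) (F := fun y => (l₂ - c) • f₂ y) hx s1 s2,
    lop_const_smul (F := f₁) _ hx T.smooth₁, lop_const_smul (F := f₂) _ hx T.smooth₂,
    T.lop₁ x hx, T.lop₂ x hx] at h2
  rw [← e x hx, ← add_zero (-l₂ • _), ← h2]
  module

/-- If `S` has constant trace `t` and determinant `d`, then either `S` is a multiple of the
identity or the constant vector `a` vanishes or `l₁ l₂ = 0`. -/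
theorem umbilical_or {t d : ℝ} (ht : ∀ y ∈ L.U, L.t y = t) (hd : ∀ y ∈ L.U, L.d y = d)
    (hx : x ∈ L.U) : l₁ * l₂ = 0 ∨ a = 0 ∨ ∃ k : ℝ, ∀ v, L.S x v = k • v := by
  by_cases hm : l₁ * l₂ = 0
  · exact Or.inl hm
  right
  have h1 : ∀ y ∈ L.U, ∀ v, ip a (fderiv ℝ L.φ y v) = 0 := fun y hy v => by
    have h := T.tangent_eq hy v
    rw [fderiv_eq_zero hy ht, fderiv_eq_zero hy ht, fderiv_eq_zero hy hd] at h
    have h' : l₁ * l₂ * ip a (fderiv ℝ L.φ y v) = 0 := by rw [h]; ring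
    exact (mul_eq_zero.1 h').resolve_left hm
  have hn : ∀ y ∈ L.U, ip a (L.n y) =
      (l₁ * l₂)⁻¹ * (-2 * L.ε * t * d ^ 2 + 2 * t * d + 2 * (l₁ + l₂) * d) := fun y hy => by
    rw [eq_inv_mul_iff_mul_eq₀ hm, T.normal_eq hy, lop_eq_zero hy hd, ht y hy, hd y hy]
    ring
  have hp : ∀ y ∈ L.U, ip a (L.φ y) =
      (l₁ * l₂)⁻¹ * (4 * L.ε * d ^ 2 - t ^ 2 - (l₁ + l₂) * t - l₁ * l₂) := fun y hy => by
    rw [eq_inv_mul_iff_mul_eq₀ hm, T.position_eq hy, lop_eq_zero hy ht, ht y hy, hd y hy]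
    ring
  set α := (l₁ * l₂)⁻¹ * (-2 * L.ε * t * d ^ 2 + 2 * t * d + 2 * (l₁ + l₂) * d)
  set β := (l₁ * l₂)⁻¹ * (4 * L.ε * d ^ 2 - t ^ 2 - (l₁ + l₂) * t - l₁ * l₂)
  have hdec : ∀ y ∈ L.U, (L.ε * α) • L.n y - β • L.φ y = a := fun y hy => by
    refine ext_frame hy ?_ ?_ ?_ ?_
    · rw [ip_sub_right, ip_smul_right, ip_smul_right, ip_comm _ (L.n y), ip_comm _ (L.φ y),
        ip_n_pd hy, ip_φ_pd hy, ip_comm _ a]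
      have : ip a (pd 0 L.φ y) = 0 := h1 y hy _
      rw [this]; ring
    · rw [ip_sub_right, ip_smul_right, ip_smul_right, ip_comm _ (L.n y), ip_comm _ (L.φ y),
        ip_n_pd hy, ip_φ_pd hy, ip_comm _ a]
      have : ip a (pd 1 L.φ y) = 0 := h1 y hy _
      rw [this]; ring
    · rw [ip_sub_right, ip_smul_right, ip_smul_right, L.n_n y hy, L.n_φ y hy, ip_comm _ a, hn y hy]
      linear_combination α * L.eps_sq
    · rw [ip_sub_right, ip_smul_right, ip_smul_right, L.φ_φ y hy, ip_comm (L.φ y) (L.n y),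
        L.n_φ y hy, ip_comm _ a, hp y hy]
      ring
  have hS : ∀ v, -((L.ε * α) • L.S x v + β • v) = 0 := fun v => by
    have h := der_eq_zero (ξ := fun _ => v) L.isOpen hx hdec
    rw [der_sub ((diff_n hx).fun_const_smul _) ((diff_φ hx).fun_const_smul _),
      der_const_smul (diff_n hx), der_const_smul (diff_φ hx)] at h
    apply fderiv_φ_injective hx
    rw [map_neg, map_add, map_smul, map_smul, fderiv_φ_S hx, map_zero, ← h]
    simp only [der]
    module
  by_cases hα : L.ε * α = 0
  · left
    have h2 := hS (basisVec 0)
    rw [hα, zero_smul, zero_add] at h2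
    have hβ : β = 0 := by simpa [basisVec] using congrArg (fun v : Plane => v 0) h2
    rw [← hdec x hx, hα, hβ, zero_smul, zero_smul, sub_zero]
  · right
    refine ⟨-((L.ε * α)⁻¹ * β), fun v => ?_⟩
    have h2 := neg_eq_zero.1 (hS v)
    rw [← sub_eq_zero, ← smul_right_injective Plane hα |>.eq_iff, smul_zero, ← h2, smul_sub,
      smul_smul, mul_neg, mul_inv_cancel_left₀ hα]
    module

end TwoType
end LocalSurface

namespace OrientedSurface

variable {M : Type*} [TopologicalSpace M] [ChartedSpace (EuclideanSpace ℝ (Fin 2)) M]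
  [IsManifold (𝓡 2) ∞ M] (W : OrientedSurface M)

section

variable [ConnectedSpace M] {a : R42} {ψ₁ ψ₂ : M → R42} {l₁ l₂ : ℝ}
  (T : ∀ p, (W.loc p).TwoType a (inChart p ψ₁) (inChart p ψ₂) l₁ l₂)
  (n₁ : ¬ ∃ v, ∀ p, ψ₁ p = v) (n₂ : ¬ ∃ v, ∀ p, ψ₂ p = v) (hl : l₁ ≠ l₂)
include T n₁ n₂ hl

omit [ConnectedSpace M] in
/-- The immersion of a surface of `L₁`-2-type is not an affine eigenfunction of `L₁`. -/
theorem false_of_affine {c : ℝ} {b : R42}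
    (h : ∀ p, ∀ x ∈ (W.loc p).U, (W.loc p).lop (W.loc p).φ x = c • (W.loc p).φ x + b) : False := by
  have c₁ : l₁ = c := by
    by_contra hc
    refine n₁ ⟨((l₁ - c) * (l₁ - l₂))⁻¹ • (-l₂ • (c • a + b)), fun p => ?_⟩
    have hne : (l₁ - c) * (l₁ - l₂) ≠ 0 := mul_ne_zero (sub_ne_zero.2 hc) (sub_ne_zero.2 hl)
    rw [eq_inv_smul_iff₀ hne, ← inChart_apply (mem_extChartAt_source (I := 𝓡 2) p) ψ₁]
    exact (T p).smul_eq_of_affine (h p) (mem_extChartAt_target (I := 𝓡 2) p)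
  have c₂ : l₂ = c := by
    by_contra hc
    refine n₂ ⟨((l₂ - c) * (l₂ - l₁))⁻¹ • (-l₁ • (c • a + b)), fun p => ?_⟩
    have hne : (l₂ - c) * (l₂ - l₁) ≠ 0 := mul_ne_zero (sub_ne_zero.2 hc) (sub_ne_zero.2 hl.symm)
    rw [eq_inv_smul_iff₀ hne, ← inChart_apply (mem_extChartAt_source (I := 𝓡 2) p) ψ₂]
    exact (T p).swap.smul_eq_of_affine (h p) (mem_extChartAt_target (I := 𝓡 2) p)
  exact hl (c₁.trans c₂.symm)

variable {t d : ℝ} (ht : ∀ q, W.tr q = t) (hd : ∀ q, W.dt q = d)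
include ht hd

omit [ConnectedSpace M] in
/-- If `det S = 0`, then `L₁ ψ = -t ψ`. -/
theorem dt_ne_zero : d ≠ 0 := by
  intro h0
  refine W.false_of_affine T n₁ n₂ hl (c := -t) (b := 0) fun p x hx => ?_
  rw [LocalSurface.lop_φ hx, W.t_eq ht p x hx, W.d_eq hd p x hx, h0]
  module

/-- A surface of `L₁`-2-type is not totally umbilical. -/
theorem exists_not_umbilical :
    ∃ p, ∃ x ∈ (W.loc p).U, ¬ ∃ k : ℝ, ∀ v, (W.loc p).S x v = k • v := by
  by_contra! h
  have hS : ∀ p, ∀ x ∈ (W.loc p).U, ∀ v, (W.loc p).S x v = (t / 2) • v := fun p x hx v => by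
    obtain ⟨k, hk⟩ := h p x hx
    have h1 := LocalSurface.t_mul_area (L := W.loc p) (x := x) (basisVec 0) (basisVec 1)
    rw [hk, hk, W.t_eq ht p x hx] at h1
    simp [LocalSurface.area, basisVec] at h1
    rw [hk, h1]
    congr 1
    ring
  have sF : ∀ p, ContDiffOn ℝ ∞ (fun y => (W.loc p).n y + (t / 2) • (W.loc p).φ y) (W.loc p).U :=
    fun p => (W.loc p).smooth_n.add ((W.loc p).smooth_φ.const_smul _)
  -- `N + (t / 2) ψ` is constant, so that `L₁ ψ` is an affine function of `ψ`
  obtain ⟨b, hb⟩ := const_of_fderiv_eq_zero (F := fun q => W.N q + (t / 2) • W.ψ q)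
    (fun p => (sF p).differentiableOn (by simp))
    (fun p x hx => by
      ext1 v
      have e : der (fun _ => v) (fun y => (W.loc p).n y + (t / 2) • (W.loc p).φ y) x = 0 := by
        rw [der_add (LocalSurface.diff_n hx) ((LocalSurface.diff_φ hx).fun_const_smul _),
          der_const_smul (LocalSurface.diff_φ hx)]
        have h1 := LocalSurface.fderiv_φ_S (L := W.loc p) hx v
        rw [hS p x hx, map_smul] at h1
        simp only [der]
        rw [h1, add_neg_cancel]
      exact e)
  refine W.false_of_affine T n₁ n₂ hl (c := W.ε * d * t - t) (b := (-2 * W.ε * d) • b)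
    fun p x hx => ?_
  have h1 : (W.loc p).n x + (t / 2) • (W.loc p).φ x = b := hb _
  rw [LocalSurface.lop_φ hx, W.t_eq ht p x hx, W.d_eq hd p x hx, ← h1]
  change (-2 * W.ε * d) • _ - _ = _
  module

/-- The relations between the two eigenvalues and the invariants of the shape operator. -/
theorem eigenvalue_relations : l₁ + l₂ = t * (W.ε * d - 1) ∧
    l₁ * l₂ = W.ε * d * (4 * d - t ^ 2) := by
  have hd0 := W.dt_ne_zero T n₁ n₂ hl ht hd
  obtain ⟨p, x, hx, hk⟩ := W.exists_not_umbilical T n₁ n₂ hl ht hd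
  have ht' := W.t_eq ht p
  have hd' := W.d_eq hd p
  have h0 : ∀ v, l₁ * l₂ * ip a v = 0 := fun v => by
    rcases (T p).umbilical_or ht' hd' hx with h | h | h
    · rw [h, zero_mul]
    · rw [h, ip_zero_left, mul_zero]
    · exact absurd h hk
  have e1 := (T p).normal_eq hx
  rw [h0, LocalSurface.lop_eq_zero hx hd', ht' x hx, hd' x hx] at e1
  have e2 := (T p).position_eq hx
  rw [h0, LocalSurface.lop_eq_zero hx ht', ht' x hx, hd' x hx] at e2
  change 0 = -2 * W.ε * t * d ^ 2 - _ + _ + _ at e1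
  change 0 = 4 * W.ε * d ^ 2 - _ + _ - _ - _ at e2
  have s : l₁ + l₂ = t * (W.ε * d - 1) := by
    apply mul_left_cancel₀ (mul_ne_zero two_ne_zero hd0)
    linear_combination -e1
  exact ⟨s, by rw [s] at e2; linear_combination e2⟩

/-- The characteristic polynomial of the shape operator has real roots, and if it has a double
root then the surface is Lorentzian, is not flat and has a point that is not umbilical. -/
theorem disc_cases : 0 < t ^ 2 - 4 * d ∨
    (t ^ 2 = 4 * d ∧ W.ε = 1 ∧ d ≠ 1 ∧ ∃ p, ¬ W.IsUmbilical p) := by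
  obtain ⟨hs, hm⟩ := W.eigenvalue_relations T n₁ n₂ hl ht hd
  obtain ⟨p, x, hx, hk⟩ := W.exists_not_umbilical T n₁ n₂ hl ht hd
  have hx1 := W.t_eq ht p x hx
  have hx2 := W.d_eq hd p x hx
  rcases lt_trichotomy (t ^ 2 - 4 * d) 0 with h | h | h
  · exfalso
    have hε : W.ε = 1 := by
      rcases W.eps_eq with h1 | h1
      · exact h1
      · have := LocalSurface.disc_nonneg (L := W.loc p) h1 hx
        rw [hx1, hx2] at this
        linarith
    -- the surface would be flat, hence `l₂ = -l₁` and `l₁ l₂ = 4 d - t² > 0`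
    obtain ⟨V, hV, hVU, ξ, η, hxV, E⟩ := LocalSurface.exists_nullFrame (L := W.loc p) hε hx
    have h1 : W.ε * d = 1 := E.eps_d_eq_one (fun y hy => W.t_eq ht p y (hVU hy))
      (fun y hy => W.d_eq hd p y (hVU hy)) (by linarith) hxV
    rw [h1] at hs hm
    rw [hε] at h1
    have h2 : l₂ = -l₁ := by linarith
    rw [h2] at hm
    nlinarith [sq_nonneg l₁]
  · right
    have h4 : t ^ 2 = 4 * d := by linarith
    have hε : W.ε = 1 := by
      rcases W.eps_eq with h1 | h1
      · exact h1
      · exact absurd ⟨_, LocalSurface.umbilical_of_disc_eq_zero (L := W.loc p) h1 hx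
          (by rw [hx1, hx2, h4])⟩ hk
    refine ⟨h4, hε, fun h1 => hl ?_, (extChartAt (𝓡 2) p).symm x, ?_⟩
    · rw [hε, h1] at hs
      rw [h4] at hm
      have h2 : l₂ = -l₁ := by linarith
      rw [h2] at hm
      have : l₁ = 0 := by nlinarith
      rw [h2, this, neg_zero]
    · rintro ⟨k, hS⟩
      refine hk ⟨k, fun v => ?_⟩
      have hq := (extChartAt (𝓡 2) p).map_target hx
      obtain ⟨X, rfl⟩ := (tau_bijective hq).2 v
      have := W.tau_shape hq X
      rw [(extChartAt (𝓡 2) p).right_inv hx, hS] at this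
      rw [← this]
      exact (tau p _).map_smul k X
  · exact Or.inl h

end

end OrientedSurface

/-! ### The parallel projection for two distinct constant principal curvatures -/

namespace LocalSurface

variable {L : LocalSurface} {x : Plane}

/-- For distinct principal curvatures `k`, `l` with `ε k l = 1`, the projection onto the plane
spanned by `n + k φ` and by the principal direction for `l`, along the orthogonal plane, which is
spanned by `n + l φ` and by the principal direction for `k`. -/
def proj (L : LocalSurface) (k l : ℝ) (v : R42) (x : Plane) : R42 :=
  (ip v (L.n x + k • L.φ x) * (k * (l - k))⁻¹) • (L.n x + k • L.φ x)
    + (l - k)⁻¹ • fderiv ℝ L.φ x (L.S x (L.coord x v) - k • L.coord x v)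

namespace EigenFrame

variable {ξ η : Plane → Plane} {k l σ τ : ℝ}
  (E : EigenFrame L ξ η (fun _ => k) (fun _ => l) σ τ)
include E

theorem expand (hx : x ∈ L.U) (v : Plane) :
    v = (σ * L.met x v (ξ x)) • ξ x + (τ * L.met x v (η x)) • η x := by
  refine met_ext hx (E.gram_ne hx) ?_ ?_
  · rw [met_add_right, met_smul_right, met_smul_right, E.ξ_ξ x hx, E.ξ_η x hx, met_comm (ξ x)]
    linear_combination -L.met x v (ξ x) * E.σ_sq
  · rw [met_add_right, met_smul_right, met_smul_right, E.η_η x hx, met_comm (η x) (ξ x),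
      E.ξ_η x hx, met_comm (η x)]
    linear_combination -L.met x v (η x) * E.τ_sq

theorem proj_eq (hkl : k ≠ l) (hx : x ∈ L.U) (v : R42) : L.proj k l v x =
    (ip v (L.n x + k • L.φ x) * (k * (l - k))⁻¹) • (L.n x + k • L.φ x)
      + (τ * ip v (der η L.φ x)) • der η L.φ x := by
  have h1 : L.met x (L.coord x v) (η x) = ip v (der η L.φ x) := ip_fderiv_coord hx _ _
  have h2 := E.expand hx (L.coord x v)
  have h3 : L.S x (L.coord x v) - k • L.coord x v =
      ((l - k) * (τ * ip v (der η L.φ x))) • η x := by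
    rw [h2, S_add, S_smul, S_smul, E.S_ξ x hx, E.S_η x hx, h1]
    module
  rw [proj, h3, map_smul, smul_smul, inv_mul_cancel_left₀ (sub_ne_zero.2 hkl.symm)]
  rfl

theorem smooth_proj (hkl : k ≠ l) (v : R42) : ContDiffOn ℝ ∞ (L.proj k l v) L.U := by
  have s1 : ContDiffOn ℝ ∞ (fun y => L.n y + k • L.φ y) L.U :=
    L.smooth_n.add (L.smooth_φ.const_smul k)
  have s2 := smooth_derφ E.smooth_η
  have s3 : ContDiffOn ℝ ∞ (fun y => ip v (L.n y + k • L.φ y) * (k * (l - k))⁻¹) L.U :=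
    (smooth_ip contDiffOn_const s1).mul contDiffOn_const
  have s4 : ContDiffOn ℝ ∞ (fun y => τ * ip v (der η L.φ y)) L.U :=
    contDiffOn_const.mul (smooth_ip contDiffOn_const s2)
  exact ((s3.smul s1).add (s4.smul s2)).congr fun y hy => E.proj_eq hkl hy v

/-- The projection is parallel. -/
theorem fderiv_proj (hkl : k ≠ l) (h1 : L.ε * k * l = 1) (v : R42) (hx : x ∈ L.U) :
    fderiv ℝ (L.proj k l v) x = 0 := by
  have hk : k ≠ 0 := by rintro rfl; simp at h1
  have hlk : l - k ≠ 0 := sub_ne_zero.2 hkl.symm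
  have c1 : conn L ξ η σ x = 0 := E.conn_eq_zero (fun _ _ => rfl) (fun _ _ => hkl.symm) hx
  have c2 : conn L η ξ τ x = 0 := E.swap.conn_eq_zero (fun _ _ => rfl) (fun _ _ => hkl) hx
  have d1 : DifferentiableAt ℝ (fun y => L.n y + k • L.φ y) x :=
    (diff_n hx).fun_add ((diff_φ hx).fun_const_smul k)
  have d2 := diffU hx (smooth_derφ E.smooth_η)
  have e1 : der ξ (fun y => L.n y + k • L.φ y) x = 0 := by
    rw [der_add (diff_n hx) ((diff_φ hx).fun_const_smul k), der_const_smul (diff_φ hx),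
      E.der_n hx, neg_add_cancel]
  have e2 : der η (fun y => L.n y + k • L.φ y) x = (k - l) • der η L.φ x := by
    rw [der_add (diff_n hx) ((diff_φ hx).fun_const_smul k), der_const_smul (diff_φ hx),
      E.swap.der_n hx]
    module
  have e3 : der ξ (der η L.φ) x = 0 := by rw [E.der_ξ_η hx, c1, zero_smul]
  have e4 : der η (der η L.φ) x = (τ * L.ε * l) • (L.n x + k • L.φ x) := by
    rw [E.swap.der_ξ_ξ hx, c2, smul_add, smul_smul,
      show τ * L.ε * l * k = τ by linear_combination τ * h1]
    module
  have dG : ∀ ζ : Plane → Plane, der ζ (L.proj k l v) x =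
      (ip v (L.n x + k • L.φ x) * (k * (l - k))⁻¹) • der ζ (fun y => L.n y + k • L.φ y) x
      + (ip v (der ζ (fun y => L.n y + k • L.φ y) x) * (k * (l - k))⁻¹) • (L.n x + k • L.φ x)
      + ((τ * ip v (der η L.φ x)) • der ζ (der η L.φ) x
      + (τ * ip v (der ζ (der η L.φ) x)) • der η L.φ x) := fun ζ => by
    have a1 : DifferentiableAt ℝ (fun y => ip v (L.n y + k • L.φ y)) x :=
      diffU hx (smooth_ip contDiffOn_const (L.smooth_n.add (L.smooth_φ.const_smul k)))
    have a2 : DifferentiableAt ℝ (fun y => ip v (der η L.φ y)) x :=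
      diffU hx (smooth_ip contDiffOn_const (smooth_derφ E.smooth_η))
    have b : ∀ {f : Plane → R42}, DifferentiableAt ℝ f x →
        der ζ (fun y => ip v (f y)) x = ip v (der ζ f x) := fun hf => by
      rw [der_ip (differentiableAt_const v) hf, der_const, ip_zero_left, zero_add]
    rw [der_congr L.isOpen hx fun y hy => E.proj_eq hkl hy v,
      der_add ((a1.mul_const _).fun_smul d1) ((a2.const_mul τ).fun_smul d2),
      der_smul (a1.mul_const _) d1, der_smul (a2.const_mul τ) d2,
      der_mul a1 (differentiableAt_const _), der_const_mul a2, b d1, b d2, der_const]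
    module
  have g1 : der ξ (L.proj k l v) x = 0 := by
    rw [dG, e1, e3]
    simp
  have g2 : der η (L.proj k l v) x = 0 := by
    have h2 : (k - l) * (k * (l - k))⁻¹ + L.ε * l = 0 := by
      field_simp
      linear_combination (l - k) * h1
    rw [dG, e2, e4]
    simp only [ip_smul_right]
    have h3 : ∀ (A B : ℝ) (X Y : R42), (A * (k * (l - k))⁻¹) • (k - l) • Y
        + ((k - l) * B * (k * (l - k))⁻¹) • X + ((τ * B) • (τ * L.ε * l) • X
        + (τ * (τ * L.ε * l * A)) • Y) = ((k - l) * (k * (l - k))⁻¹ + (τ * τ) * (L.ε * l)) •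
          (A • Y + B • X) := fun A B X Y => by module
    rw [h3, E.τ_sq, one_mul, h2, zero_smul]
  ext1 u
  rw [E.expand hx u, map_add, map_smul, map_smul]
  change _ • der ξ (L.proj k l v) x + _ • der η (L.proj k l v) x = _
  rw [g1, g2]
  simp

end EigenFrame

theorem ip_conormal {k l : ℝ} (h1 : L.ε * k * l = 1) (hx : x ∈ L.U) :
    ip (L.n x + k • L.φ x) (L.n x + l • L.φ x) = 0 ∧
    ip (L.n x + k • L.φ x) (L.n x + k • L.φ x) = k * (l - k) := by
  have := L.eps_sq
  simp only [ip_add_left, ip_add_right, ip_smul_left, ip_smul_right, L.n_n x hx, L.n_φ x hx,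
    L.φ_φ x hx, ip_comm (L.φ x) (L.n x)]
  constructor
  · linear_combination k * l * this - L.ε * h1
  · linear_combination k * l * this - L.ε * h1

theorem coord_conormal (hx : x ∈ L.U) (k : ℝ) : L.coord x (L.n x + k • L.φ x) = 0 := by
  apply fderiv_φ_injective hx
  rw [fderiv_coord hx, map_zero]
  simp only [ip_add_right, ip_smul_right, L.n_n x hx, L.n_φ x hx,
    L.φ_φ x hx, ip_comm (L.φ x) (L.n x), L.eps_sq, mul_add]
  module

theorem proj_conormal_left {k l : ℝ} (hkl : k ≠ l) (h1 : L.ε * k * l = 1) (hx : x ∈ L.U) :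
    L.proj k l (L.n x + k • L.φ x) x = L.n x + k • L.φ x := by
  have hk : k ≠ 0 := by rintro rfl; simp at h1
  have hlk : l - k ≠ 0 := sub_ne_zero.2 hkl.symm
  rw [proj, coord_conormal hx, (ip_conormal h1 hx).2, mul_inv_cancel₀ (mul_ne_zero hk hlk)]
  simp [S_eq]

theorem proj_conormal_right {k l : ℝ} (h1 : L.ε * k * l = 1) (hx : x ∈ L.U) :
    L.proj k l (L.n x + l • L.φ x) x = 0 := by
  rw [proj, coord_conormal hx, ip_comm, (ip_conormal h1 hx).1]
  simp [S_eq]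

theorem proj_symm {k l : ℝ} (hx : x ∈ L.U) (v w : R42) :
    ip (L.proj k l v x) w = ip (L.proj k l w x) v := by
  have h : ∀ v w : R42, ip (fderiv ℝ L.φ x (L.S x (L.coord x v) - k • L.coord x v)) w =
      L.met x (L.S x (L.coord x v) - k • L.coord x v) (L.coord x w) := fun v w => by
    rw [met_comm, met, ip_fderiv_coord hx, ip_comm]
  simp only [proj, ip_add_left, ip_smul_left, h, met_sub_left, met_smul_left, ip_add_right,
    ip_smul_right]
  rw [met_S hx, met_comm (L.S x (L.coord x w)), met_comm (L.coord x w), ip_comm v, ip_comm v,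
    ip_comm w, ip_comm w]
  ring

end LocalSurface

/-! ### Orthonormal bases and standard products -/

/-- `b` is orthonormal, with `⟨b i, b i⟩ = s i = ±1`. -/
structure IsOrthonormal (b : Fin 4 → R42) (s : Fin 4 → ℝ) : Prop where
  sq : ∀ i, s i * s i = 1
  self : ∀ i, ip (b i) (b i) = s i
  ne : ∀ i j, i ≠ j → ip (b i) (b j) = 0

namespace IsOrthonormal

variable {b : Fin 4 → R42} {s : Fin 4 → ℝ} (h : IsOrthonormal b s)
include h

theorem reindex {e : Fin 4 → Fin 4} (he : Function.Injective e) :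
    IsOrthonormal (fun i => b (e i)) (fun i => s (e i)) where
  sq _ := h.sq _
  self _ := h.self _
  ne _ _ hij := h.ne _ _ (he.ne hij)

theorem ip_sum (y : R42) (j : Fin 4) : ip (∑ i, y i • b i) (b j) = y j * s j := by
  rw [map_sum, LinearMap.sum_apply, Finset.sum_eq_single j]
  · rw [ip_smul_left, h.self]
  · intro i _ hij
    rw [ip_smul_left, h.ne i j hij, mul_zero]
  · simp

/-- The coordinate isomorphism of an orthonormal basis. -/
theorem exists_equiv : ∃ R : R42 ≃ₗ[ℝ] R42, ∀ y, R y = ∑ i, y i • b i := by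
  set A : R42 →ₗ[ℝ] R42 :=
    { toFun := fun y => ∑ i, y i • b i
      map_add' := fun y z => by simp [add_smul, Finset.sum_add_distrib]
      map_smul' := fun c y => by simp [Finset.smul_sum, mul_smul] } with hA
  have hi : Function.Injective A := by
    rw [← LinearMap.ker_eq_bot, LinearMap.ker_eq_bot']
    intro y hy
    funext j
    have h1 := h.ip_sum y j
    change A y = 0 at hy
    rw [show ∑ i, y i • b i = A y from rfl, hy, ip_zero_left] at h1
    have h2 := h.sq j
    have h3 : y j * (s j * s j) = 0 := by rw [← mul_assoc, ← h1, zero_mul]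
    rwa [h2, mul_one] at h3
  exact ⟨LinearEquiv.ofInjectiveEndo A hi, fun y => rfl⟩

theorem ip_sum_sum (y z : R42) :
    ip (∑ i, y i • b i) (∑ i, z i • b i) = ∑ i, y i * z i * s i := by
  rw [map_sum]
  refine Finset.sum_congr rfl fun j _ => ?_
  rw [ip_smul_right, h.ip_sum]
  ring

/-- The metric is not negative definite. -/
theorem exists_ne_neg_one : ∃ i, s i ≠ -1 := by
  by_contra! h0
  obtain ⟨R, hR⟩ := h.exists_equiv
  have h1 := h.ip_sum_sum (R.symm ![0, 0, 1, 0]) (R.symm ![0, 0, 1, 0])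
  rw [← hR, LinearEquiv.apply_symm_apply, ip_apply] at h1
  have h2 : ∑ i, R.symm ![0, 0, 1, 0] i * R.symm ![0, 0, 1, 0] i * s i ≤ 0 :=
    Finset.sum_nonpos fun i _ => by
      rw [h0 i]
      nlinarith [mul_self_nonneg (R.symm ![0, 0, 1, 0] i)]
  rw [← h1] at h2
  simp at h2
  norm_num at h2

/-- An orthonormal basis with the standard signature is mapped to the standard basis by a linear
isometry. -/
theorem exists_isometry (h0 : s 0 = -1) (h1 : s 1 = -1) (h2 : s 2 = 1) (h3 : s 3 = 1) :
    ∃ T : R42 ≃ₗ[ℝ] R42, (∀ x y, ip (T x) (T y) = ip x y) ∧ ∀ v i, T v i = s i * ip v (b i) := by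
  obtain ⟨R, hR⟩ := h.exists_equiv
  refine ⟨R.symm, fun x y => ?_, fun v i => ?_⟩
  · conv_rhs => rw [← R.apply_symm_apply x, ← R.apply_symm_apply y, hR, hR, h.ip_sum_sum]
    rw [Fin.sum_univ_four, h0, h1, h2, h3, ip_apply]
    ring
  · conv_rhs => rw [← R.apply_symm_apply v, hR, h.ip_sum]
    linear_combination -R.symm v i * h.sq i

end IsOrthonormal

theorem sq_mul_eq_iff {c ρ : ℝ} (hc : 0 < c) (hρ : ρ ≠ 0) : c ^ 2 * ρ = ρ ↔ c = 1 := by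
  constructor
  · intro h
    have h1 : c ^ 2 = 1 := mul_right_cancel₀ hρ (by rw [h, one_mul])
    nlinarith
  · rintro rfl; ring

/-- Two maps into orthogonal planes with values of constant norms `ρ₁`, `ρ₂` where
`ρ₁ + ρ₂ = -1`: up to an isometry their sum takes its values in a standard product, and no other
positive combination does. -/
theorem exists_standardProduct {ι : Type*} {X₁ X₂ : ι → R42} {ρ₁ ρ₂ : ℝ} {b : Fin 4 → R42}
    {s : Fin 4 → ℝ} (hb : IsOrthonormal b s) (hX₁ : ∀ q, ip (X₁ q) (X₁ q) = ρ₁)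
    (hX₂ : ∀ q, ip (X₂ q) (X₂ q) = ρ₂) (h12 : ∀ q, ip (X₁ q) (b 2) = 0)
    (h13 : ∀ q, ip (X₁ q) (b 3) = 0) (h20 : ∀ q, ip (X₂ q) (b 0) = 0)
    (h21 : ∀ q, ip (X₂ q) (b 1) = 0) (hρ : ρ₁ + ρ₂ = -1) (s0 : 0 < s 0 * ρ₁) (s2 : 0 < s 2 * ρ₂)
    (hs : 0 < ρ₁ * ρ₂ * s 1 * s 3) :
    ∃ (P : Set R42) (T : R42 ≃ₗ[ℝ] R42), IsStandardProduct P ∧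
      (∀ x y, ip (T x) (T y) = ip x y) ∧ ∀ c₁ c₂ : ℝ, 0 < c₁ → 0 < c₂ → ∀ q,
        (T (c₁ • X₁ q + c₂ • X₂ q) ∈ P ↔ c₁ = 1 ∧ c₂ = 1) := by
  have pm : ∀ i, s i = 1 ∨ s i = -1 := fun i => mul_self_eq_one_iff.1 (hb.sq i)
  -- norms `ρ₁ > 0 > ρ₂`: the signs of the other two basis vectors decide between the products
  -- `prodHS` and `prodSH`
  have key : ∀ (X₁ X₂ : ι → R42) (ρ₁ ρ₂ : ℝ) (b : Fin 4 → R42) (s : Fin 4 → ℝ),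
      IsOrthonormal b s → (∀ q, ip (X₁ q) (X₁ q) = ρ₁) → (∀ q, ip (X₂ q) (X₂ q) = ρ₂) →
      (∀ q, ip (X₁ q) (b 2) = 0) → (∀ q, ip (X₁ q) (b 3) = 0) → (∀ q, ip (X₂ q) (b 0) = 0) →
      (∀ q, ip (X₂ q) (b 1) = 0) → ρ₁ + ρ₂ = -1 → s 0 = 1 → s 2 = -1 → 0 < ρ₁ → ρ₂ < 0 →
      s 1 * s 3 < 0 → ∃ (P : Set R42) (T : R42 ≃ₗ[ℝ] R42), IsStandardProduct P ∧
        (∀ x y, ip (T x) (T y) = ip x y) ∧ ∀ c₁ c₂ : ℝ, 0 < c₁ → 0 < c₂ → ∀ q,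
          (T (c₁ • X₁ q + c₂ • X₂ q) ∈ P ↔ c₁ = 1 ∧ c₂ = 1) := by
    intro X₁ X₂ ρ₁ ρ₂ b s hb hX₁ hX₂ h12 h13 h20 h21 hρ s0 s2 p1 p2 hs
    have pm : ∀ i, s i = 1 ∨ s i = -1 := fun i => mul_self_eq_one_iff.1 (hb.sq i)
    rcases pm 1 with s1 | s1
    · have s3 : s 3 = -1 := by
        rcases pm 3 with s3 | s3
        · rw [s1, s3] at hs; norm_num at hs
        · exact s3
      obtain ⟨T, hT, hT'⟩ := (hb.reindex (e := ![2, 3, 0, 1]) (by decide)).exists_isometry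
        s2 s3 s0 s1
      refine ⟨_, T, Or.inr (Or.inr ⟨√(-ρ₂), Real.lt_sqrt_of_sq_lt (by linarith), rfl⟩), hT,
        fun c₁ c₂ k₁ k₂ q => ?_⟩
      have a2 := hT' (X₂ q) 2
      have a3 := hT' (X₂ q) 3
      have a0 := hT' (X₁ q) 0
      have a1 := hT' (X₁ q) 1
      have n1 := hT (X₁ q) (X₁ q)
      have n2 := hT (X₂ q) (X₂ q)
      simp only [Matrix.cons_val, h20, h21, h12, h13, mul_zero] at a0 a1 a2 a3
      rw [hX₁, ip_apply, a0, a1] at n1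
      rw [hX₂, ip_apply, a2, a3] at n2
      simp only [prodHS, Set.mem_ofPred_eq, map_add, map_smul, Pi.add_apply, Pi.smul_apply,
        smul_eq_mul, a0, a1, a2, a3]
      rw [Real.sq_sqrt (by linarith), ← sq_mul_eq_iff k₁ p1.ne', ← sq_mul_eq_iff k₂ p2.ne, and_comm]
      refine and_congr ⟨fun e => ?_, fun e => ?_⟩ ⟨fun e => ?_, fun e => ?_⟩
      · linear_combination e - c₁ ^ 2 * n1 - hρ
      · linear_combination e + c₁ ^ 2 * n1 + hρ
      · linear_combination e - c₂ ^ 2 * n2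
      · linear_combination e + c₂ ^ 2 * n2
    · have s3 : s 3 = 1 := by
        rcases pm 3 with s3 | s3
        · exact s3
        · rw [s1, s3] at hs; norm_num at hs
      obtain ⟨T, hT, hT'⟩ := (hb.reindex (e := ![1, 2, 0, 3]) (by decide)).exists_isometry
        s1 s2 s0 s3
      refine ⟨_, T, Or.inl ⟨√ρ₁, Real.sqrt_pos.2 p1, rfl⟩, hT, fun c₁ c₂ k₁ k₂ q => ?_⟩
      have a2 := hT' (X₂ q) 2
      have a0 := hT' (X₂ q) 0
      have a3 := hT' (X₁ q) 3
      have a1 := hT' (X₁ q) 1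
      have n1 := hT (X₁ q) (X₁ q)
      have n2 := hT (X₂ q) (X₂ q)
      simp only [Matrix.cons_val, h20, h21, h12, h13, mul_zero] at a0 a1 a2 a3
      rw [hX₁, ip_apply, a3, a1] at n1
      rw [hX₂, ip_apply, a2, a0] at n2
      simp only [prodSH, Set.mem_ofPred_eq, map_add, map_smul, Pi.add_apply, Pi.smul_apply,
        smul_eq_mul, a0, a1, a2, a3]
      rw [Real.sq_sqrt p1.le, ← sq_mul_eq_iff k₁ p1.ne', ← sq_mul_eq_iff k₂ p2.ne]
      refine and_congr ⟨fun e => ?_, fun e => ?_⟩ ⟨fun e => ?_, fun e => ?_⟩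
      · linear_combination e - c₁ ^ 2 * n1
      · linear_combination e + c₁ ^ 2 * n1
      · linear_combination e - c₂ ^ 2 * n2 - hρ
      · linear_combination e + c₂ ^ 2 * n2 + hρ
  rcases pm 0 with s0' | s0' <;> rcases pm 2 with s2' | s2' <;> rw [s0'] at s0 <;> rw [s2'] at s2
  · linarith
  · exact key X₁ X₂ ρ₁ ρ₂ b s hb hX₁ hX₂ h12 h13 h20 h21 hρ s0' s2' (by linarith) (by linarith)
      (by
        by_contra h
        nlinarith [mul_nonneg (mul_nonneg (by linarith : (0 : ℝ) ≤ ρ₁) (by linarith : 0 ≤ -ρ₂))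
          (not_lt.1 h)])
  · obtain ⟨P, T, hP, hT, h⟩ := key X₂ X₁ ρ₂ ρ₁ (fun i => b (![2, 3, 0, 1] i))
      (fun i => s (![2, 3, 0, 1] i)) (hb.reindex (by decide)) hX₂ hX₁ h20 h21 h12 h13 (by linarith)
      s2' s0' (by linarith) (by linarith) (by
        change s 3 * s 1 < 0
        by_contra h
        nlinarith [mul_nonneg (mul_nonneg (by linarith : (0 : ℝ) ≤ ρ₂) (by linarith : 0 ≤ -ρ₁))
          (not_lt.1 h)])
    exact ⟨P, T, hP, hT, fun c₁ c₂ k₁ k₂ q => by rw [add_comm, h c₂ c₁ k₂ k₁ q, and_comm]⟩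
  -- both norms are negative, and the index two of the metric makes `b 1` and `b 3` spacelike
  · have p1 : ρ₁ < 0 := by linarith
    have p2 : ρ₂ < 0 := by linarith
    have hs' : 0 < s 1 * s 3 := by
      by_contra h
      nlinarith [mul_nonneg (mul_pos_of_neg_of_neg p1 p2).le (neg_nonneg.2 (not_lt.1 h))]
    have s13 : s 1 = 1 ∧ s 3 = 1 := by
      rcases pm 1 with s1 | s1 <;> rcases pm 3 with s3 | s3
      · exact ⟨s1, s3⟩
      · rw [s1, s3] at hs'; norm_num at hs'
      · rw [s1, s3] at hs'; norm_num at hs'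
      · obtain ⟨i, hi⟩ := hb.exists_ne_neg_one
        exfalso
        fin_cases i
        exacts [hi s0', hi s1, hi s2', hi s3]
    obtain ⟨T, hT, hT'⟩ := (hb.reindex (e := ![0, 2, 1, 3]) (by decide)).exists_isometry
      s0' s2' s13.1 s13.2
    refine ⟨_, T, Or.inr (Or.inl ⟨√(-ρ₁), Real.sqrt_pos.2 (by linarith),
      (Real.sqrt_lt' one_pos).2 (by linarith), rfl⟩), hT, fun c₁ c₂ k₁ k₂ q => ?_⟩
    have a2 := hT' (X₂ q) 2
    have a0 := hT' (X₂ q) 0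
    have a3 := hT' (X₁ q) 3
    have a1 := hT' (X₁ q) 1
    have n1 := hT (X₁ q) (X₁ q)
    have n2 := hT (X₂ q) (X₂ q)
    simp only [Matrix.cons_val, h20, h21, h12, h13, mul_zero] at a0 a1 a2 a3
    rw [hX₁, ip_apply, a3, a1] at n1
    rw [hX₂, ip_apply, a2, a0] at n2
    simp only [prodHH, Set.mem_ofPred_eq, map_add, map_smul, Pi.add_apply, Pi.smul_apply,
      smul_eq_mul, a0, a1, a2, a3]
    rw [Real.sq_sqrt (by linarith), ← sq_mul_eq_iff k₁ p1.ne, ← sq_mul_eq_iff k₂ p2.ne]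
    refine and_congr ⟨fun e => ?_, fun e => ?_⟩ ⟨fun e => ?_, fun e => ?_⟩
    · linear_combination e - c₁ ^ 2 * n1
    · linear_combination e + c₁ ^ 2 * n1
    · linear_combination e - c₂ ^ 2 * n2 - hρ
    · linear_combination e + c₂ ^ 2 * n2 + hρ

/-! ### Surfaces with two distinct constant principal curvatures are products -/

/-- Normalization of a non-null vector. -/
theorem exists_unit {u : R42} {ρ : ℝ} (h : ip u u = ρ) (hρ : ρ ≠ 0) :
    ∃ α s : ℝ, s * s = 1 ∧ 0 < s * ρ ∧ ip (α • u) (α • u) = s := by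
  obtain ⟨s, hs, hp⟩ : ∃ s : ℝ, s * s = 1 ∧ 0 < s * ρ := by
    rcases lt_or_gt_of_ne hρ with h | h
    · exact ⟨-1, by norm_num, by linarith⟩
    · exact ⟨1, by norm_num, by linarith⟩
  refine ⟨(√(s * ρ))⁻¹, s, hs, hp, ?_⟩
  rw [ip_smul_left, ip_smul_right, h, ← mul_assoc, ← mul_inv, Real.mul_self_sqrt hp.le,
    inv_mul_eq_iff_eq_mul₀ hp.ne']
  linear_combination -ρ * hs

namespace LocalSurface

variable {L : LocalSurface} {x : Plane}

/-- The vectors `n + k φ` have tangential derivatives, which vanish in the principal directions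
for `k`. -/
theorem der_conormal (hx : x ∈ L.U) (c k : ℝ) (v : Plane) :
    fderiv ℝ (fun y => c • (L.n y + k • L.φ y)) x v =
      fderiv ℝ L.φ x (c • (k • v - L.S x v)) := by
  have h : der (fun _ => v) (fun y => c • (L.n y + k • L.φ y)) x = _ :=
    der_const_smul ((diff_n hx).fun_add ((diff_φ hx).fun_const_smul k))
  rw [der_add (diff_n hx) ((diff_φ hx).fun_const_smul k), der_const_smul (diff_φ hx)] at h
  change fderiv ℝ _ x v = _ at h
  rw [h, map_smul, map_sub, map_smul, fderiv_φ_S hx, sub_neg_eq_add, add_comm]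
  rfl

/-- The positive combinations of the two components of a surface with distinct principal
curvatures `k`, `l` fill an open set. -/
theorem map_nhds_cone {k l c₁ c₂ : ℝ} (hkl : k ≠ l) (ht : L.t x = k + l) (hd : L.d x = k * l)
    (hx : x ∈ L.U) (h₁ : 0 < c₁) (h₂ : 0 < c₂) :
    Filter.map (fun z : Plane × ℝ × ℝ => z.2.1 • (k - l)⁻¹ • (L.n z.1 + k • L.φ z.1)
        + z.2.2 • (-(k - l)⁻¹) • (L.n z.1 + l • L.φ z.1)) (nhds (x, c₁, c₂)) =
      nhds (c₁ • (k - l)⁻¹ • (L.n x + k • L.φ x)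
        + c₂ • (-(k - l)⁻¹) • (L.n x + l • L.φ x)) := by
  set c := (k - l)⁻¹ with hc
  have hck : c * (k - l) = 1 := inv_mul_cancel₀ (sub_ne_zero.2 hkl)
  have strict : ∀ c k : ℝ, HasStrictFDerivAt (fun y => c • (L.n y + k • L.φ y))
      (fderiv ℝ (fun y => c • (L.n y + k • L.φ y)) x) x := fun c k =>
    ((((L.smooth_n.add (L.smooth_φ.const_smul k)).const_smul c).contDiffAt
      (L.isOpen.mem_nhds hx)).hasStrictFDerivAt (by simp))
  have hfst : HasStrictFDerivAt (𝕜 := ℝ) (fun z : Plane × ℝ × ℝ => z.1) _ (x, c₁, c₂) :=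
    hasStrictFDerivAt_fst (𝕜 := ℝ)
  have hsnd : HasStrictFDerivAt (𝕜 := ℝ) (fun z : Plane × ℝ × ℝ => z.2) _ (x, c₁, c₂) :=
    hasStrictFDerivAt_snd (𝕜 := ℝ)
  have g1 := (strict c k).comp (x, c₁, c₂) hfst
  have g2 := (strict (-c) l).comp (x, c₁, c₂) hfst
  have hG := (hsnd.fst.smul g1).add (hsnd.snd.smul g2)
  refine hG.map_nhds_eq_of_surj (LinearMap.range_eq_top.2 fun w => ?_)
  -- the derivative acts on the tangent plane by `A`, whose inverse is a multiple of `A'`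
  set A : Plane → Plane := fun v => c₁ • c • (k • v - L.S x v) + c₂ • (-c) • (l • v - L.S x v)
  set v : Plane := L.coord x w
  set u : Plane := (c₁ * c₂)⁻¹ • (c₂ • c • (k • v - L.S x v) + c₁ • (-c) • (l • v - L.S x v))
    with hu
  have hA : A u = v := by
    have e : L.S x (c₂ • c • (k • v - L.S x v) + c₁ • (-c) • (l • v - L.S x v)) =
        (c₂ * c) • (k • L.S x v - ((k + l) • L.S x v - (k * l) • v))
        - (c₁ * c) • (l • L.S x v - ((k + l) • L.S x v - (k * l) • v)) := by
      rw [S_add, S_smul, S_smul, S_smul, S_smul, S_sub, S_sub, S_smul, S_smul, S_S, ht, hd]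
      module
    have hne : c₁ * c₂ ≠ 0 := (mul_pos h₁ h₂).ne'
    have e2 : A u = ((c₁ * c₂)⁻¹ * ((c₁ * c₂) * (c * (k - l)) ^ 2)) • v := by
      simp only [A]
      rw [hu, S_smul, e]
      module
    rw [e2, hck, one_pow, mul_one, inv_mul_cancel₀ hne, one_smul]
  have hdec := fderiv_coord hx w
  refine ⟨(u, L.ε * ip (L.n x) w * (-l) - ip (L.φ x) w,
    L.ε * ip (L.n x) w * (-k) - ip (L.φ x) w), ?_⟩
  have hval : ∀ a b : ℝ, c₁ • fderiv ℝ (fun y => c • (L.n y + k • L.φ y)) x u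
      + a • c • (L.n x + k • L.φ x) + (c₂ • fderiv ℝ (fun y => (-c) • (L.n y + l • L.φ y)) x u
      + b • (-c) • (L.n x + l • L.φ x)) = fderiv ℝ L.φ x v + ((a - b) * c) • L.n x
        + ((a * k - b * l) * c) • L.φ x := fun a b => by
    rw [← hA]
    simp only [A, der_conormal hx, map_add, map_smul, map_sub]
    module
  have hw : w = fderiv ℝ L.φ x v + (L.ε * ip (L.n x) w) • L.n x - ip (L.φ x) w • L.φ x := by
    rw [hdec]; abel
  refine (hval (L.ε * ip (L.n x) w * (-l) - ip (L.φ x) w)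
    (L.ε * ip (L.n x) w * (-k) - ip (L.φ x) w)).trans ?_
  conv_rhs => rw [hw]
  have e3 : (L.ε * ip (L.n x) w * (-l) - ip (L.φ x) w
      - (L.ε * ip (L.n x) w * (-k) - ip (L.φ x) w)) * c = L.ε * ip (L.n x) w := by
    linear_combination (L.ε * ip (L.n x) w) * hck
  have e4 : ((L.ε * ip (L.n x) w * (-l) - ip (L.φ x) w) * k
      - (L.ε * ip (L.n x) w * (-k) - ip (L.φ x) w) * l) * c = -ip (L.φ x) w := by
    linear_combination (-ip (L.φ x) w) * hck
  rw [e3, e4]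
  module

end LocalSurface

namespace OrientedSurface

variable {M : Type*} [TopologicalSpace M] [ChartedSpace (EuclideanSpace ℝ (Fin 2)) M]
  [IsManifold (𝓡 2) ∞ M] (W : OrientedSurface M)

/-- The intrinsic form of `LocalSurface.proj`. -/
def proj (k l : ℝ) (v : R42) (q : M) : R42 :=
  (ip v (W.N q + k • W.ψ q) * (k * (l - k))⁻¹) • (W.N q + k • W.ψ q)
    + (l - k)⁻¹ • diff W.ψ q (W.shape q (W.tang q v) - k • W.tang q v)

theorem proj_eq (k l : ℝ) (v : R42) {p q : M} (hq : q ∈ (extChartAt (𝓡 2) p).source) :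
    W.proj k l v q = (W.loc p).proj k l v (extChartAt (𝓡 2) p q) := by
  rw [proj, LocalSurface.proj, ← W.fderiv_tau hq, map_sub, map_smul, W.tau_shape hq,
    W.tau_tang hq]
  change _ = (ip v (inChart p W.N _ + k • inChart p W.ψ _) * _) •
    (inChart p W.N _ + k • inChart p W.ψ _) + _
  rw [inChart_apply hq, inChart_apply hq]

theorem inChart_proj (k l : ℝ) (v : R42) (p : M) : ∀ x ∈ (W.loc p).U,
    inChart p (W.proj k l v) x = (W.loc p).proj k l v x := fun x hx => by
  have := W.proj_eq k l v ((extChartAt (𝓡 2) p).map_target hx)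
  rwa [(extChartAt (𝓡 2) p).right_inv hx] at this

section

variable {k l : ℝ} (hkl : k ≠ l) (ht : ∀ q, W.tr q = k + l) (hd : ∀ q, W.dt q = k * l)
include hkl ht hd

theorem exists_frame {p : M} {x : Plane} (hx : x ∈ (W.loc p).U) :
    ∃ (V : Set Plane) (hV : IsOpen V) (hVU : V ⊆ (W.loc p).U) (ξ η : Plane → Plane) (σ τ : ℝ),
      x ∈ V ∧ LocalSurface.EigenFrame ((W.loc p).restrict hV hVU) ξ η (fun _ => k) (fun _ => l)
        σ τ :=
  LocalSurface.exists_eigenFrame hx contDiffOn_const contDiffOn_const (W.t_eq ht p) (W.d_eq hd p)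
    hkl

theorem eps_mul_eq_one [Nonempty M] : W.ε * k * l = 1 := by
  obtain ⟨V, hV, hVU, ξ, η, σ, τ, hxV, E⟩ := W.exists_frame hkl ht hd
    (mem_extChartAt_target (I := 𝓡 2) (Classical.arbitrary M))
  exact E.eps_mul_eq_one (fun _ _ => rfl) (fun _ _ => rfl) hkl hxV

/-- The projections split `R^4_2` into two orthogonal planes independent of the point. -/
theorem proj_const [ConnectedSpace M] (v : R42) : ∃ c, ∀ q, W.proj k l v q = c := by
  have h1 := W.eps_mul_eq_one hkl ht hd
  have key : ∀ p, ∀ x ∈ (W.loc p).U, DifferentiableAt ℝ (inChart p (W.proj k l v)) x ∧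
      fderiv ℝ (inChart p (W.proj k l v)) x = 0 := fun p x hx => by
    obtain ⟨V, hV, hVU, ξ, η, σ, τ, hxV, E⟩ := W.exists_frame hkl ht hd hx
    have e : inChart p (W.proj k l v) =ᶠ[nhds x] ((W.loc p).restrict hV hVU).proj k l v :=
      Filter.eventuallyEq_of_mem ((W.loc p).isOpen.mem_nhds hx) (W.inChart_proj k l v p)
    rw [e.fderiv_eq, e.differentiableAt_iff]
    exact ⟨LocalSurface.diffU (L := (W.loc p).restrict hV hVU) hxV (E.smooth_proj hkl v),
      E.fderiv_proj hkl h1 v hxV⟩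
  exact const_of_fderiv_eq_zero (fun p x hx => (key p x hx).1.differentiableWithinAt)
    fun p x hx => (key p x hx).2

theorem proj_conormal (q : M) [ConnectedSpace M] :
    W.proj k l (W.N q + k • W.ψ q) q = W.N q + k • W.ψ q ∧
    W.proj k l (W.N q + l • W.ψ q) q = 0 := by
  have h1 := W.eps_mul_eq_one hkl ht hd
  have hq := mem_extChartAt_source (I := 𝓡 2) q
  have hx := W.mem_loc hq
  have e : ∀ k : ℝ, W.N q + k • W.ψ q = (W.loc q).n (extChartAt (𝓡 2) q q)
      + k • (W.loc q).φ (extChartAt (𝓡 2) q q) := fun k => by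
    change _ = inChart q W.N _ + k • inChart q W.ψ _
    rw [inChart_apply hq, inChart_apply hq]
  rw [W.proj_eq k l _ hq, W.proj_eq k l _ hq, e k, e l]
  exact ⟨LocalSurface.proj_conormal_left hkl h1 hx, LocalSurface.proj_conormal_right h1 hx⟩

theorem ip_conormal_eq_zero [ConnectedSpace M] {v : R42} {p : M} (hv : W.proj k l v p = 0)
    (q : M) : ip (W.N q + k • W.ψ q) v = 0 := by
  obtain ⟨c, hc⟩ := W.proj_const hkl ht hd v
  have hq := mem_extChartAt_source (I := 𝓡 2) q
  rw [← (W.proj_conormal hkl ht hd q).1, W.proj_eq k l _ hq,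
    LocalSurface.proj_symm (W.mem_loc hq), ← W.proj_eq k l _ hq, hc, ← hc p, hv, ip_zero_left]

theorem ip_conormal_eq_zero' [ConnectedSpace M] {v : R42} {p : M} (hv : W.proj k l v p = v)
    (q : M) : ip (W.N q + l • W.ψ q) v = 0 := by
  obtain ⟨c, hc⟩ := W.proj_const hkl ht hd v
  have hq := mem_extChartAt_source (I := 𝓡 2) q
  rw [ip_comm, ← hv, hc, ← hc q, W.proj_eq k l _ hq, LocalSurface.proj_symm (W.mem_loc hq),
    ← W.proj_eq k l _ hq, (W.proj_conormal hkl ht hd q).2, ip_zero_left]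

/-- The cone over the two factors of the surface is open. -/
theorem isOpen_cone : IsOpen {y : R42 | ∃ (q : M) (c₁ c₂ : ℝ), 0 < c₁ ∧ 0 < c₂ ∧
    c₁ • (k - l)⁻¹ • (W.N q + k • W.ψ q) + c₂ • (-(k - l)⁻¹) • (W.N q + l • W.ψ q) = y} := by
  rw [isOpen_iff_mem_nhds]
  rintro y ⟨q, c₁, c₂, h₁, h₂, rfl⟩
  have hq := mem_extChartAt_source (I := 𝓡 2) q
  have hx := W.mem_loc hq
  have h := LocalSurface.map_nhds_cone hkl (W.t_eq ht q _ hx) (W.d_eq hd q _ hx) hx h₁ h₂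
  change Filter.map _ _ = nhds (c₁ • (k - l)⁻¹ • (inChart q W.N _ + k • inChart q W.ψ _)
    + c₂ • (-(k - l)⁻¹) • (inChart q W.N _ + l • inChart q W.ψ _)) at h
  rw [inChart_apply hq, inChart_apply hq] at h
  rw [← h, Filter.mem_map]
  refine Filter.mem_of_superset (prod_mem_nhds (Filter.univ_mem : Set.univ ∈ nhds _)
    (prod_mem_nhds (Ioi_mem_nhds h₁) (Ioi_mem_nhds h₂))) ?_
  rintro ⟨z, a, b⟩ ⟨-, ha, hb⟩
  exact ⟨(extChartAt (𝓡 2) q).symm z, a, b, ha, hb, rfl⟩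

/-- A surface with two distinct constant real principal curvatures is an open portion of a
product. -/
theorem isOpenPortionOfProduct [ConnectedSpace M] : W.IsOpenPortionOfProduct := by
  have h1 := W.eps_mul_eq_one hkl ht hd
  have hk : k ≠ 0 := by rintro rfl; simp at h1
  have hl : l ≠ 0 := by rintro rfl; simp at h1
  have hc : (k - l)⁻¹ ≠ 0 := inv_ne_zero (sub_ne_zero.2 hkl)
  have hck : (k - l)⁻¹ * (k - l) = 1 := inv_mul_cancel₀ (sub_ne_zero.2 hkl)
  set c := (k - l)⁻¹ with hcdef
  have hε : W.ε * W.ε = 1 := (W.loc (Classical.arbitrary M)).eps_sq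
  have hkl' : k * l = W.ε := by linear_combination W.ε * h1 - k * l * hε
  obtain ⟨p⟩ : Nonempty M := inferInstance
  have hp := mem_extChartAt_source (I := 𝓡 2) p
  have hx := W.mem_loc hp
  obtain ⟨V, hV, hVU, ξ, η, σ, τ, hxV, E⟩ := W.exists_frame hkl ht hd hx
  set x := extChartAt (𝓡 2) p p with hxdef
  -- norms of the conormals
  have nk : ∀ q, ip (W.N q + k • W.ψ q) (W.N q + k • W.ψ q) = k * (l - k) := fun q => by
    have := W.mem_AdS q
    simp only [ip_add_left, ip_add_right, ip_smul_left, ip_smul_right, W.ip_N_N, W.ip_N_ψ,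
      ip_comm (W.ψ q) (W.N q), show ip (W.ψ q) (W.ψ q) = -1 from W.mem_AdS q]
    linear_combination -hkl'
  have nl : ∀ q, ip (W.N q + l • W.ψ q) (W.N q + l • W.ψ q) = l * (k - l) := fun q => by
    simp only [ip_add_left, ip_add_right, ip_smul_left, ip_smul_right, W.ip_N_N, W.ip_N_ψ,
      ip_comm (W.ψ q) (W.N q), show ip (W.ψ q) (W.ψ q) = -1 from W.mem_AdS q]
    linear_combination -hkl'
  have pk := fun q => (W.proj_conormal hkl ht hd q).1
  have pl := fun q => (W.proj_conormal hkl ht hd q).2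
  -- the principal directions at the base point
  set e₁ := der ξ (W.loc p).φ x with he₁
  set e₂ := der η (W.loc p).φ x with he₂
  have m11 : ip e₁ e₁ = σ := E.ξ_ξ x hxV
  have m12 : ip e₁ e₂ = 0 := E.ξ_η x hxV
  have m22 : ip e₂ e₂ = τ := E.η_η x hxV
  have ne : ∀ (ζ : Plane → Plane) (k : ℝ),
      ip (W.N p + k • W.ψ p) (der ζ (W.loc p).φ x) = 0 := fun ζ k => by
    have a1 : ip ((W.loc p).n x) (der ζ (W.loc p).φ x) = 0 := LocalSurface.ip_n_fderiv hx _
    have a2 : ip ((W.loc p).φ x) (der ζ (W.loc p).φ x) = 0 := LocalSurface.ip_φ_fderiv hx _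
    change ip (inChart p W.N x) _ = 0 at a1
    change ip (inChart p W.ψ x) _ = 0 at a2
    rw [hxdef, inChart_apply hp] at a1 a2
    rw [ip_add_left, ip_smul_left, a1, a2, mul_zero, add_zero]
  have cn : ∀ k : ℝ, (W.loc p).n x + k • (W.loc p).φ x = W.N p + k • W.ψ p := fun k => by
    change inChart p W.N _ + k • inChart p W.ψ _ = _
    rw [hxdef, inChart_apply hp, inChart_apply hp]
  have p1 : W.proj k l e₁ p = 0 := by
    rw [W.proj_eq k l _ hp]
    refine (E.proj_eq hkl hxV e₁).trans ?_
    change (ip e₁ ((W.loc p).n x + k • (W.loc p).φ x) * _) • _ + (τ * ip e₁ e₂) • e₂ = 0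
    rw [cn, ip_comm, ne ξ k, m12]
    simp
  have p2 : W.proj k l e₂ p = e₂ := by
    rw [W.proj_eq k l _ hp]
    refine (E.proj_eq hkl hxV e₂).trans ?_
    change (ip e₂ ((W.loc p).n x + k • (W.loc p).φ x) * _) • _ + (τ * ip e₂ e₂) • e₂ = e₂
    rw [cn, ip_comm, ne η k, m22, E.τ_sq]
    simp
  obtain ⟨α, s, hs, hs', hα⟩ := exists_unit (nk p) (mul_ne_zero hk (sub_ne_zero.2 hkl.symm))
  obtain ⟨β, r, hr, hr', hβ⟩ := exists_unit (nl p) (mul_ne_zero hl (sub_ne_zero.2 hkl))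
  have hkp := W.ip_conormal_eq_zero hkl ht hd (pl p) p
  have hb : IsOrthonormal ![α • (W.N p + k • W.ψ p), e₂, β • (W.N p + l • W.ψ p), e₁]
      ![s, τ, r, σ] := by
    refine ⟨fun i => ?_, fun i => ?_, fun i j hij => ?_⟩
    · fin_cases i
      exacts [hs, E.τ_sq, hr, E.σ_sq]
    · fin_cases i
      exacts [hα, m22, hβ, m11]
    · have n1 := ne ξ k
      have n2 := ne ξ l
      have n3 := ne η k
      have n4 := ne η l
      have n1' := (ip_comm _ _).trans n1
      have n2' := (ip_comm _ _).trans n2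
      have n3' := (ip_comm _ _).trans n3
      have n4' := (ip_comm _ _).trans n4
      have m12' := (ip_comm _ _).trans m12
      have hkp' := (ip_comm _ _).trans hkp
      rw [← he₁] at n1 n2 n1' n2'
      rw [← he₂] at n3 n4 n3' n4'
      fin_cases i <;> fin_cases j <;> first
        | exact absurd rfl hij
        | simp only [Fin.mk_zero, Fin.mk_one, Fin.reduceFinMk, Matrix.cons_val, ip_smul_left,
            ip_smul_right, n1, n2, n3, n4, n1', n2', n3', n4', m12, m12', hkp, hkp', mul_zero]
  have hστ : 0 < -W.ε * (σ * τ) := by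
    have g := LocalSurface.met_gram (L := W.loc p) (x := x) (ξ x) (η x)
    have g1 : (W.loc p).met x (ξ x) (ξ x) = σ := m11
    have g2 : (W.loc p).met x (η x) (η x) = τ := m22
    have g3 : (W.loc p).met x (ξ x) (η x) = 0 := m12
    have hne : (W.loc p).met x (ξ x) (ξ x) * (W.loc p).met x (η x) (η x)
      - (W.loc p).met x (ξ x) (η x) ^ 2 ≠ 0 := E.gram_ne hxV
    have hΔ : 0 < -W.ε * (W.loc p).Δ x := LocalSurface.eps_Δ hx
    have ha : 0 < LocalSurface.area (ξ x) (η x) ^ 2 := by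
      rw [sq_pos_iff]
      intro h0
      apply hne
      rw [g, h0]
      ring
    rw [g1, g2, g3] at g
    have e : -W.ε * (σ * τ) = LocalSurface.area (ξ x) (η x) ^ 2 * (-W.ε * (W.loc p).Δ x) := by
      linear_combination -W.ε * g
    rw [e]
    exact mul_pos ha hΔ
  have hc2 : 0 < c ^ 2 := by positivity
  obtain ⟨P, T, hP, hT, h⟩ := exists_standardProduct
    (X₁ := fun q => c • (W.N q + k • W.ψ q)) (X₂ := fun q => (-c) • (W.N q + l • W.ψ q))
    (ρ₁ := c ^ 2 * (k * (l - k))) (ρ₂ := c ^ 2 * (l * (k - l))) hb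
    (fun q => by rw [ip_smul_left, ip_smul_right, nk]; ring)
    (fun q => by rw [ip_smul_left, ip_smul_right, nl]; ring)
    (fun q => by
      change ip _ (β • (W.N p + l • W.ψ p)) = 0
      rw [ip_smul_left, ip_smul_right, W.ip_conormal_eq_zero hkl ht hd (pl p) q, mul_zero,
        mul_zero])
    (fun q => by
      change ip _ e₁ = 0
      rw [ip_smul_left, W.ip_conormal_eq_zero hkl ht hd p1 q, mul_zero])
    (fun q => by
      change ip _ (α • (W.N p + k • W.ψ p)) = 0
      rw [ip_smul_left, ip_smul_right, W.ip_conormal_eq_zero' hkl ht hd (pk p) q, mul_zero,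
        mul_zero])
    (fun q => by
      change ip _ e₂ = 0
      rw [ip_smul_left, W.ip_conormal_eq_zero' hkl ht hd p2 q, mul_zero])
    (by linear_combination -(c * (k - l) + 1) * hck)
    (by
      change 0 < s * _
      have := mul_pos hc2 hs'
      linarith)
    (by
      change 0 < r * _
      have := mul_pos hc2 hr'
      linarith)
    (by
      change 0 < _ * τ * σ
      have e : c ^ 2 * (k * (l - k)) * (c ^ 2 * (l * (k - l))) * τ * σ =
          c ^ 2 * (-W.ε * (σ * τ)) := by
        linear_combination (-(c ^ 4 * (k - l) ^ 2 * σ * τ)) * hkl'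
          - W.ε * σ * τ * c ^ 2 * (c * (k - l) + 1) * hck
      rw [e]
      exact mul_pos hc2 hστ)
  have hψ : ∀ q, W.ψ q = (1 : ℝ) • c • (W.N q + k • W.ψ q)
      + (1 : ℝ) • (-c) • (W.N q + l • W.ψ q) := fun q => by
    have : W.ψ q = (c * (k - l)) • W.ψ q := by rw [hck, one_smul]
    conv_lhs => rw [this]
    module
  refine ⟨P, T, _, hP, hT, (W.isOpen_cone hkl ht hd).preimage
    (LinearMap.continuous_of_finiteDimensional T.symm.toLinearMap), ?_⟩
  ext y
  constructor
  · rintro ⟨q, rfl⟩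
    refine ⟨⟨q, 1, 1, one_pos, one_pos, ?_⟩, ?_⟩
    · change _ = T.symm (T (W.ψ q))
      rw [T.symm_apply_apply, ← hcdef, ← hψ]
    · have := (h 1 1 one_pos one_pos q).2 ⟨rfl, rfl⟩
      rw [← hψ] at this
      exact this
  · rintro ⟨⟨q, c₁, c₂, k₁, k₂, hy⟩, hyP⟩
    have hy' : T (c₁ • c • (W.N q + k • W.ψ q) + c₂ • (-c) • (W.N q + l • W.ψ q)) = y := by
      rw [hy]
      exact T.apply_symm_apply y
    obtain ⟨rfl, rfl⟩ := (h c₁ c₂ k₁ k₂ q).1 (by rw [hy']; exact hyP)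
    refine ⟨q, ?_⟩
    rw [← hy', ← hψ]

end

end OrientedSurface

/-! ### Integral curves and smooth local inverses -/

section Flow

variable {E : Type*} [NormedAddCommGroup E] [NormedSpace ℝ E] [CompleteSpace E]

/-- Picard-Lindelöf, with a common existence time for all starting points close to `x₀`, curves
that stay in a prescribed open set, and smoothness in time. -/
theorem exists_integralCurves {f : E → E} {U : Set E} {x₀ : E} (hU : IsOpen U)
    (hf : ContDiffOn ℝ ∞ f U) (hx₀ : x₀ ∈ U) :
    ∃ r > 0, ∃ δ > 0, ∀ x ∈ Metric.closedBall x₀ r, ∃ α : ℝ → E, α 0 = x ∧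
      ContDiffOn ℝ ∞ α (Set.Ioo (-δ) δ) ∧
      ∀ t ∈ Set.Ioo (-δ) δ, α t ∈ U ∧ HasDerivAt α (f (α t)) t := by
  have hf₀ : ContDiffAt ℝ 1 f x₀ := (hf.contDiffAt (hU.mem_nhds hx₀)).of_le (by norm_cast)
  obtain ⟨T, hT, a, r, K, K', hr, H⟩ := IsPicardLindelof.of_contDiffAt_one hf₀
  obtain ⟨ρ, hρ, hρU⟩ := Metric.isOpen_iff.mp hU x₀ hx₀
  have ha : 0 < a := by
    have h1 := (H 0).mul_max_le
    have h2 : (0 : ℝ) ≤ K * max (0 + T - 0) (0 - (0 - T)) := by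
      have : (0 : ℝ) ≤ max (0 + T - 0) (0 - (0 - T)) := le_max_of_le_left (by linarith)
      positivity
    have h3 : (0 : ℝ) < r := by exact_mod_cast hr
    have h4 : (0 : ℝ) < a := by simp only at h1; linarith
    exact_mod_cast h4
  let a' : NNReal := min a (.mk (ρ / 2) (half_pos hρ).le)
  have ha' : 0 < a' := lt_min ha (by exact_mod_cast half_pos hρ)
  have ha'ρ : (a' : ℝ) < ρ := by
    have : (a' : ℝ) ≤ ρ / 2 := by exact_mod_cast min_le_right a (.mk (ρ / 2) (half_pos hρ).le)
    linarith
  obtain ⟨δ, hδ, P⟩ := (H 0).exists_shrink_radius hT (min_le_left a _ : a' ≤ a)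
    (NNReal.half_lt_self ha'.ne' : a' / 2 < a')
  have hr' : 0 < a' / 2 := half_pos ha'
  refine ⟨(a' / 2 : NNReal), by exact_mod_cast hr', δ, hδ, fun x hx => ?_⟩
  obtain ⟨α, hα⟩ := ODE.FunSpace.exists_isFixedPt_next P hx
  have hmem : ∀ t, α.compProj t ∈ U := fun t => hρU
    (Metric.closedBall_subset_ball ha'ρ (α.compProj_mem_closedBall P.mul_max_le))
  have hder : ∀ t ∈ Set.Icc (0 - δ) (0 + δ),
      HasDerivWithinAt α.compProj (f (α.compProj t)) (Set.Icc (0 - δ) (0 + δ)) t := by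
    intro t ht
    refine ODE.hasDerivWithinAt_picard_Icc (f := fun _ => f) (u := Metric.closedBall x₀ a')
      (by simp [hδ.le] : (0 : ℝ) ∈ Set.Icc (0 - δ) (0 + δ)) P.continuousOn_uncurry
      α.continuous_compProj.continuousOn (fun _ _ => α.compProj_mem_closedBall P.mul_max_le)
      x ht |>.congr_of_mem ?_ ht
    intro t' ht'
    nth_rw 1 [← hα]
    rw [ODE.FunSpace.compProj_of_mem ht', ODE.FunSpace.next_apply]
  have hsm : ContDiffOn ℝ ∞ α.compProj (Set.Icc (0 - δ) (0 + δ)) :=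
    ODE.contDiffOn_enat_Icc_of_hasDerivWithinAt (n := ⊤) (f := fun _ => f) (u := U)
      (hf.comp contDiffOn_snd fun y hy => hy.2) hder fun t _ => hmem t
  have hI : Set.Icc (-δ) δ = Set.Icc (0 - δ) (0 + δ) := by rw [zero_sub, zero_add]
  refine ⟨α.compProj, ?_, hsm.mono (hI ▸ Set.Ioo_subset_Icc_self), fun t ht => ⟨hmem t, ?_⟩⟩
  · have := ODE.FunSpace.compProj_val (α := α) (t := ⟨0, by simp [hδ.le]⟩)
    rw [this, ← hα, ODE.FunSpace.next_apply₀]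
  · exact (hder t (hI ▸ Set.Ioo_subset_Icc_self ht)).hasDerivAt
      (hI ▸ Icc_mem_nhds ht.1 ht.2)

end Flow

section Inverse

variable {E F : Type*} [NormedAddCommGroup E] [NormedSpace ℝ E] [CompleteSpace E]
  [NormedAddCommGroup F] [NormedSpace ℝ F]

/-- The inverse function theorem, with an inverse that is smooth on its whole domain. -/
theorem exists_smooth_localInverse {f : E → F} {O : Set E} {x₀ : E} (hO : IsOpen O)
    (hf : ContDiffOn ℝ ∞ f O) (hx₀ : x₀ ∈ O) (f' : E ≃L[ℝ] F)
    (hf' : HasFDerivAt f (f' : E →L[ℝ] F) x₀) :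
    ∃ e : OpenPartialHomeomorph E F, x₀ ∈ e.source ∧ e.source ⊆ O ∧ ⇑e = f ∧
      ContDiffOn ℝ ∞ e.symm e.target := by
  have hfx : ContDiffAt ℝ ∞ f x₀ := hf.contDiffAt (hO.mem_nhds hx₀)
  let e₀ := hfx.toOpenPartialHomeomorph f hf' (by simp)
  let O' : Set E := O ∩ fderiv ℝ f ⁻¹' Set.range ((↑) : (E ≃L[ℝ] F) → E →L[ℝ] F)
  have hO' : IsOpen O' := (hf.continuousOn_fderiv_of_isOpen hO (by simp)).isOpen_inter_preimage hO
    (ContinuousLinearEquiv.isOpen)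
  refine ⟨e₀.restrOpen O' hO', ?_, ?_, rfl, ?_⟩
  · rw [OpenPartialHomeomorph.restrOpen_source]
    exact ⟨hfx.mem_toOpenPartialHomeomorph_source hf' (by simp), hx₀, f', hf'.fderiv.symm⟩
  · rw [OpenPartialHomeomorph.restrOpen_source]
    exact fun y hy => hy.2.1
  · intro y hy
    have hs := (e₀.restrOpen O' hO').map_target hy
    rw [OpenPartialHomeomorph.restrOpen_source] at hs
    obtain ⟨-, hsO, g, hg⟩ := hs
    have hd := hf.contDiffAt (hO.mem_nhds hsO)
    refine ((e₀.restrOpen O' hO').contDiffAt_symm hy (f₀' := g) ?_ hd).contDiffWithinAt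
    rw [hg]
    exact (hd.differentiableAt (by simp)).hasFDerivAt

end Inverse

namespace LocalSurface

/-! ### Functions that are multiplied along the curves of a frame -/

/-- The linear isomorphism `(σ, μ) ↦ σ v + μ w` given by a basis of the plane. -/
def frameEquiv (v w : Plane) (h : area v w ≠ 0) : (ℝ × ℝ) ≃L[ℝ] Plane :=
  LinearEquiv.toContinuousLinearEquiv
  { toFun := fun z => z.1 • v + z.2 • w
    map_add' := fun y z => by simp only [Prod.fst_add, Prod.snd_add]; module
    map_smul' := fun c z => by
      simp only [Prod.smul_fst, Prod.smul_snd, smul_eq_mul, RingHom.id_apply]; module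
    invFun := fun z => (area z w / area v w, area v z / area v w)
    left_inv := fun z => by
      ext
      · rw [div_eq_iff h]; simp [area]; ring
      · rw [div_eq_iff h]; simp [area]; ring
    right_inv := fun z => by
      unfold area at *
      ext i
      fin_cases i
      · simp; rw [div_mul_eq_mul_div, div_mul_eq_mul_div, ← add_div, div_eq_iff h]; ring
      · simp; rw [div_mul_eq_mul_div, div_mul_eq_mul_div, ← add_div, div_eq_iff h]; ring }

@[simp]
theorem frameEquiv_apply (v w : Plane) (h : area v w ≠ 0) (z : ℝ × ℝ) :
    frameEquiv v w h z = z.1 • v + z.2 • w := rfl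

/-- A solution of a linear equation `f' = g f` that is not zero at `0` has no zeros. -/
theorem ne_zero_of_linear_ode {δ : ℝ} {f g : ℝ → ℝ} (hg : ContinuousOn g (Set.Ioo (-δ) δ))
    (hf : ∀ t ∈ Set.Ioo (-δ) δ, HasDerivAt f (g t * f t) t) (h0 : f 0 ≠ 0) {t : ℝ}
    (ht : t ∈ Set.Ioo (-δ) δ) : f t ≠ 0 := by
  intro h
  obtain ⟨τ, hτ, hτδ⟩ := exists_between (max_lt ht.2 (by linarith [ht.1] : -t < δ))
  obtain ⟨h1, h2⟩ := max_lt_iff.mp hτ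
  have hsub : Set.Icc (-τ) τ ⊆ Set.Ioo (-δ) δ := fun y hy =>
    ⟨by linarith [hy.1], by linarith [hy.2]⟩
  obtain ⟨K, hK⟩ := isCompact_Icc.exists_bound_of_continuousOn (hg.mono hsub)
  have hI : Set.Ioo (-τ) τ ⊆ Set.Ioo (-δ) δ := Set.Ioo_subset_Icc_self.trans hsub
  refine h0 (ODE_solution_unique_of_mem_Ioo (v := fun t y => g t * y) (s := fun _ => Set.univ)
    (K := K.toNNReal) (f := f) (g := fun _ => 0) (a := -τ) (b := τ) (t₀ := t)
    (fun y hy => ?_) ⟨by linarith, h1⟩ (fun y hy => ⟨hf y (hI hy), trivial⟩)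
    (fun y _ => ⟨by simpa using hasDerivAt_const y (0 : ℝ), trivial⟩) h
    (⟨by linarith, by linarith⟩ : (0 : ℝ) ∈ Set.Ioo (-τ) τ))
  refine LipschitzOnWith.of_dist_le_mul fun y₁ _ y₂ _ => ?_
  rw [Real.dist_eq, Real.dist_eq, ← mul_sub, abs_mul]
  have := (hK y (Set.Ioo_subset_Icc_self hy)).trans (Real.le_coe_toNNReal K)
  gcongr
  exact this

/-- Curves whose velocity is close to `v` are close to straight lines. -/
theorem norm_sub_sub_smul_le {δ c : ℝ} {α α' : ℝ → Plane} {v : Plane}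
    (hα : ∀ t ∈ Set.Ioo (-δ) δ, HasDerivAt α (α' t) t) (hv : ∀ t ∈ Set.Ioo (-δ) δ, ‖α' t - v‖ ≤ c)
    {t t' : ℝ} (ht : t ∈ Set.Ioo (-δ) δ) (ht' : t' ∈ Set.Ioo (-δ) δ) :
    ‖α t - α t' - (t - t') • v‖ ≤ c * |t - t'| := by
  have h := (convex_Ioo (-δ) δ).norm_image_sub_le_of_norm_hasDerivWithin_le
    (f := fun t => α t - t • v) (f' := fun t => α' t - v) (C := c)
    (fun s hs => ((hα s hs).sub (by simpa using (hasDerivAt_id s).smul_const v)).hasDerivWithinAt)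
    hv ht' ht
  rw [Real.norm_eq_abs] at h
  refine le_trans (le_of_eq ?_) h
  congr 1
  module

/-- If `a` is multiplied along the curves of `η` and `b` along the curves of `ξ`, and if
`a b = 0`, then `a` or `b` vanishes near any given point: the `η`-curve through a point where
`a ≠ 0` and the `ξ`-curve through a nearby point where `b ≠ 0` would meet. -/
theorem eq_zero_or_eq_zero_near {U : Set Plane} {x₀ : Plane} {ξ η : Plane → Plane}
    {a b α β : Plane → ℝ} (hU : IsOpen U) (hx₀ : x₀ ∈ U)
    (hξ : ContDiffOn ℝ ∞ ξ U) (hη : ContDiffOn ℝ ∞ η U) (h : area (ξ x₀) (η x₀) ≠ 0)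
    (ha : ContDiffOn ℝ ∞ a U) (hb : ContDiffOn ℝ ∞ b U)
    (hα : ContinuousOn α U) (hβ : ContinuousOn β U)
    (hηa : ∀ x ∈ U, der η a x = α x * a x) (hξb : ∀ x ∈ U, der ξ b x = β x * b x)
    (hab : ∀ x ∈ U, a x * b x = 0) :
    ∃ V, IsOpen V ∧ x₀ ∈ V ∧ V ⊆ U ∧ ((∀ x ∈ V, a x = 0) ∨ ∀ x ∈ V, b x = 0) := by
  set J := frameEquiv (ξ x₀) (η x₀) h with hJ
  have hN : 0 < ‖(J.symm : Plane →L[ℝ] ℝ × ℝ)‖ := J.norm_symm_pos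
  set N := ‖(J.symm : Plane →L[ℝ] ℝ × ℝ)‖₊ with hNdef
  have hN' : 0 < (N : ℝ) := hN
  let c : NNReal := N⁻¹ / 2
  have hc : (0 : ℝ) < c := by simp only [c, NNReal.coe_div, NNReal.coe_inv]; positivity
  obtain ⟨V, hVsub, hV, hxV⟩ := mem_nhds_iff.mp (Filter.inter_mem (hU.mem_nhds hx₀)
    (Filter.inter_mem
      ((hξ.continuousOn.continuousAt (hU.mem_nhds hx₀)).preimage_mem_nhds
        (Metric.closedBall_mem_nhds _ (half_pos hc)))
      ((hη.continuousOn.continuousAt (hU.mem_nhds hx₀)).preimage_mem_nhds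
        (Metric.closedBall_mem_nhds _ (half_pos hc)))))
  have hVU : V ⊆ U := fun y hy => (hVsub hy).1
  obtain ⟨r₁, hr₁, δ₁, hδ₁, F₁⟩ := exists_integralCurves hV (hξ.mono hVU) hxV
  obtain ⟨r₂, hr₂, δ₂, hδ₂, F₂⟩ := exists_integralCurves hV (hη.mono hVU) hxV
  let δ := min δ₁ δ₂ / 2
  have hδ : 0 < δ := by have := lt_min hδ₁ hδ₂; simp only [δ]; linarith
  have hI₁ : ∀ t, |t| ≤ δ → t ∈ Set.Ioo (-δ₁) δ₁ := fun t ht => by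
    have h1 := min_le_left δ₁ δ₂
    have := abs_le.mp ht
    simp only [δ] at this
    exact ⟨by linarith, by linarith⟩
  have hI₂ : ∀ t, |t| ≤ δ → t ∈ Set.Ioo (-δ₂) δ₂ := fun t ht => by
    have h1 := min_le_right δ₁ δ₂
    have := abs_le.mp ht
    simp only [δ] at this
    exact ⟨by linarith, by linarith⟩
  let r := min (min r₁ r₂) (c * δ / 2)
  have hr : 0 < r := lt_min (lt_min hr₁ hr₂) (by positivity)
  refine ⟨U ∩ Metric.ball x₀ r, hU.inter Metric.isOpen_ball, ⟨hx₀, Metric.mem_ball_self hr⟩,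
    Set.inter_subset_left, ?_⟩
  by_contra! hcon
  obtain ⟨⟨q, ⟨-, hq⟩, haq⟩, q', ⟨-, hq'⟩, hbq⟩ := hcon
  obtain ⟨y, hy0, -, hy⟩ := F₁ q' (Metric.mem_closedBall.mpr ((Metric.mem_ball.mp hq').le.trans
    ((min_le_left _ _).trans (min_le_left _ _))))
  obtain ⟨z, hz0, -, hz⟩ := F₂ q (Metric.mem_closedBall.mpr ((Metric.mem_ball.mp hq).le.trans
    ((min_le_left _ _).trans (min_le_right _ _))))
  -- along the two curves `b` and `a` stay different from zero
  have hb0 : ∀ t ∈ Set.Ioo (-δ₁) δ₁, b (y t) ≠ 0 := fun t ht => by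
    refine ne_zero_of_linear_ode (δ := δ₁) (f := fun t => b (y t)) (g := fun t => β (y t)) ?_ ?_
      (by rwa [hy0]) ht
    · exact hβ.comp (HasDerivAt.continuousOn fun t ht => (hy t ht).2) fun t ht => hVU (hy t ht).1
    · intro t ht
      have h1 := (diffAt_of_smooth hU hb (hVU (hy t ht).1)).hasFDerivAt.comp_hasDerivAt t (hy t ht).2
      rw [← hξb _ (hVU (hy t ht).1)]
      exact h1
  have ha0 : ∀ t ∈ Set.Ioo (-δ₂) δ₂, a (z t) ≠ 0 := fun t ht => by
    refine ne_zero_of_linear_ode (δ := δ₂) (f := fun t => a (z t)) (g := fun t => α (z t)) ?_ ?_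
      (by rwa [hz0]) ht
    · exact hα.comp (HasDerivAt.continuousOn fun t ht => (hz t ht).2) fun t ht => hVU (hz t ht).1
    · intro t ht
      have h1 := (diffAt_of_smooth hU ha (hVU (hz t ht).1)).hasFDerivAt.comp_hasDerivAt t (hz t ht).2
      rw [← hηa _ (hVU (hz t ht).1)]
      exact h1
  -- the two curves meet
  let g : ℝ × ℝ → Plane := fun s => y s.1 - z (-s.2)
  have hg : ApproximatesLinearOn g (J : (ℝ × ℝ) →L[ℝ] Plane) (Metric.closedBall 0 δ) c := by
    intro s hs s' hs'
    rw [mem_closedBall_zero_iff, Prod.norm_def, max_le_iff] at hs hs'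
    have h1 := norm_sub_sub_smul_le (v := ξ x₀) (c := c / 2) (fun t ht => (hy t ht).2)
      (fun t ht => by
        rw [← dist_eq_norm]; exact (hVsub (hy t ht).1).2.1) (hI₁ _ hs.1) (hI₁ _ hs'.1)
    have h2 := norm_sub_sub_smul_le (v := η x₀) (c := c / 2) (fun t ht => (hz t ht).2)
      (fun t ht => by
        rw [← dist_eq_norm]; exact (hVsub (hz t ht).1).2.2)
      (hI₂ (-s.2) (by simpa using hs.2)) (hI₂ (-s'.2) (by simpa using hs'.2))
    have h3 : g s - g s' - J (s - s') = (y s.1 - y s'.1 - (s.1 - s'.1) • ξ x₀)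
        - (z (-s.2) - z (-s'.2) - (-s.2 - -s'.2) • η x₀) := by
      simp only [g, hJ, frameEquiv_apply, Prod.fst_sub, Prod.snd_sub]
      module
    have h4 : |s.1 - s'.1| ≤ ‖s - s'‖ := norm_fst_le (s - s')
    have h5 : |-s.2 - -s'.2| ≤ ‖s - s'‖ := by
      rw [show -s.2 - -s'.2 = -(s.2 - s'.2) by ring, abs_neg]
      exact norm_snd_le (s - s')
    rw [ContinuousLinearEquiv.coe_coe, h3]
    calc _ ≤ _ := norm_sub_le _ _
      _ ≤ c / 2 * |s.1 - s'.1| + c / 2 * |-s.2 - -s'.2| := add_le_add h1 h2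
      _ ≤ c / 2 * ‖s - s'‖ + c / 2 * ‖s - s'‖ := by gcongr
      _ = c * ‖s - s'‖ := by ring
  have hsurj := hg.surjOn_closedBall_of_nonlinearRightInverse J.toNonlinearRightInverse hδ.le
    subset_rfl
  have h0 : (0 : Plane) ∈ Metric.closedBall (g 0)
      (((J.toNonlinearRightInverse.nnnorm : ℝ)⁻¹ - c) * δ) := by
    have e1 : ((J.toNonlinearRightInverse.nnnorm : ℝ)⁻¹ - c) = c := by
      change (N : ℝ)⁻¹ - c = c
      simp only [c, NNReal.coe_div, NNReal.coe_inv, NNReal.coe_ofNat]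
      ring
    rw [e1, Metric.mem_closedBall, dist_zero_left]
    have e2 : g 0 = q' - q := by simp [g, hy0, hz0]
    rw [e2, ← dist_eq_norm]
    have := dist_triangle_right q' q x₀
    have h1 := Metric.mem_ball.mp hq
    have h2 := Metric.mem_ball.mp hq'
    have h3 : r ≤ c * δ / 2 := min_le_right _ _
    linarith
  obtain ⟨s, hs, hgs⟩ := hsurj h0
  rw [mem_closedBall_zero_iff, Prod.norm_def, max_le_iff] at hs
  have hmeet : y s.1 = z (-s.2) := sub_eq_zero.mp hgs
  have hs2 : -s.2 ∈ Set.Ioo (-δ₂) δ₂ := hI₂ (-s.2) (by simpa using hs.2)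
  rcases mul_eq_zero.mp (hab (z (-s.2)) (hVU (hz _ hs2).1)) with h1 | h1
  · exact ha0 _ hs2 h1
  · exact hb0 _ (hI₁ _ hs.1) (by rw [hmeet]; exact h1)

end LocalSurface

namespace LocalSurface

/-! ### The normalized null frame of a surface with a double principal curvature -/

variable {L : LocalSurface} {x : Plane}

/-- A null frame whose second field consists of principal directions and has straight lines of
`R^4_2` as integral curves. -/
structure ScrollFrame (L : LocalSurface) (ξ η : Plane → Plane) : Prop extends
    NullFrame L ξ η where
  off_η : ∀ x ∈ L.U, NullFrame.off L η x = 0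
  der_η_η : ∀ x ∈ L.U, der η (der η L.φ) x = 0

theorem NullFrame.mono {ξ η : Plane → Plane} (E : NullFrame L ξ η) {V : Set Plane} (hV : IsOpen V)
    (hVU : V ⊆ L.U) : NullFrame (L.restrict hV hVU) ξ η where
  smooth_ξ := E.smooth_ξ.mono hVU
  smooth_η := E.smooth_η.mono hVU
  ξ_ξ x hx := E.ξ_ξ x (hVU hx)
  η_η x hx := E.η_η x (hVU hx)
  ξ_η x hx := E.ξ_η x (hVU hx)

theorem ScrollFrame.mono {ξ η : Plane → Plane} (E : ScrollFrame L ξ η) {V : Set Plane}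
    (hV : IsOpen V) (hVU : V ⊆ L.U) : ScrollFrame (L.restrict hV hVU) ξ η where
  toNullFrame := E.toNullFrame.mono hV hVU
  off_η x hx := E.off_η x (hVU hx)
  der_η_η x hx := E.der_η_η x (hVU hx)

/-- Rescaling turns the integral curves of a principal null field into straight lines. -/
theorem NullFrame.exists_scrollFrame {ξ η : Plane → Plane} (E : NullFrame L ξ η)
    (h : ∀ y ∈ L.U, off L η y = 0) (hx : x ∈ L.U) :
    ∃ (V : Set Plane) (hV : IsOpen V) (hVU : V ⊆ L.U) (ξ' η' : Plane → Plane), x ∈ V ∧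
      ScrollFrame (L.restrict hV hVU) ξ' η' := by
  let c := der ξ L.φ x
  let f : Plane → ℝ := fun y => ip c (der η L.φ y)
  have hf : ContDiffOn ℝ ∞ f L.U := smooth_ip contDiffOn_const (smooth_derφ E.smooth_η)
  have hfx : f x ≠ 0 := by
    change L.met x (ξ x) (η x) ≠ 0
    rw [E.ξ_η x hx]
    norm_num
  have sub : {y ∈ L.U | f y ≠ 0} ⊆ L.U := fun y hy => hy.1
  have hV := isOpen_ne_zero hf
  have E' : NullFrame (L.restrict hV sub) (fun y => f y • ξ y) (fun y => (f y)⁻¹ • η y) :=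
    { smooth_ξ := (hf.smul E.smooth_ξ).mono sub
      smooth_η := ((hf.mono sub).inv fun y hy => hy.2).smul (E.smooth_η.mono sub)
      ξ_ξ := fun y hy => by
        change L.met y _ _ = 0
        rw [met_smul_left, met_smul_right, E.ξ_ξ y hy.1]; ring
      η_η := fun y hy => by
        change L.met y _ _ = 0
        rw [met_smul_left, met_smul_right, E.η_η y hy.1]; ring
      ξ_η := fun y hy => by
        change L.met y _ _ = -1
        rw [met_smul_left, met_smul_right, E.ξ_η y hy.1, ← mul_assoc, mul_inv_cancel₀ hy.2]
        ring }
  have hoff : ∀ y ∈ (L.restrict hV sub).U, off (L.restrict hV sub) (fun y => (f y)⁻¹ • η y) y = 0 :=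
    fun y hy => by
      change -L.met y (L.S y ((f y)⁻¹ • η y)) ((f y)⁻¹ • η y) = 0
      have := h y hy.1
      rw [off] at this
      rw [S_smul, met_smul_left, met_smul_right]
      linear_combination (f y)⁻¹ * (f y)⁻¹ * this
  refine ⟨_, hV, sub, _, _, ⟨hx, hfx⟩, E', hoff, fun y hy => ?_⟩
  have h1 := E'.swap.der_ξ_ξ hy
  rw [hoff y hy, mul_zero, zero_smul, sub_zero] at h1
  -- `⟨c, dφ η⟩` is constant for the rescaled field
  have h2 : ∀ z ∈ (L.restrict hV sub).U, 
      ip c (der (fun y => (f y)⁻¹ • η y) (L.restrict hV sub).φ z) = 1 := by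
    intro z hz
    change ip c (der _ L.φ z) = 1
    rw [der, map_smul, ip_smul_right]
    exact inv_mul_cancel₀ hz.2
  have h3 := der_eq_zero (ξ := fun y => (f y)⁻¹ • η y) hV hy h2
  rw [der_ip (differentiableAt_const c) (diffU hy (smooth_derφ E'.smooth_η)), der_const,
    ip_zero_left, zero_add] at h3
  rw [h1, ip_smul_right] at h3
  rw [h2 y hy, mul_one] at h3
  rw [h1, h3, zero_smul]

/-- If the shape operator has a constant double eigenvalue, then near every point one of the two
null directions is principal, and it can be rescaled to have straight integral curves. -/
theorem exists_scrollFrame (hε : L.ε = 1) {k : ℝ} (ht : ∀ y ∈ L.U, L.t y = 2 * k)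
    (hd : ∀ y ∈ L.U, L.d y = k ^ 2) (hx : x ∈ L.U) :
    ∃ (V : Set Plane) (hV : IsOpen V) (hVU : V ⊆ L.U) (ξ η : Plane → Plane), x ∈ V ∧
      ScrollFrame (L.restrict hV hVU) ξ η := by
  obtain ⟨V, hV, hVU, ξ, η, hxV, E⟩ := exists_nullFrame hε hx
  have hxV' : x ∈ (L.restrict hV hVU).U := hxV
  have ht' : ∀ y ∈ (L.restrict hV hVU).U, (L.restrict hV hVU).t y = 2 * k :=
    fun y hy => ht y (hVU hy)
  have prod : ∀ y ∈ (L.restrict hV hVU).U, NullFrame.off (L.restrict hV hVU) ξ y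
      * NullFrame.off (L.restrict hV hVU) η y = 0 := fun y hy => by
    have h1 := E.d_eq hy
    have h2 : (L.restrict hV hVU).d y = k ^ 2 := hd y (hVU hy)
    rw [ht' y hy, h2] at h1
    linarith
  obtain ⟨V', hV', hxV'', hV'V, h⟩ := eq_zero_or_eq_zero_near (L.restrict hV hVU).isOpen hxV'
    E.smooth_ξ E.smooth_η (E.area_ne hxV') E.smooth_off E.swap.smooth_off
    (contDiffOn_const (c := (2 : ℝ)) |>.mul E.smooth_conn₂).continuousOn
    (contDiffOn_const (c := (2 : ℝ)) |>.mul E.swap.smooth_conn₂).continuousOn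
    (fun y hy => E.codazzi ht' hy) (fun y hy => E.swap.codazzi ht' hy) prod
  rcases h with h | h
  · obtain ⟨V₁, hV₁, hs, ξ', η', hx₁, E'⟩ :=
      (E.swap.mono hV' hV'V).exists_scrollFrame (x := x) h hxV''
    exact ⟨V₁, hV₁, hs.trans (hV'V.trans hVU), ξ', η', hx₁, E'⟩
  · obtain ⟨V₁, hV₁, hs, ξ', η', hx₁, E'⟩ :=
      (E.mono hV' hV'V).exists_scrollFrame (x := x) h hxV''
    exact ⟨V₁, hV₁, hs.trans (hV'V.trans hVU), ξ', η', hx₁, E'⟩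

end LocalSurface

namespace LocalSurface

/-! ### The ruled parametrization -/

theorem eq_of_hasDerivAt_zero {V : Type*} [NormedAddCommGroup V] [NormedSpace ℝ V] {f : ℝ → V}
    {δ : ℝ} (hf : ∀ t ∈ Set.Ioo (-δ) δ, HasDerivAt f 0 t) {t t' : ℝ} (ht : t ∈ Set.Ioo (-δ) δ)
    (ht' : t' ∈ Set.Ioo (-δ) δ) : f t = f t' :=
  isOpen_Ioo.is_const_of_deriv_eq_zero isPreconnected_Ioo
    (fun s hs => (hf s hs).differentiableAt.differentiableWithinAt) (fun s hs => (hf s hs).deriv)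
    ht ht'

namespace ScrollFrame

variable {L : LocalSurface} {x : Plane} {ξ η : Plane → Plane} (E : ScrollFrame L ξ η)
include E

theorem der_n_eq {k : ℝ} (ht : ∀ y ∈ L.U, L.t y = 2 * k) (hx : x ∈ L.U) :
    fderiv ℝ L.n x (ξ x) =
      -k • der ξ L.φ x - NullFrame.off L ξ x • der η L.φ x := by
  have h := E.der_n hx
  rw [ht x hx, mul_div_cancel_left₀ _ two_ne_zero] at h
  rw [neg_smul]
  exact h

/-- Along an integral curve of `ξ` the null frame and the normal form a Cartan frame. -/
theorem isCartanFramed (hε : L.ε = 1) {k : ℝ} (hk : k ≠ 0) (ht : ∀ y ∈ L.U, L.t y = 2 * k)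
    {δ : ℝ} {y : ℝ → Plane} (hy : ContDiffOn ℝ ∞ y (Set.Ioo (-δ) δ))
    (hy' : ∀ s ∈ Set.Ioo (-δ) δ, y s ∈ L.U ∧ HasDerivAt y (ξ (y s)) s) :
    IsCartanFramed (Set.Ioo (-δ) δ) k (fun s => NullFrame.off L ξ (y s)) (fun s => L.φ (y s))
      (fun s => der ξ L.φ (y s)) (fun s => der η L.φ (y s)) (fun s => L.n (y s)) where
  isOpen := isOpen_Ioo
  ordConnected := Set.ordConnected_Ioo
  a₀_ne_zero := hk
  smooth_κ := E.smooth_off.comp hy fun s hs => (hy' s hs).1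
  smooth_γ := L.smooth_φ.comp hy fun s hs => (hy' s hs).1
  smooth_A := (smooth_derφ E.smooth_ξ).comp hy fun s hs => (hy' s hs).1
  smooth_B := (smooth_derφ E.smooth_η).comp hy fun s hs => (hy' s hs).1
  smooth_C := L.smooth_n.comp hy fun s hs => (hy' s hs).1
  γ_mem s hs := L.φ_φ _ (hy' s hs).1
  A_γ s hs := (ip_comm _ _).trans (ip_φ_fderiv (hy' s hs).1 _)
  B_γ s hs := (ip_comm _ _).trans (ip_φ_fderiv (hy' s hs).1 _)
  C_γ s hs := L.n_φ _ (hy' s hs).1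
  A_A s hs := E.ξ_ξ _ (hy' s hs).1
  B_B s hs := E.η_η _ (hy' s hs).1
  A_B s hs := E.ξ_η _ (hy' s hs).1
  A_C s hs := (ip_comm _ _).trans (ip_n_fderiv (hy' s hs).1 _)
  B_C s hs := (ip_comm _ _).trans (ip_n_fderiv (hy' s hs).1 _)
  C_C s hs := (L.n_n _ (hy' s hs).1).trans hε
  deriv_γ s hs := (diff_φ (hy' s hs).1).hasFDerivAt.comp_hasDerivAt s (hy' s hs).2
  deriv_C s hs := by
    rw [← E.der_n_eq ht (hy' s hs).1]
    exact (diff_n (hy' s hs).1).hasFDerivAt.comp_hasDerivAt s (hy' s hs).2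

/-- The integral curves of `η` are parametrized straight lines. -/
theorem φ_eq_add_smul {δ : ℝ} {z : ℝ → Plane}
    (hz : ∀ u ∈ Set.Ioo (-δ) δ, z u ∈ L.U ∧ HasDerivAt z (η (z u)) u) {u : ℝ}
    (hu : u ∈ Set.Ioo (-δ) δ) : L.φ (z u) = L.φ (z 0) + u • der η L.φ (z 0) := by
  have h0 : (0 : ℝ) ∈ Set.Ioo (-δ) δ := by
    have := hu.1.trans hu.2
    exact ⟨by linarith, by linarith⟩
  have h1 : ∀ v ∈ Set.Ioo (-δ) δ, der η L.φ (z v) = der η L.φ (z 0) := fun v hv =>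
    eq_of_hasDerivAt_zero (f := fun v => der η L.φ (z v)) (fun w hw => by
      have h := (diffU (hz w hw).1 (smooth_derφ E.smooth_η)).hasFDerivAt.comp_hasDerivAt w
        (hz w hw).2
      have h2 := E.der_η_η _ (hz w hw).1
      rw [der] at h2
      rw [h2] at h
      exact h) hv h0
  have h2 : ∀ v ∈ Set.Ioo (-δ) δ,
      HasDerivAt (fun v => L.φ (z v) - v • der η L.φ (z 0)) 0 v := fun v hv => by
    have h := ((diff_φ (hz v hv).1).hasFDerivAt.comp_hasDerivAt v (hz v hv).2).sub
      ((hasDerivAt_id v).smul_const (der η L.φ (z 0)))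
    have h3 := h1 v hv
    rw [der] at h3
    rw [h3, one_smul, sub_self] at h
    exact h
  have h3 := eq_of_hasDerivAt_zero h2 hu h0
  simp only [zero_smul, sub_zero] at h3
  rw [← h3, sub_add_cancel]

/-- The coordinates `(s, u)` given by the integral curve of `ξ` through `x` and by the integral
curves of `η` that start on it. -/
theorem exists_ruled (hε : L.ε = 1) {k : ℝ} (hk : k ≠ 0) (ht : ∀ y ∈ L.U, L.t y = 2 * k)
    (hx : x ∈ L.U) : ∃ (I : Set ℝ) (κ : ℝ → ℝ) (γ A B C : ℝ → R42)
      (G : OpenPartialHomeomorph Plane (ℝ × ℝ)), IsCartanFramed I k κ γ A B C ∧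
      (∀ s ∈ I, ∃ y ∈ L.U, κ s = NullFrame.off L ξ y) ∧ x ∈ G.source ∧ G.source ⊆ L.U ∧
      G.target ⊆ I ×ˢ Set.univ ∧ ContDiffOn ℝ ∞ G G.source ∧ ContDiffOn ℝ ∞ G.symm G.target ∧
      ∀ y ∈ G.source, L.φ y = γ (G y).1 + (G y).2 • B (G y).1 := by
  obtain ⟨r, hr, δ, hδ, F⟩ := exists_integralCurves L.isOpen E.smooth_ξ hx
  obtain ⟨y, hy0, hys, hy⟩ := F x (Metric.mem_closedBall_self hr.le)
  have C := E.isCartanFramed hε hk ht hys hy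
  have h0 : (0 : ℝ) ∈ Set.Ioo (-δ) δ := ⟨by linarith, hδ⟩
  -- the tangential projection at `x` makes local diffeomorphisms out of `φ` and of `γ + u B`
  let ℓ : R42 →L[ℝ] Plane := (L.coordLin x).toContinuousLinearMap
  have hℓ : ∀ v, ℓ (fderiv ℝ L.φ x v) = v := coord_fderiv hx
  obtain ⟨h, hxh, hhU, hh, hhs⟩ := exists_smooth_localInverse (f := fun z => ℓ (L.φ z)) L.isOpen
    (ℓ.contDiff.comp_contDiffOn L.smooth_φ) hx (ContinuousLinearEquiv.refl ℝ Plane) (by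
      have h1 := ℓ.hasFDerivAt.comp x (diff_φ hx).hasFDerivAt
      have h2 : ℓ.comp (fderiv ℝ L.φ x) =
          (ContinuousLinearEquiv.refl ℝ Plane : Plane →L[ℝ] Plane) := by
        ext1 v; exact hℓ v
      rw [h2] at h1
      exact h1)
  have sI : ContDiffOn ℝ ∞ (fun z : ℝ × ℝ => z.1) (Set.Ioo (-δ) δ ×ˢ (Set.univ : Set ℝ)) :=
    contDiffOn_fst
  have sγ : ContDiffOn ℝ ∞ (fun z : ℝ × ℝ => L.φ (y z.1) + z.2 • der η L.φ (y z.1))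
      (Set.Ioo (-δ) δ ×ˢ (Set.univ : Set ℝ)) :=
    (C.smooth_γ.comp sI fun z hz => hz.1).add
      (contDiffOn_snd.smul (C.smooth_B.comp sI fun z hz => hz.1))
  obtain ⟨P, h0P, hPI, hP, hPs⟩ := exists_smooth_localInverse (x₀ := ((0 : ℝ), (0 : ℝ)))
    (f := fun z => ℓ (L.φ (y z.1) + z.2 • der η L.φ (y z.1)))
    (isOpen_Ioo.prod isOpen_univ) (ℓ.contDiff.comp_contDiffOn sγ) ⟨h0, trivial⟩
    (frameEquiv (ξ x) (η x) (E.area_ne hx)) (by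
      have e1 : HasFDerivAt (fun z : ℝ × ℝ => z.1) (ContinuousLinearMap.fst ℝ ℝ ℝ)
        ((0 : ℝ), (0 : ℝ)) := hasFDerivAt_fst
      have e2 : HasFDerivAt (fun z : ℝ × ℝ => z.2) (ContinuousLinearMap.snd ℝ ℝ ℝ)
        ((0 : ℝ), (0 : ℝ)) := hasFDerivAt_snd
      have hB := ((C.smooth_B.contDiffAt (isOpen_Ioo.mem_nhds h0)).differentiableAt
        (by simp)).hasDerivAt
      have h1 := HasFDerivAt.comp (g := fun s => L.φ (y s)) (f := fun z : ℝ × ℝ => z.1)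
        ((0 : ℝ), (0 : ℝ)) (C.deriv_γ 0 h0).hasFDerivAt e1
      have h2 := HasFDerivAt.comp (g := fun s => der η L.φ (y s)) (f := fun z : ℝ × ℝ => z.1)
        ((0 : ℝ), (0 : ℝ)) hB.hasFDerivAt e1
      have h3 := ℓ.hasFDerivAt.comp ((0 : ℝ), (0 : ℝ)) (h1.add (e2.smul h2))
      refine h3.congr_fderiv (ContinuousLinearMap.ext fun z => ?_)
      change ℓ (z.1 • der ξ L.φ (y 0)
        + ((0 : ℝ) • (z.1 • _) + z.2 • der η L.φ (y 0))) = z.1 • ξ x + z.2 • η x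
      rw [hy0, zero_smul, zero_add, map_add, map_smul, map_smul, der, der, hℓ, hℓ])
  obtain ⟨r', hr', δ', hδ', F'⟩ := exists_integralCurves h.open_source
    (E.smooth_η.mono hhU) hxh
  -- the box of the points `(s, u)` reached by curves that stay in the domain of `h`
  have hyo : IsOpen (Set.Ioo (-δ) δ ∩ y ⁻¹' Metric.ball x r') :=
    hys.continuousOn.isOpen_inter_preimage isOpen_Ioo Metric.isOpen_ball
  let Q := P.restrOpen _ (hyo.prod (isOpen_Ioo (a := -δ') (b := δ')))
  have hQ0 : ((0 : ℝ), (0 : ℝ)) ∈ Q.source := by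
    rw [OpenPartialHomeomorph.restrOpen_source]
    refine ⟨h0P, ⟨h0, ?_⟩, by linarith, hδ'⟩
    change y 0 ∈ Metric.ball x r'
    rw [hy0]
    exact Metric.mem_ball_self hr'
  have hQval : ∀ z, Q z = ℓ (L.φ (y z.1) + z.2 • der η L.φ (y z.1)) := fun z => congrFun hP z
  have hhval : ∀ z, h z = ℓ (L.φ z) := fun z => congrFun hh z
  have hQP : Q.target ⊆ P.target := fun z hz => hz.1
  have hQsub : Q.source ⊆ P.source := fun z hz => by
    rw [OpenPartialHomeomorph.restrOpen_source] at hz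
    exact hz.1
  refine ⟨_, _, _, _, _, _, h.trans Q.symm, C, fun s hs => ⟨y s, (hy s hs).1, rfl⟩, ?_, ?_, ?_, ?_,
    ?_, ?_⟩
  · rw [OpenPartialHomeomorph.trans_source]
    refine ⟨hxh, ?_⟩
    change h x ∈ Q.target
    have e : h x = Q (0, 0) := by
      rw [hhval, hQval, hy0, zero_smul, add_zero]
    rw [e]
    exact Q.map_source hQ0
  · rw [OpenPartialHomeomorph.trans_source]
    exact fun z hz => hhU hz.1
  · rw [OpenPartialHomeomorph.trans_target]
    exact fun z hz => hPI (hQsub hz.1)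
  · have : ContDiffOn ℝ ∞ h h.source := by
      rw [hh]
      exact (ℓ.contDiff.comp_contDiffOn L.smooth_φ).mono hhU
    rw [OpenPartialHomeomorph.trans_source]
    exact (hPs.mono hQP).comp (this.mono Set.inter_subset_left) fun z hz => hz.2
  · have : ContDiffOn ℝ ∞ Q Q.source := by
      have e : ⇑Q = fun z => ℓ (L.φ (y z.1) + z.2 • der η L.φ (y z.1)) := hP
      rw [e]
      exact (ℓ.contDiff.comp_contDiffOn sγ).mono fun z hz => hPI (hQsub hz)
    rw [OpenPartialHomeomorph.trans_target]
    exact hhs.comp (this.mono Set.inter_subset_left) fun z hz => hz.2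
  · intro z hz
    rw [OpenPartialHomeomorph.trans_source] at hz
    obtain ⟨hz1, hz2⟩ := hz
    change L.φ z = L.φ (y (Q.symm (h z)).1) + (Q.symm (h z)).2 • der η L.φ (y (Q.symm (h z)).1)
    have hz3 : h z ∈ Q.target := hz2
    have e := Q.right_inv hz3
    have hm := Q.map_target hz3
    set w := Q.symm (h z)
    rw [OpenPartialHomeomorph.restrOpen_source] at hm
    obtain ⟨-, ⟨-, hw1⟩, hw2⟩ := hm
    obtain ⟨c, hc0, -, hc⟩ := F' (y w.1) (Metric.ball_subset_closedBall hw1)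
    have hcφ := E.φ_eq_add_smul (fun u hu => ⟨hhU (hc u hu).1, (hc u hu).2⟩) hw2
    rw [hc0] at hcφ
    have hcz : c w.2 = z := h.injOn (hc _ hw2).1 hz1 (by
      rw [← e, hQval, hhval, hcφ])
    rw [← hcz, hcφ]

end ScrollFrame
end LocalSurface

/-! ### Non-flat `B`-scrolls -/

namespace OrientedSurface

variable {M : Type*} [TopologicalSpace M] [ChartedSpace (EuclideanSpace ℝ (Fin 2)) M]
  [IsManifold (𝓡 2) ∞ M] (W : OrientedSurface M)

theorem isRuledNear {p : M} {I : Set ℝ} {γ B : ℝ → R42}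
    (G : OpenPartialHomeomorph Plane (ℝ × ℝ)) (hp : extChartAt (𝓡 2) p p ∈ G.source)
    (hI : G.target ⊆ I ×ˢ Set.univ) (hG : ContDiffOn ℝ ∞ G G.source)
    (hG' : ContDiffOn ℝ ∞ G.symm G.target)
    (h : ∀ y ∈ G.source, (W.loc p).φ y = γ (G y).1 + (G y).2 • B (G y).1) :
    W.IsRuledNear p I γ B := by
  refine ⟨(chartAt (EuclideanSpace ℝ (Fin 2)) p).trans G, ?_, ?_, ?_, ?_, ?_⟩
  · rw [OpenPartialHomeomorph.trans_source]
    exact ⟨mem_chart_source _ p, hp⟩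
  · rw [OpenPartialHomeomorph.trans_target]
    exact fun z hz => hI hz.1
  · rw [OpenPartialHomeomorph.trans_source]
    exact hG.contMDiffOn.comp ((contMDiffOn_extChartAt (I := 𝓡 2) (x := p)).mono fun z hz => hz.1)
      fun z hz => hz.2
  · rw [OpenPartialHomeomorph.trans_target]
    refine (contMDiffOn_extChartAt_symm (I := 𝓡 2) p).comp
      (hG'.contMDiffOn.mono fun z hz => hz.1) fun z hz => ?_
    rw [extChartAt_target]
    simpa using hz.2
  · intro q hq
    rw [OpenPartialHomeomorph.trans_source] at hq
    have hq1 : q ∈ (extChartAt (𝓡 2) p).source := by rw [extChartAt_source]; exact hq.1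
    rw [← inChart_apply hq1 W.ψ]
    exact h _ hq.2

theorem isUmbilical_of_loc {p : M} {k : ℝ}
    (h : ∀ v, (W.loc p).S (extChartAt (𝓡 2) p p) v = k • v) : W.IsUmbilical p := by
  refine ⟨k, LinearMap.ext fun X => (tau_bijective (mem_extChartAt_source (I := 𝓡 2) p)).1 ?_⟩
  rw [W.tau_shape (mem_extChartAt_source (I := 𝓡 2) p), h]
  exact (map_smul (tau p p) k X).symm

theorem isNonflatBScroll {k : ℝ} (hε : W.ε = 1) (hk : k ≠ 0) (hk1 : k ^ 2 ≠ 1)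
    (ht : ∀ q, W.tr q = 2 * k) (hd : ∀ q, W.dt q = k ^ 2) (hu : ∃ p, ¬ W.IsUmbilical p) :
    W.IsNonflatBScroll := by
  refine ⟨fun p => ?_, hu, k, fun p => ?_⟩
  · rw [W.gaussCurv_eq, hε, hd, one_mul]
    exact sub_ne_zero.2 hk1
  have hx : extChartAt (𝓡 2) p p ∈ (W.loc p).U := W.mem_loc (mem_extChartAt_source (I := 𝓡 2) p)
  obtain ⟨V, hV, hVU, ξ, η, hxV, E⟩ := LocalSurface.exists_scrollFrame (L := W.loc p) hε
    (W.t_eq ht p) (W.d_eq hd p) hx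
  have ht' : ∀ y ∈ V, (W.loc p).t y = 2 * k := fun y hy => W.t_eq ht p y (hVU hy)
  by_cases hp : W.IsUmbilical p
  · obtain ⟨I, κ, γ, A, B, C, G, F, -, hxG, -, hI, hG, hG', h⟩ := E.exists_ruled hε hk ht' hxV
    exact ⟨I, κ, γ, A, B, C, F, W.isRuledNear G hxG hI hG hG' h, fun h => absurd hp h⟩
  · have hoff : LocalSurface.NullFrame.off ((W.loc p).restrict hV hVU) ξ (extChartAt (𝓡 2) p p)
        ≠ 0 := fun h0 => hp (W.isUmbilical_of_loc (k := k) fun v => by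
      have h1 := E.S_ξ hxV
      have h2 := E.swap.S_ξ hxV
      rw [h0, zero_smul, add_zero] at h1
      rw [E.off_η _ hxV, zero_smul, add_zero] at h2
      have h3 : ((W.loc p).restrict hV hVU).t (extChartAt (𝓡 2) p p) = 2 * k := ht' _ hxV
      rw [h3, mul_div_cancel_left₀ _ two_ne_zero] at h1 h2
      change ((W.loc p).restrict hV hVU).S _ _ = _
      rw [E.expand hxV v, LocalSurface.S_sub, LocalSurface.S_smul, LocalSurface.S_smul, h1, h2]
      module)
    have E' := E.mono (LocalSurface.isOpen_ne_zero E.smooth_off) fun y hy => hy.1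
    obtain ⟨I, κ, γ, A, B, C, G, F, hκ, hxG, -, hI, hG, hG', h⟩ :=
      E'.exists_ruled hε hk (fun y hy => ht' y hy.1) ⟨hxV, hoff⟩
    refine ⟨I, κ, γ, A, B, C, F, W.isRuledNear G hxG hI hG hG' h, fun _ s hs => ?_⟩
    obtain ⟨y, hy, e⟩ := hκ s hs
    rw [e]
    exact hy.2

end OrientedSurface

end AdSSurface

end

theorem theoremC {M : Type*} [TopologicalSpace M] [ConnectedSpace M]
    [ChartedSpace (EuclideanSpace ℝ (Fin 2)) M] [IsManifold (𝓡 2) ∞ M]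
    (W : AdSSurface.OrientedSurface M) (h : W.IsL1TwoType) :
    W.IsOpenPortionOfProduct ∨
    W.IsNonflatBScroll ∨
    ((¬ ∃ c : ℝ, ∀ p, W.meanCurv p = c) ∧
      (¬ ∃ c : ℝ, ∀ p, W.gaussCurv p = c) ∧
      (¬ ∃ c : ℝ, ∀ p, Module.End.HasEigenvalue (W.shape p) c)) := by
  obtain ⟨a, ψ₁, ψ₂, l₁, l₂, s₁, s₂, n₁, n₂, hl, hs, e₁, e₂⟩ := h
  have T := fun p => W.twoType_loc s₁ s₂ hs e₁ e₂ p
  by_cases hc : (∃ c : ℝ, ∀ p, W.meanCurv p = c) ∨ (∃ c : ℝ, ∀ p, W.gaussCurv p = c) ∨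
      ∃ c : ℝ, ∀ p, Module.End.HasEigenvalue (W.shape p) c
  · obtain ⟨t, d, ht, hd⟩ := W.tr_dt_const T hc
    rcases W.disc_cases T n₁ n₂ hl ht hd with hD | ⟨hD, hε, hd1, hu⟩
    · left
      have hsq := Real.sq_sqrt hD.le
      have hpos := Real.sqrt_pos.2 hD
      set r := √(t ^ 2 - 4 * d)
      refine W.isOpenPortionOfProduct (k := (t + r) / 2) (l := (t - r) / 2)
        (fun h => by linarith) (fun q => ?_) fun q => ?_
      · rw [ht]; ring
      · rw [hd]; linear_combination (1 / 4 : ℝ) * hsq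
    · right; left
      have hd0 := W.dt_ne_zero T n₁ n₂ hl ht hd
      have hk : d = (t / 2) ^ 2 := by linear_combination (-1 / 4 : ℝ) * hD
      refine W.isNonflatBScroll (k := t / 2) hε (fun h0 => hd0 ?_) (hk ▸ hd1) (fun q => ?_)
        (fun q => (hd q).trans hk) hu
      · rw [hk, h0]; norm_num
      · rw [ht]; ring
  · right; right
    exact ⟨fun h => hc (Or.inl h), fun h => hc (Or.inr (Or.inl h)),
      fun h => hc (Or.inr (Or.inr h))⟩
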